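/- Let $D$ be a reduced alternating diagram of a prime link (nonempty, non-split, not the unknot, and such that in every decomposition as a connected sum one summand is the unknot). For each crossing with over-arc $b$ and under-arcs $a$ and $c$ consider the relation $2b-a-c=0$. Let $Col(D)$ be the abelian group generated by the arcs of $D$ with these relations; a Fox $k$-coloring of $D$ is a map from the arcs to $\mathbb Z/k$ satisfying them. Then every arc of $D$ is the over-arc $a_i$ of exactly one crossing $c_i$ $(1\le i\le n)$. Order the crossings $c_1,\dots,c_n$ arbitrarily. Let $C'(D)$ be the $n\times n$ integer matrix whose $i$-th row consists of the coefficients of the relation at $c_i$ with respect to $a_1,\dots,a_n$. Let $C(D)$ be $C'(D)$ without its last row and last column, let $Col^{red}(D)$ be the quotient of $Col(D)$ by the infinite cyclic group generated by the base arc $a_n$, and let $n_1$ be its annihilator (the least positive integer that annihilates the group, i.e. its largest invariant factor). Then $\det C(D)\neq 0$, the number $n_1$ exists, the matrix $L_{n_1}(D)=n_1\,C(D)^{-1}$ has integer entries, and each of its columns taken modulo $n_1$, completed by the color $0$ on the base arc $a_n$, is a Fox $n_1$-coloring of $D$. For any two distinct arcs of $D$, one of these column colorings gives them different colors. Consequently,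 (a) distinct arcs of $D$ represent distinct elements of $Col(D)$, and (b) with $\delta(D)=|\det C(D)|$, there are finitely many Fox $\delta(D)$-colorings $y_1,\dots,y_t$ of $D$ such that any two distinct arcs get different colors in some $y_k$. -/

import Mathlib

/-- Combinatorial data of a link diagram. Strand pieces ("edges") carry labels in `ℕ`.
A crossing lists the labels of its four ends in counterclockwise order, the ends `0` and `2` being
the two ends of the under-strand and the ends `1` and `3` those of the over-strand.
A marker is a point on a strand away from the crossings; it lists the labels of the two pieces that
meet there. A circle without crossings is a cyclic chain of markers, for example one marker
`![a, a]`. -/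
structure Code where
  crossings : List (Fin 4 → ℕ)
  markers : List (Fin 2 → ℕ)

namespace Code

/-- The crossings of the diagram, as an index type. -/
abbrev Crossing (C : Code) : Type := Fin C.crossings.length

/-- The ends of edges at crossings and at markers. -/
abbrev Dart (C : Code) : Type :=
  (Fin C.crossings.length × Fin 4) ⊕ (Fin C.markers.length × Fin 2)

/-- The label of the edge to which an end belongs. -/
def label (C : Code) : C.Dart → ℕ
  | Sum.inl p => C.crossings.get p.1 p.2
  | Sum.inr p => C.markers.get p.1 p.2

/-- The next end, counterclockwise, at the same crossing or marker. -/
def turn (C : Code) : C.Dart → C.Dart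
  | Sum.inl p => Sum.inl (p.1, p.2 + 1)
  | Sum.inr p => Sum.inr (p.1, p.2 + 1)

/-- Every edge has exactly two ends. -/
def IsClosed (C : Code) : Prop :=
  ∀ d : C.Dart, ∃! d' : C.Dart, d' ≠ d ∧ C.label d' = C.label d

/-- Walk from the end `d` to the other end `d'` of its edge and turn to the next end there.
The walk keeps one region of the diagram at its side. The end `d` stands for the corner between `d`
and its clockwise neighbour at the same crossing or marker. -/
def FaceStep (C : Code) (d e : C.Dart) : Prop :=
  ∃ d' : C.Dart, d' ≠ d ∧ C.label d' = C.label d ∧ e = C.turn d'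

/-- The faces of the underlying graph, each connected piece being drawn on its own sphere. -/
def Face (C : Code) : Type := Quot C.FaceStep

/-- Two ends on one edge, or consecutive ends at one crossing or marker. -/
def PieceStep (C : Code) (d e : C.Dart) : Prop :=
  C.label d = C.label e ∨ e = C.turn d

/-- The connected pieces of the underlying graph. -/
def Piece (C : Code) : Type := Quot C.PieceStep

/-- Euler's formula `V + F = E + 2 * (number of pieces)`: every connected piece of the graph has
genus zero. With `n` crossings and `m` markers, `V = n + m` and `E = (4 * n + 2 * m) / 2`. -/
def IsPlanar (C : Code) : Prop :=
  (C.crossings.length + C.markers.length) + Nat.card C.Face =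
    (2 * C.crossings.length + C.markers.length) + 2 * Nat.card C.Piece

/-- Identify the label `b` with the label `a`. -/
def mergeLabel (a b : ℕ) (x : ℕ) : ℕ := if x = b then a else x

/-- Elementary moves. The first five only change the description of one and the same planar
diagram, the others are the Reidemeister moves, each given by the two local pictures. -/
inductive Move : Code → Code → Prop
  /-- The order in which crossings and markers are listed is irrelevant. -/
  | perm {R R' : List (Fin 4 → ℕ)} {S S' : List (Fin 2 → ℕ)} (hR : R.Perm R') (hS : S.Perm S') :
      Move ⟨R, S⟩ ⟨R', S'⟩
  /-- The names of the labels are irrelevant. -/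
  | relabel (f : Equiv.Perm ℕ) (R : List (Fin 4 → ℕ)) (S : List (Fin 2 → ℕ)) :
      Move ⟨R, S⟩ ⟨R.map (fun v => f ∘ v), S.map (fun v => f ∘ v)⟩
  /-- A crossing may be read from either end of its under-strand. -/
  | halfTurn (a b c d : ℕ) (R : List (Fin 4 → ℕ)) (S : List (Fin 2 → ℕ)) :
      Move ⟨![a, b, c, d] :: R, S⟩ ⟨![c, d, a, b] :: R, S⟩
  /-- A marker may be read in either direction. -/
  | flip (a b : ℕ) (R : List (Fin 4 → ℕ)) (S : List (Fin 2 → ℕ)) :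
      Move ⟨R, ![a, b] :: S⟩ ⟨R, ![b, a] :: S⟩
  /-- A marker between two different edges may be deleted; the two edges become one. -/
  | unmark (a b : ℕ) (hab : a ≠ b) (R : List (Fin 4 → ℕ)) (S : List (Fin 2 → ℕ)) :
      Move ⟨R, ![a, b] :: S⟩
        ⟨R.map (fun v => mergeLabel a b ∘ v), S.map (fun v => mergeLabel a b ∘ v)⟩
  /-- First Reidemeister move, for a kink of either sign. -/
  | r1 (a b c : ℕ) (R : List (Fin 4 → ℕ)) (S : List (Fin 2 → ℕ)) :
      Move ⟨![a, a, b, c] :: R, S⟩ ⟨R, ![b, c] :: S⟩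
  | r1_mirror (a b c : ℕ) (R : List (Fin 4 → ℕ)) (S : List (Fin 2 → ℕ)) :
      Move ⟨![b, a, a, c] :: R, S⟩ ⟨R, ![b, c] :: S⟩
  /-- Second Reidemeister move: the under-strand `p, m, q` and the over-strand `r, n, s` bound a
  bigon with sides `m` and `n`. -/
  | r2 (p m q r n s : ℕ) (R : List (Fin 4 → ℕ)) (S : List (Fin 2 → ℕ)) :
      Move ⟨![p, n, m, r] :: ![m, n, q, s] :: R, S⟩ ⟨R, ![p, q] :: ![r, s] :: S⟩
  /-- Third Reidemeister move. The six ends of the local picture are, counterclockwise,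
  `t₁, u₁, v₁, t₂, u₂, v₂`, and the triangle has the sides `t, u, v`. The strand `t₁ t₂` is on top
  and is moved across the crossing of the other two; here `u₁ u₂` passes over `v₁ v₂`. -/
  | r3 (t₁ u₁ v₁ t₂ u₂ v₂ t u v : ℕ) (R : List (Fin 4 → ℕ)) (S : List (Fin 2 → ℕ)) :
      Move ⟨![u₂, t, u, t₂] :: ![v₂, t₁, v, t] :: ![v, u₁, v₁, u] :: R, S⟩
        ⟨![u, t₁, u₁, t] :: ![v, t, v₁, t₂] :: ![v₂, u, v, u₂] :: R, S⟩
  /-- Third Reidemeister move, in the case where `v₁ v₂` passes over `u₁ u₂`. -/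
  | r3_mirror (t₁ u₁ v₁ t₂ u₂ v₂ t u v : ℕ) (R : List (Fin 4 → ℕ)) (S : List (Fin 2 → ℕ)) :
      Move ⟨![u₂, t, u, t₂] :: ![v₂, t₁, v, t] :: ![u, v, u₁, v₁] :: R, S⟩
        ⟨![u, t₁, u₁, t] :: ![v, t, v₁, t₂] :: ![u₂, v₂, u, v] :: R, S⟩

end Code

/-- A (planar, unoriented) link diagram, up to planar isotopy on the sphere. -/
structure LinkDiagram extends Code where
  closed : toCode.IsClosed
  planar : toCode.IsPlanar

namespace LinkDiagram

/-- Two diagrams represent the same (unoriented) link: they are joined by a finite sequence of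
Reidemeister moves through link diagrams. -/
def SameLink (D D' : LinkDiagram) : Prop :=
  Relation.EqvGen (fun E E' : LinkDiagram => Code.Move E.toCode E'.toCode) D D'

/-- The circle without crossings. -/
def circle : LinkDiagram where
  crossings := []
  markers := [![0, 0]]
  closed := by unfold Code.IsClosed ExistsUnique; decide
  planar := by
    have e : Nat.card (Code.mk [] [![0, 0]]).Face = 2 := by
      have h : ∀ d d' : (Code.mk [] [![0, 0]]).Dart,
          (Code.mk [] [![0, 0]]).FaceStep d d' → d = d' := by
        unfold Code.FaceStep; decide
      have : Nat.card (Code.mk [] [![0, 0]]).Face = Nat.card (Code.mk [] [![0, 0]]).Dart :=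
        Nat.card_congr
          { toFun := Quot.lift id h
            invFun := Quot.mk _
            left_inv := by rintro ⟨d⟩; rfl
            right_inv := fun _ => rfl }
      rw [this, Nat.card_eq_fintype_card]; rfl
    have p : Nat.card (Code.mk [] [![0, 0]]).Piece = 1 := by
      rw [Nat.card_eq_one_iff_unique]
      refine ⟨⟨?_⟩, ⟨Quot.mk _ (Sum.inr (0, 0))⟩⟩
      rintro ⟨d⟩ ⟨d'⟩
      refine Quot.sound (Or.inl ?_)
      revert d d'; decide
    unfold Code.IsPlanar
    rw [e, p]; rfl

/-- The link represented by the diagram is the unknot. -/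
def IsUnknot (D : LinkDiagram) : Prop := D.SameLink circle

/-- The link represented by the diagram is a split union of two nonempty links. -/
def IsSplit (D : LinkDiagram) : Prop :=
  ∃ D' D₁ D₂ : LinkDiagram, D.SameLink D' ∧ Nonempty D₁.Dart ∧ Nonempty D₂.Dart ∧
    D'.crossings = D₁.crossings ++ D₂.crossings ∧ D'.markers = D₁.markers ++ D₂.markers

/-- `D` is a connected sum of `D₁` and `D₂`: both are cut open at a marked point, and the ends
`a, b` of the first are joined to the ends `c, d` of the second. (As all three are link diagrams,
the labels used in `D₁` and in `D₂` are disjoint.) -/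
def IsConnectedSum (D D₁ D₂ : LinkDiagram) : Prop :=
  ∃ (a b c d : ℕ) (S₁ S₂ : List (Fin 2 → ℕ)),
    D₁.markers = ![a, b] :: S₁ ∧ D₂.markers = ![c, d] :: S₂ ∧
    D.crossings = D₁.crossings ++ D₂.crossings ∧
    D.markers = ![a, c] :: ![b, d] :: (S₁ ++ S₂)

/-- The link represented by the diagram is prime: it is nonempty, not the unknot, not split, and
in every decomposition as a connected sum one of the summands is the unknot. -/
def RepresentsPrimeLink (D : LinkDiagram) : Prop :=
  Nonempty D.Dart ∧ ¬ D.IsUnknot ∧ ¬ D.IsSplit ∧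
    ∀ D' D₁ D₂ : LinkDiagram, D.SameLink D' → IsConnectedSum D' D₁ D₂ →
      D₁.IsUnknot ∨ D₂.IsUnknot

/-- No crossing is nugatory: there is no circle on the sphere that meets the diagram only in one
crossing and separates the four ends there into two pairs of neighbours. Such a circle exists
exactly if two opposite corners at the crossing lie in the same face. -/
def IsReduced (D : LinkDiagram) : Prop :=
  ∀ (c : D.Crossing) (k : Fin 4),
    ¬ Relation.EqvGen D.FaceStep (Sum.inl (c, k)) (Sum.inl (c, k + 2))

/-- Two ends on one edge, or the two ends at one marker. -/
def StrandStep (D : LinkDiagram) (d e : D.Dart) : Prop :=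
  D.label d = D.label e ∨ ∃ m, d = Sum.inr (m, 0) ∧ e = Sum.inr (m, 1)

/-- Along each component, over-crossings and under-crossings alternate: whenever two ends at
crossings are joined by a strand that passes no other crossing, one of them is an end of an
over-strand and the other one is an end of an under-strand. -/
def IsAlternating (D : LinkDiagram) : Prop :=
  ∀ (c c' : D.Crossing) (k k' : Fin 4), (c, k) ≠ (c', k') →
    Relation.EqvGen D.StrandStep (Sum.inl (c, k)) (Sum.inl (c', k')) →
    (Odd k.val ↔ Even k'.val)

/-- One step along an arc: along an edge, through a marker, or over a crossing. -/
def ArcStep (D : LinkDiagram) (d e : D.Dart) : Prop :=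
  D.StrandStep d e ∨ ∃ c, d = Sum.inl (c, 1) ∧ e = Sum.inl (c, 3)

/-- The arcs of the diagram, from under-crossing to under-crossing (or closed). -/
def Arc (D : LinkDiagram) : Type := Quot D.ArcStep

/-- The arc through an end. -/
def arcOf (D : LinkDiagram) (d : D.Dart) : D.Arc := Quot.mk _ d

/-- The over-arc at a crossing. -/
def overArc (D : LinkDiagram) (c : D.Crossing) : D.Arc := D.arcOf (Sum.inl (c, 1))

/-- The first under-arc at a crossing. -/
def underArc (D : LinkDiagram) (c : D.Crossing) : D.Arc := D.arcOf (Sum.inl (c, 0))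

/-- The second under-arc at a crossing. -/
def underArc' (D : LinkDiagram) (c : D.Crossing) : D.Arc := D.arcOf (Sum.inl (c, 2))

/-- Fox `k`-colorings. -/
def IsFoxColoring (D : LinkDiagram) (k : ℕ) (f : D.Arc → ZMod k) : Prop :=
  ∀ c : D.Crossing, 2 * f (D.overArc c) - f (D.underArc c) - f (D.underArc' c) = 0

/-- The relation `2b - a - c` of a crossing, in the free abelian group on the arcs. -/
noncomputable def relator (D : LinkDiagram) (c : D.Crossing) : D.Arc →₀ ℤ :=
  Finsupp.single (D.overArc c) 2 - Finsupp.single (D.underArc c) 1 -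
    Finsupp.single (D.underArc' c) 1

/-- The universal group of Fox colorings. -/
abbrev Col (D : LinkDiagram) : Type :=
  (D.Arc →₀ ℤ) ⧸ Submodule.span ℤ (Set.range D.relator)

/-- The element of `Col D` given by an arc. -/
noncomputable def colClass (D : LinkDiagram) (a : D.Arc) : D.Col :=
  Submodule.Quotient.mk (Finsupp.single a 1)

/-- The reduced group of Fox colorings: the quotient of `Col D` by the infinite cyclic group
generated by a base arc. -/
abbrev ColRed (D : LinkDiagram) (a : D.Arc) : Type :=
  D.Col ⧸ Submodule.span ℤ {D.colClass a}

/-- The annihilator `n₁` of the reduced group of Fox colorings, that is, the least positive integer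
that annihilates the group (and `0` if there is none). -/
noncomputable def annihilator (D : LinkDiagram) (a : D.Arc) : ℕ :=
  AddMonoid.exponent (D.ColRed a)

/-- The crossing matrix: row `i` is the relation of the crossing `i`, and column `j` belongs to the
over-arc at the crossing `j`. -/
noncomputable def crossingMatrix (D : LinkDiagram) : Matrix D.Crossing D.Crossing ℤ :=
  fun i j => D.relator i (D.overArc j)

/-- The reduced crossing matrix: row and column of the base crossing `b` are removed. (In a listing
of the crossings, `b` is the last one.) -/
noncomputable def reducedCrossingMatrix (D : LinkDiagram) (b : D.Crossing) :
    Matrix {i : D.Crossing // i ≠ b} {i : D.Crossing // i ≠ b} ℤ :=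
  D.crossingMatrix.submatrix Subtype.val Subtype.val

end LinkDiagram

/-! ### Directed graphs in which every vertex has out-degree two -/

/-! Make every crossing a vertex, and let it send one arrow for each of its two under-ends to the
crossing where that under-arc passes over. In a connected alternating diagram without markers each
arc passes over exactly one crossing, so arcs correspond to vertices, and every vertex has two
outgoing and two incoming arrows. The crossing matrix is the Laplacian `lap` of this overpass graph,
acting on row vectors.

The heart is a maximum principle (`exists_argmax`, `exists_cut_le_one`). If an integral potential
has Laplacian `e_i - e_i'`, then the set where it is maximal misses `i'` and is left by at most one
arrow. So if every nonempty proper set of vertices is left by two arrows, no difference of two arcs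
is an integral combination of the rows (`not_lap`). This is injectivity of arcs into `Col`. It also
separates arcs by colors: if two rows `i`, `i'` of `L` agreed modulo `n₁`, their difference would be
`n₁ u` with `u` integral, and `L C = n₁` would give `u C = e_i - e_i'` away from the base.
Nonvanishing of the determinant needs only that one arrow leaves each such set.

The two arrows come from primeness. Non-splitness makes the diagram connected once markers are
deleted, so at least one arrow leaves. If exactly one arrow leaves `T`, balance of the graph shows
that exactly two edges of the diagram leave `T`, and cutting them exhibits a connected sum. Both
summands are knotted (`TwoCut.not_isUnknot`): a diagram of the unknot has only constant colorings in
any abelian group (`Rigid`, invariant under all moves), whereas the capped summand has a connected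
overpass graph with at most one loop, and submodularity of cuts then yields a nonconstant coloring
(`exists_not_lap`).

That the summands are planar diagrams at all rests on nonnegativity of the genus (`euler_le`) and a
count of faces (`card_capFace`), which uses that a face leaving `T` along one of the two edges
returns along the other. -/

namespace TwoOut

open Finset

variable {V : Type} [Fintype V] [DecidableEq V] (s : V → Fin 2 → V)

/-- Every vertex is the target of exactly two arrows. -/
def TwoIn : Prop :=
  ∀ j, ∑ p : V × Fin 2, (if s p.1 p.2 = j then 1 else 0 : ℤ) = 2

/-- The number of arrows that leave a set of vertices. -/
def cut (T : Finset V) : ℤ :=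
  ∑ p : V × Fin 2, if p.1 ∈ T ∧ s p.1 p.2 ∉ T then 1 else 0

/-- The Laplacian, acting on functions from the right. -/
def lap (w : V → ℤ) (j : V) : ℤ :=
  2 * w j - ∑ p : V × Fin 2, if s p.1 p.2 = j then w p.1 else 0

variable {s}

lemma sum_target (h : TwoIn s) (g : V → ℤ) :
    ∑ p : V × Fin 2, g (s p.1 p.2) = 2 * ∑ j, g j := by
  have : ∀ p : V × Fin 2, g (s p.1 p.2) = ∑ j, if s p.1 p.2 = j then g j else 0 := by
    intro p; simp
  simp_rw [this]
  rw [sum_comm, mul_sum]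
  refine sum_congr rfl fun j _ => ?_
  rw [← h j, sum_mul]
  exact sum_congr rfl fun p _ => by split_ifs <;> simp

lemma sum_source (g : V → ℤ) : ∑ p : V × Fin 2, g p.1 = 2 * ∑ j, g j := by
  rw [Fintype.sum_prod_type, mul_sum]
  exact sum_congr rfl fun p _ => by simp

lemma sum_mem_source (T : Finset V) :
    ∑ p : V × Fin 2, (if p.1 ∈ T then 1 else 0 : ℤ) = 2 * #T := by
  rw [sum_source (fun v => if v ∈ T then (1 : ℤ) else 0)]; simp

lemma sum_mem_target (h : TwoIn s) (T : Finset V) :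
    ∑ p : V × Fin 2, (if s p.1 p.2 ∈ T then 1 else 0 : ℤ) = 2 * #T := by
  rw [sum_target h (fun v => if v ∈ T then (1 : ℤ) else 0)]; simp

/-- Balance: the arrows that start in `T` and those that end in `T` both number `2 * #T`, and the
arrows inside `T` cancel. -/
lemma cut_eq_in (h : TwoIn s) (T : Finset V) :
    cut s T = ∑ p : V × Fin 2, if p.1 ∉ T ∧ s p.1 p.2 ∈ T then 1 else 0 := by
  have h1 := sum_mem_source T
  have h2 := sum_mem_target h T
  have h3 : cut s T - ∑ p : V × Fin 2, (if p.1 ∉ T ∧ s p.1 p.2 ∈ T then 1 else 0 : ℤ) =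
      ∑ p : V × Fin 2, (if p.1 ∈ T then 1 else 0 : ℤ) -
        ∑ p : V × Fin 2, (if s p.1 p.2 ∈ T then 1 else 0 : ℤ) := by
    rw [cut, ← sum_sub_distrib, ← sum_sub_distrib]
    exact sum_congr rfl fun p _ => by
      by_cases p.1 ∈ T <;> by_cases s p.1 p.2 ∈ T <;> simp [*]
  omega

lemma cut_compl (h : TwoIn s) (T : Finset V) : cut s Tᶜ = cut s T := by
  rw [cut_eq_in h T, cut]; simp

/-- Submodularity, checked for each arrow separately according to the position of its two endpoints.
-/
lemma cut_inter_add_cut_union (A B : Finset V) :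
    cut s (A ∩ B) + cut s (A ∪ B) ≤ cut s A + cut s B := by
  unfold cut
  rw [← sum_add_distrib, ← sum_add_distrib]
  refine sum_le_sum fun p _ => ?_
  by_cases p.1 ∈ A <;> by_cases s p.1 p.2 ∈ A <;> by_cases p.1 ∈ B <;>
    by_cases s p.1 p.2 ∈ B <;> simp [*]

lemma cut_nonneg (T : Finset V) : 0 ≤ cut s T :=
  sum_nonneg fun p _ => by split_ifs <;> simp

/-- The set where `w` is maximal. -/
lemma exists_argmax [Nonempty V] (h : TwoIn s) (w : V → ℤ) :
    ∃ T : Finset V, T.Nonempty ∧ (∀ j ∈ T, 0 ≤ lap s w j) ∧ cut s T ≤ ∑ j ∈ T, lap s w j ∧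
      (T = univ → ∀ i j, w i = w j) := by
  obtain ⟨m, -, hm⟩ := exists_max_image univ w univ_nonempty
  have hm' : ∀ j, w j ≤ w m := fun j => hm j (mem_univ _)
  -- The term `2 * w j` is distributed over the two incoming arrows, so at a maximum the Laplacian
  -- is a sum of nonnegative drops.
  have key : ∀ j, w j = w m →
      lap s w j = ∑ p : V × Fin 2, if s p.1 p.2 = j then w m - w p.1 else 0 := by
    intro j hj
    rw [lap, hj, ← h j, sum_mul, ← sum_sub_distrib]
    exact sum_congr rfl fun p _ => by split_ifs <;> simp
  refine ⟨univ.filter (fun j => w j = w m), ⟨m, by simp⟩, ?_, ?_, ?_⟩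
  · intro j hj
    rw [key j (by simpa using hj)]
    exact sum_nonneg fun p _ => by split_ifs <;> simp [hm']
  · rw [sum_congr rfl fun j hj => key j (by simpa using hj), sum_comm, cut_eq_in h]
    -- An arrow entering the maximal set from outside has a drop of at least one, since `w` is
    -- integral. By balance there are as many of these as leaving arrows.
    refine sum_le_sum fun p _ => ?_
    rw [sum_ite_eq]
    have := hm' p.1
    split_ifs with h1 h2 h2
    · have : w p.1 ≠ w m := by simpa using h1.1
      omega
    · exact absurd h1.2 h2
    · omega
    · rfl
  · intro hT i j
    have hi : ∀ i, w i = w m := fun i => by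
      have := mem_univ i
      rw [← hT] at this
      simpa using this
    rw [hi i, hi j]

lemma lap_const (h : TwoIn s) (w : V → ℤ) (hw : ∀ i j, w i = w j) (j : V) : lap s w j = 0 := by
  rw [lap, sub_eq_zero, ← h j, sum_mul]
  exact sum_congr rfl fun p _ => by rw [hw p.1 j]; split_ifs <;> simp

/-- A unit source and a unit sink are separated by at most one arrow. -/
lemma exists_cut_le_one (h : TwoIn s) {w : V → ℤ} {i i' : V} (hne : i ≠ i')
    (hw : ∀ j, lap s w j = (if j = i then 1 else 0) - (if j = i' then 1 else 0)) :
    ∃ T : Finset V, T.Nonempty ∧ i' ∉ T ∧ cut s T ≤ if i ∈ T then 1 else 0 := by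
  have : Nonempty V := ⟨i⟩
  obtain ⟨T, hT, hpos, hcut, -⟩ := exists_argmax h w
  -- The Laplacian is nonnegative on `T` but equals `-1` at `i'`.
  have hi' : i' ∉ T := fun hi => by
    have := hpos i' hi
    rw [hw] at this
    simp [hne.symm] at this
  refine ⟨T, hT, hi', hcut.trans ?_⟩
  simp_rw [hw, sum_sub_distrib, sum_ite_eq']
  simp [hi']

variable (s) in
/-- Every nonempty proper set of vertices is left by an arrow. -/
def Conn : Prop := ∀ T : Finset V, T.Nonempty → T ≠ univ → 1 ≤ cut s T

/-- If the graph is connected and at most one arrow is a loop, then the vertices are not all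
equivalent modulo the Laplacian. -/
theorem exists_not_lap [Nonempty V] (h : TwoIn s) (hc : Conn s) {ε : V × Fin 2}
    (hl : ∀ c k, s c k = c → (c, k) = ε) :
    ∃ i i', ∀ w, ¬ ∀ j, lap s w j = (if j = i then 1 else 0) - (if j = i' then 1 else 0) := by
  by_contra! hall
  have two : ∀ i i', i ≠ i' → ∃ T : Finset V, i ∈ T ∧ i' ∉ T ∧ cut s T ≤ 1 := by
    intro i i' hne
    obtain ⟨w, hw⟩ := hall i i'
    obtain ⟨T, hT, hi', hcut⟩ := exists_cut_le_one h hne hw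
    have h1 := hc T hT (fun hu => hi' (by rw [hu]; simp))
    have hi : i ∈ T := by
      by_contra hi
      rw [if_neg hi] at hcut
      omega
    exact ⟨T, hi, hi', by simpa [hi] using hcut⟩
  -- a smallest such set away from the loop
  let F : Finset (Finset V) :=
    univ.filter fun T => T.Nonempty ∧ ε.1 ∉ T ∧ cut s T ≤ 1
  have hF : F.Nonempty := by
    -- If there were only one vertex, both of its arrows would be loops.
    have hex : ∃ u, u ≠ ε.1 := by
      by_contra! hu
      have h0 := hl ε.1 0 (hu _)
      have h1 := hl ε.1 1 (hu _)
      rw [← h1] at h0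
      simp at h0
    obtain ⟨u, hu⟩ := hex
    obtain ⟨T, h1, h2, h3⟩ := two u ε.1 hu
    exact ⟨T, by simp only [F, mem_filter, mem_univ, true_and]; exact ⟨⟨u, h1⟩, h2, h3⟩⟩
  obtain ⟨T, hTF, hmin⟩ := exists_min_image F card hF
  simp only [F, mem_filter, mem_univ, true_and] at hTF hmin
  obtain ⟨⟨u, hu⟩, hε, hcut⟩ := hTF
  have hsub : ∀ u', u' ∈ T → u' = u := by
    intro u' hu'
    by_contra hne
    obtain ⟨B, hB, hB', hcB⟩ := two u' u hne
    -- one of `B` and its complement does not cover the complement of `T`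
    have main : ∀ B : Finset V, cut s B ≤ 1 → (T ∩ B).Nonempty → (∃ x ∈ T, x ∉ B) →
        T ∪ B ≠ univ → False := by
      rintro B hcB hne' ⟨x, hx, hxB⟩ hun
      -- The two cuts add up to at most two and the union uses at least one by connectedness, so `T
      -- ∩ B` has cut at most one and contradicts minimality of `T`.
      have h1 := cut_inter_add_cut_union (s := s) T B
      have h2 := hc (T ∪ B) (hne'.mono (by intro y; simp; tauto)) hun
      have h3 := hmin (T ∩ B) ⟨hne', fun hh => hε (mem_inter.1 hh).1, by omega⟩
      have h4 : T ∩ B ⊂ T := by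
        rw [ssubset_iff_of_subset inter_subset_left]
        exact ⟨x, hx, fun hh => hxB (mem_inter.1 hh).2⟩
      exact absurd h3 (not_le.2 (card_lt_card h4))
    -- A set and its complement have the same cut. The one that avoids the loop vertex is used, so
    -- that its union with `T` is still proper.
    by_cases hun : ε.1 ∈ B
    · refine main Bᶜ ?_ ⟨u, ?_⟩ ⟨u', hu', by simpa using hB⟩ ?_
      · rwa [cut_compl h]
      · simp [hu, hB']
      · intro hh
        have := mem_univ ε.1
        rw [← hh] at this
        simp [hε, hun] at this
    · refine main B hcB ⟨u', by simp [hu', hB]⟩ ⟨u, hu, hB'⟩ ?_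
      intro hh
      have := mem_univ ε.1
      rw [← hh] at this
      simp [hε, hun] at this
  have hTu : T = {u} := by
    ext x; simp only [mem_singleton]; exact ⟨hsub x, fun hx => hx ▸ hu⟩
  -- The only possible loop starts outside `T = {u}`, so both arrows from `u` leave `T` and the cut
  -- is two.
  have hnl : ∀ k, s u k ≠ u := fun k hk => hε (by rw [← hl u k hk]; exact hu)
  have : cut s T = 2 := by
    rw [show (2 : ℤ) = 2 * #T by simp [hTu], ← sum_mem_source T, cut]
    refine sum_congr rfl fun p _ => ?_
    by_cases hp : p.1 = u
    · have := hnl p.2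
      rw [← hp] at this
      simp [hTu, hp, hnl]
    · simp [hTu, hp]
  omega

end TwoOut

/-! ### The crossing matrix as a Laplacian -/

namespace TwoOut

open Finset

variable {V : Type} [Fintype V] [DecidableEq V] {s : V → Fin 2 → V}

/-- Out-degree two: each weight occurs twice with either sign. Unlike `lap_const`, this does not
need the in-degrees. -/
lemma sum_lap (w : V → ℤ) : ∑ j, lap s w j = 0 := by
  simp_rw [lap]
  rw [sum_sub_distrib, sum_comm (f := fun j (p : V × Fin 2) => if s p.1 p.2 = j then w p.1 else 0),
    ← mul_sum, ← sum_source w]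
  simp

lemma lap_sub_const (h : TwoIn s) (w : V → ℤ) (a : ℤ) (j : V) :
    lap s (fun i => w i - a) j = lap s w j := by
  have := lap_const h (fun _ => a) (fun _ _ => rfl) j
  rw [← sub_zero (lap s w j), ← this]
  simp only [lap]
  have : ∀ p : V × Fin 2, (if s p.1 p.2 = j then w p.1 - a else 0) =
      (if s p.1 p.2 = j then w p.1 else 0) - (if s p.1 p.2 = j then a else 0) := by
    intro p; split_ifs <;> simp
  simp_rw [this, sum_sub_distrib]
  ring

/-- Extension by zero. -/
def extend {b : V} (x : {i // i ≠ b} → ℤ) (i : V) : ℤ := if h : i ≠ b then x ⟨i, h⟩ else 0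

lemma extend_base {b : V} (x : {i // i ≠ b} → ℤ) : extend x b = 0 := by simp [extend]

lemma extend_coe {b : V} (x : {i // i ≠ b} → ℤ) (i : {i // i ≠ b}) : extend x i.1 = x i := by
  simp [extend, i.2]

lemma sum_extend {b : V} (g : V → ℤ) (hg : g b = 0) : ∑ i, g i = ∑ i : {i // i ≠ b}, g i := by
  rw [← Fintype.sum_subtype_add_sum_subtype (fun i => i ≠ b) g]
  simp only [ne_eq, add_eq_left]
  exact sum_eq_zero fun i _ => by rw [not_not.1 i.2, hg]

lemma sum_base {b : V} (g : V → ℤ) : ∑ i : {i // ¬ i ≠ b}, g i = g b :=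
  Fintype.sum_eq_single (⟨b, by simp⟩ : {i // ¬ i ≠ b})
    fun i hi => absurd (Subtype.ext (not_not.1 i.2)) hi

end TwoOut

/-! ### Colorings that separate arcs, from cuts of the overpass graph -/

namespace LinkDiagram

open Finset TwoOut

/-- The overpass graph: the over-arc at `s c 0` is the first under-arc at `c`, and the over-arc at
`s c 1` is the second one. -/
structure IsOverpassGraph (D : LinkDiagram) (s : D.Crossing → Fin 2 → D.Crossing) : Prop where
  bij : Function.Bijective D.overArc
  under : ∀ c, D.underArc c = D.overArc (s c 0)
  under' : ∀ c, D.underArc' c = D.overArc (s c 1)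
  twoIn : TwoIn s

variable {D : LinkDiagram} {s : D.Crossing → Fin 2 → D.Crossing}

namespace IsOverpassGraph

lemma relator_apply (h : D.IsOverpassGraph s) (i j : D.Crossing) :
    D.relator i (D.overArc j) =
      2 * (if i = j then 1 else 0) - (if s i 0 = j then 1 else 0) -
        (if s i 1 = j then 1 else 0) := by
  classical
  simp [relator, h.under, h.under', Finsupp.single_apply, h.bij.1.eq_iff]

lemma sum_mul_relator (h : D.IsOverpassGraph s) (w : D.Crossing → ℤ) (j : D.Crossing) :
    ∑ i, w i * D.relator i (D.overArc j) = lap s w j := by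
  simp_rw [h.relator_apply, lap, Fintype.sum_prod_type, mul_sub, sum_sub_distrib]
  simp [Fin.sum_univ_two, sum_add_distrib]
  ring

lemma sum_relator_mul {R : Type} [CommRing R] (h : D.IsOverpassGraph s) (i : D.Crossing)
    (g : D.Arc → R) :
    ∑ j, (D.relator i (D.overArc j) : R) * g (D.overArc j) =
      2 * g (D.overArc i) - g (D.underArc i) - g (D.underArc' i) := by
  simp_rw [h.relator_apply, h.under, h.under']
  push_cast
  simp [sub_mul, sum_sub_distrib]

/-- A potential that vanishes at the base vertex does not see the removed row. -/
lemma vecMul_reduced (h : D.IsOverpassGraph s) {b : D.Crossing} (x : {i // i ≠ b} → ℤ)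
    (j : {i // i ≠ b}) :
    Matrix.vecMul x (D.reducedCrossingMatrix b) j = lap s (extend x) j.1 := by
  rw [← h.sum_mul_relator, sum_extend (b := b) _ (by simp [extend_base])]
  simp only [extend_coe]
  rfl

/-- The total of the Laplacian is zero, so the entry of the removed column is determined by the
others. -/
lemma lap_extend_base {b : D.Crossing} (x : {i // i ≠ b} → ℤ) :
    lap s (extend x) b = - ∑ j : {i // i ≠ b}, lap s (extend x) j.1 := by
  have := sum_lap (s := s) (extend x)
  rw [← Fintype.sum_subtype_add_sum_subtype (fun i => i ≠ b)] at this
  rw [sum_base] at this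
  linarith

/-- A kernel vector, extended by zero, is harmonic at every vertex. Its maximal set is then left by
no arrow, hence is everything, and the vector equals its base value zero. -/
lemma det_ne_zero (h : D.IsOverpassGraph s) (hc : Conn s) (b : D.Crossing) :
    (D.reducedCrossingMatrix b).det ≠ 0 := by
  intro h0
  obtain ⟨x, hx, hx0⟩ := Matrix.exists_vecMul_eq_zero_iff.2 h0
  have h1 : ∀ j : {i // i ≠ b}, lap s (extend x) j.1 = 0 := fun j => by
    rw [← h.vecMul_reduced, hx0]; rfl
  have h2 : ∀ j, lap s (extend x) j = 0 := by
    intro j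
    by_cases hj : j ≠ b
    · exact h1 ⟨j, hj⟩
    · rw [not_not.1 hj, lap_extend_base]
      simp [h1]
  have : Nonempty D.Crossing := ⟨b⟩
  obtain ⟨T, hT, -, hcut, huniv⟩ := exists_argmax h.twoIn (extend x)
  simp only [h2, sum_const_zero] at hcut
  have hTu : T = univ := by
    by_contra hne
    have := hc T hT hne
    omega
  apply hx
  ext i
  rw [← extend_coe x i, huniv hTu i.1 b, extend_base]
  rfl

/-- No arrow-weighted combination of relators is a difference of two arcs. -/
lemma not_lap (h : D.IsOverpassGraph s)
    (hc : ∀ T : Finset D.Crossing, T.Nonempty → T ≠ univ → 2 ≤ cut s T)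
    {i i' : D.Crossing} (hne : i ≠ i') (w : D.Crossing → ℤ) :
    ¬ ∀ j, lap s w j = (if j = i then 1 else 0) - (if j = i' then 1 else 0) := by
  intro hw
  obtain ⟨T, hT, hi', hcut⟩ := exists_cut_le_one h.twoIn hne hw
  have := hc T hT (fun hu => hi' (by rw [hu]; simp))
  split_ifs at hcut <;> omega

/-- Two arcs with the same class would have a difference that is an integral combination of
relators, against `not_lap`. -/
lemma injective_colClass (h : D.IsOverpassGraph s)
    (hc : ∀ T : Finset D.Crossing, T.Nonempty → T ≠ univ → 2 ≤ cut s T) :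
    Function.Injective D.colClass := by
  classical
  intro a a' haa
  obtain ⟨i, rfl⟩ := h.bij.2 a
  obtain ⟨i', rfl⟩ := h.bij.2 a'
  by_contra hne
  have hne' : i ≠ i' := fun hh => hne (by rw [hh])
  rw [colClass, colClass, Submodule.Quotient.eq, Submodule.mem_span_range_iff_exists_fun] at haa
  obtain ⟨w, hw⟩ := haa
  refine h.not_lap hc hne' w fun j => ?_
  rw [← h.sum_mul_relator]
  have := DFunLike.congr_fun hw (D.overArc j)
  simp only [Finsupp.coe_finsetSum, Finset.sum_apply, Finsupp.smul_apply, smul_eq_mul,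
    Finsupp.sub_apply, Finsupp.single_apply, h.bij.1.eq_iff] at this
  rw [this]
  simp [eq_comm]

/-- If `X C = N`, then the columns of `X` are Fox `N`-colorings which distinguish the arcs. -/
lemma exists_colorings (h : D.IsOverpassGraph s)
    (hc : ∀ T : Finset D.Crossing, T.Nonempty → T ≠ univ → 2 ≤ cut s T) (b : D.Crossing)
    {N : ℕ} (hN : N ≠ 0) {X : Matrix {i : D.Crossing // i ≠ b} {i : D.Crossing // i ≠ b} ℤ}
    (hX : X * D.reducedCrossingMatrix b = (N : ℤ) • 1) :
    ∃ y : {i : D.Crossing // i ≠ b} → D.Arc → ZMod N,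
      (∀ k, y k (D.overArc b) = 0 ∧ (∀ i, y k (D.overArc i.val) = (X i k : ZMod N)) ∧
          D.IsFoxColoring N (y k)) ∧
        ∀ a a' : D.Arc, a ≠ a' → ∃ k, y k a ≠ y k a' := by
  have hN' : (N : ℤ) ≠ 0 := by exact_mod_cast hN
  -- A one-sided inverse up to the scalar `N` is two-sided. Multiplication by the adjugate cancels
  -- `C` over the integers.
  have hX' : D.reducedCrossingMatrix b * X = (N : ℤ) • 1 := by
    set C := D.reducedCrossingMatrix b
    have hdet : C.det ≠ 0 := by
      have := congrArg Matrix.det hX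
      rw [Matrix.det_mul, Matrix.det_smul, Matrix.det_one, mul_one] at this
      intro h0
      rw [h0, mul_zero] at this
      exact pow_ne_zero _ hN' this.symm
    have h1 : C * (X * C) = (C * X) * C := by rw [Matrix.mul_assoc]
    rw [hX] at h1
    have h2 : (C * X - (N : ℤ) • 1) * C = 0 := by
      rw [sub_mul, ← h1, Matrix.smul_mul, Matrix.mul_smul, one_mul, mul_one, sub_self]
    have h3 : (C * X - (N : ℤ) • 1) * C * C.adjugate = 0 := by rw [h2, zero_mul]
    rw [Matrix.mul_assoc, Matrix.mul_adjugate, Matrix.mul_smul, mul_one] at h3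
    exact sub_eq_zero.1 ((smul_eq_zero.1 h3).resolve_left hdet)
  let e := Equiv.ofBijective _ h.bij
  have he : ∀ i, e.symm (D.overArc i) = i := fun i => e.symm_apply_apply i
  let y : {i : D.Crossing // i ≠ b} → D.Arc → ZMod N := fun k a =>
    (extend (fun i => X i k) (e.symm a) : ℤ)
  have hy : ∀ k i, y k (D.overArc i) = (extend (fun i => X i k) i : ℤ) := fun k i => by
    simp only [y, he]
  have hrow : ∀ k (i : {i // i ≠ b}),
      ∑ j, D.relator i.1 (D.overArc j) * extend (fun i => X i k) j = if i = k then (N : ℤ) else 0 := by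
    intro k i
    have := congrFun (congrFun hX' i) k
    rw [Matrix.mul_apply, Matrix.smul_apply, Matrix.one_apply] at this
    rw [sum_extend (b := b) _ (by simp [extend_base])]
    simp only [extend_coe]
    refine Eq.trans this ?_
    simp
  have hfox : ∀ k i, ∑ j, (D.relator i (D.overArc j) : ZMod N) * y k (D.overArc j) = 0 := by
    intro k
    have h1 : ∀ i, i ≠ b → ∑ j, (D.relator i (D.overArc j) : ZMod N) * y k (D.overArc j) = 0 := by
      intro i hi
      have := congrArg (Int.cast : ℤ → ZMod N) (hrow k ⟨i, hi⟩)
      push_cast at this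
      simp only [hy]
      rw [this]
      split_ifs <;> simp
    intro i
    by_cases hi : i ≠ b
    · exact h1 i hi
    · rw [not_not.1 hi]
      -- The rows of the full crossing matrix add up to zero, so the relation at the base crossing
      -- follows from the others.
      have hsum : ∑ i, ∑ j, (D.relator i (D.overArc j) : ZMod N) * y k (D.overArc j) = 0 := by
        rw [sum_comm]
        refine sum_eq_zero fun j _ => ?_
        rw [← sum_mul]
        have := h.sum_mul_relator (fun _ => 1) j
        rw [lap_const h.twoIn _ (fun _ _ => rfl)] at this
        have := congrArg (Int.cast : ℤ → ZMod N) this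
        simp only [one_mul] at this
        push_cast at this
        rw [this, zero_mul]
      rwa [Fintype.sum_eq_single b (fun i hi => h1 i hi)] at hsum
  refine ⟨y, fun k => ⟨?_, fun i => ?_, fun c => ?_⟩, ?_⟩
  · rw [hy, extend_base]; simp
  · rw [hy, extend_coe (fun i => X i k)]
  · rw [← h.sum_relator_mul c (y k)]
    exact hfox k c
  · intro a a' haa
    obtain ⟨i, rfl⟩ := h.bij.2 a
    obtain ⟨i', rfl⟩ := h.bij.2 a'
    have hne : i ≠ i' := fun hh => haa (by rw [hh])
    by_contra! hk
    -- If no column separates the two arcs, the difference of their rows in `X` (the base row being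
    -- zero) is `N` times an integral vector `u`.
    have hdvd : ∀ k, ∃ u : ℤ,
        extend (fun i => X i k) i - extend (fun i => X i k) i' = N * u := by
      intro k
      have := hk k
      rw [hy, hy, ← sub_eq_zero, ← Int.cast_sub, ZMod.intCast_zmod_eq_zero_iff_dvd] at this
      exact this
    choose u hu using hdvd
    have hcol : ∀ (l : D.Crossing) (j : {i // i ≠ b}),
        ∑ k, extend (fun i => X i k) l * D.reducedCrossingMatrix b k j =
          N * if j.1 = l then 1 else 0 := by
      intro l j
      by_cases hl : l ≠ b
      · have := congrFun (congrFun hX ⟨l, hl⟩) j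
        rw [Matrix.mul_apply, Matrix.smul_apply, Matrix.one_apply] at this
        simp only [extend, hl, ne_eq, not_false_eq_true, dite_true]
        rw [this, smul_eq_mul]
        congr 1
        exact if_congr (by rw [Subtype.ext_iff, eq_comm]) rfl rfl
      · have hlb := not_not.1 hl
        rw [if_neg (fun hj => j.2 (hj.trans hlb)), mul_zero]
        exact sum_eq_zero fun k _ => by rw [hlb, extend_base, zero_mul]
    -- Multiplying by `C` and cancelling `N` shows that `u C` is the difference of the two arcs,
    -- away from the base.
    have hlap : ∀ j : {i // i ≠ b}, lap s (extend u) j.1 =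
        (if j.1 = i then 1 else 0) - (if j.1 = i' then 1 else 0) := by
      intro j
      rw [← h.vecMul_reduced]
      apply mul_left_cancel₀ hN'
      rw [mul_sub, ← hcol, ← hcol, ← sum_sub_distrib, Matrix.vecMul, dotProduct, mul_sum]
      exact sum_congr rfl fun k _ => by rw [← sub_mul, hu, mul_assoc]
    refine h.not_lap hc hne (extend u) fun j => ?_
    by_cases hj : j ≠ b
    · exact hlap ⟨j, hj⟩
    · rw [not_not.1 hj, lap_extend_base, sum_congr rfl fun j _ => hlap j]
      have : ∑ j, ((if j = i then 1 else 0) - (if j = i' then 1 else 0) : ℤ) = 0 := by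
        simp [sum_sub_distrib]
      rw [← Fintype.sum_subtype_add_sum_subtype (fun i => i ≠ b)] at this
      rw [sum_base fun j => ((if j = i then 1 else 0) - (if j = i' then 1 else 0) : ℤ)] at this
      linarith

/-- The class of an arc in the reduced group. -/
noncomputable def redClass (D : LinkDiagram) (b : D.Arc) : (D.Arc →₀ ℤ) →ₗ[ℤ] D.ColRed b :=
  (Submodule.mkQ _).comp (Submodule.mkQ _)

lemma redClass_surjective (b : D.Arc) : Function.Surjective (redClass D b) :=
  (Submodule.mkQ_surjective _).comp (Submodule.mkQ_surjective _)

lemma redClass_base (b : D.Arc) : redClass D b (Finsupp.single b 1) = 0 := by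
  simp only [redClass, LinearMap.comp_apply, Submodule.mkQ_apply]
  rw [Submodule.Quotient.mk_eq_zero]
  exact Submodule.subset_span rfl

lemma redClass_relator (b : D.Arc) (c : D.Crossing) : redClass D b (D.relator c) = 0 := by
  have h0 : (Submodule.Quotient.mk (D.relator c) : D.Col) = 0 :=
    (Submodule.Quotient.mk_eq_zero _).2 (Submodule.subset_span (Set.mem_range_self c))
  simp only [redClass, LinearMap.comp_apply, Submodule.mkQ_apply, h0]
  exact Submodule.Quotient.mk_zero _

lemma redClass_eq_zero (b : D.Arc) (f : D.Arc →₀ ℤ) (hf : redClass D b f = 0) :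
    ∃ (z : ℤ) (w : D.Crossing → ℤ), f = Finsupp.single b z + ∑ i, w i • D.relator i := by
  simp only [redClass, LinearMap.comp_apply, Submodule.mkQ_apply] at hf
  rw [Submodule.Quotient.mk_eq_zero, Submodule.mem_span_singleton] at hf
  obtain ⟨z, hz⟩ := hf
  rw [colClass, ← Submodule.Quotient.mk_smul, eq_comm, Submodule.Quotient.eq,
    Submodule.mem_span_range_iff_exists_fun] at hz
  obtain ⟨w, hw⟩ := hz
  refine ⟨z, w, ?_⟩
  rw [hw]
  simp

lemma relator_eq_sum (h : D.IsOverpassGraph s) (i : D.Crossing) :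
    D.relator i = ∑ j, Finsupp.single (D.overArc j) (D.relator i (D.overArc j)) := by
  classical
  ext a
  obtain ⟨l, rfl⟩ := h.bij.2 a
  simp [Finsupp.single_apply, h.bij.1.eq_iff]

/-- Cramer's rule: the relators say that `C` kills the vector of arc classes, and multiplying by the
adjugate turns `C` into its determinant. -/
lemma det_smul (h : D.IsOverpassGraph s) (b : D.Crossing) (z : D.ColRed (D.overArc b)) :
    (D.reducedCrossingMatrix b).det • z = 0 := by
  set C := D.reducedCrossingMatrix b with hC
  set q : D.Crossing → D.ColRed (D.overArc b) :=
    fun j => redClass D (D.overArc b) (Finsupp.single (D.overArc j) 1) with hq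
  have hq0 : q b = 0 := redClass_base _
  have hrow : ∀ i : {i // i ≠ b}, ∑ j : {i // i ≠ b}, C i j • q j.1 = 0 := by
    intro i
    have h1 := redClass_relator (D.overArc b) i.1
    rw [h.relator_eq_sum, map_sum, ← Fintype.sum_subtype_add_sum_subtype (fun i => i ≠ b)] at h1
    have h2 : ∀ j, redClass D (D.overArc b)
        (Finsupp.single (D.overArc j) (D.relator i.1 (D.overArc j))) =
          D.relator i.1 (D.overArc j) • q j := by
      intro j
      rw [hq, ← map_smul, Finsupp.smul_single, smul_eq_mul, mul_one]
    simp_rw [h2] at h1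
    rw [sum_eq_zero (s := (univ : Finset {i // ¬ i ≠ b}))
      (fun j _ => by rw [not_not.1 j.2, hq0, smul_zero]), add_zero] at h1
    exact h1
  have hdet : ∀ j, C.det • q j = 0 := by
    intro j
    by_cases hj : j ≠ b
    · have h1 : ∀ l, ∑ i, C.adjugate ⟨j, hj⟩ i * C i l = if l = ⟨j, hj⟩ then C.det else 0 := by
        intro l
        rw [← Matrix.mul_apply, Matrix.adjugate_mul, Matrix.smul_apply, Matrix.one_apply]
        simp [eq_comm]
      have h2 : ∑ l, (∑ i, C.adjugate ⟨j, hj⟩ i * C i l) • q l.1 = C.det • q j := by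
        simp_rw [h1]
        rw [Fintype.sum_eq_single ⟨j, hj⟩ (fun l hl => by rw [if_neg hl, zero_smul]), if_pos rfl]
      rw [← h2]
      simp_rw [sum_smul]
      rw [sum_comm]
      refine sum_eq_zero fun i _ => ?_
      simp_rw [mul_smul]
      rw [← smul_sum, hrow, smul_zero]
    · rw [not_not.1 hj, hq0, smul_zero]
  obtain ⟨f, rfl⟩ := redClass_surjective _ z
  have : C.det • redClass D (D.overArc b) = 0 := by
    refine Finsupp.lhom_ext' fun a => LinearMap.ext_ring ?_
    obtain ⟨j, rfl⟩ := h.bij.2 a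
    exact hdet j
  exact LinearMap.congr_fun this f

lemma annihilator_pos (h : D.IsOverpassGraph s) (hc : Conn s) (b : D.Crossing) :
    0 < D.annihilator (D.overArc b) := by
  rw [annihilator, Nat.pos_iff_ne_zero, AddMonoid.exponent_ne_zero]
  refine ⟨(D.reducedCrossingMatrix b).det.natAbs, Int.natAbs_pos.2 (h.det_ne_zero hc b), fun z => ?_⟩
  have := h.det_smul b z
  rw [← natCast_zsmul, Int.natCast_natAbs]
  rcases abs_choice (D.reducedCrossingMatrix b).det with h1 | h1 <;> rw [h1]
  · exact this
  · rw [neg_smul, this, neg_zero]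

/-- Since `N` kills the class of each arc, `N` times the arc is a multiple of the base arc plus a
combination of relators. The coefficients of these combinations are the rows of `X`. -/
lemma exists_mul_eq_annihilator (h : D.IsOverpassGraph s) (b : D.Crossing) :
    ∃ X : Matrix {i : D.Crossing // i ≠ b} {i : D.Crossing // i ≠ b} ℤ,
      X * D.reducedCrossingMatrix b = (D.annihilator (D.overArc b) : ℤ) • 1 := by
  classical
  set N := D.annihilator (D.overArc b) with hN
  have key : ∀ j : {i : D.Crossing // i ≠ b}, ∃ x : {i : D.Crossing // i ≠ b} → ℤ,
      ∀ l, Matrix.vecMul x (D.reducedCrossingMatrix b) l = N * if j = l then 1 else 0 := by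
    intro j
    have h1 : redClass D (D.overArc b) (Finsupp.single (D.overArc j.1) (N : ℤ)) = 0 := by
      rw [show Finsupp.single (D.overArc j.1) (N : ℤ) = N • Finsupp.single (D.overArc j.1) (1 : ℤ) by
        simp, map_nsmul]
      exact AddMonoid.exponent_nsmul_eq_zero _
    obtain ⟨z, w, hw⟩ := redClass_eq_zero _ _ h1
    -- Constant weights have zero Laplacian, so the weights may be normalised to vanish at the base
    -- crossing.
    refine ⟨fun i => w i.1 - w b, fun l => ?_⟩
    have hext : extend (fun i : {i : D.Crossing // i ≠ b} => w i.1 - w b) = fun i => w i - w b := by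
      ext i
      by_cases hi : i = b <;> simp [extend, hi]
    rw [h.vecMul_reduced, hext, lap_sub_const h.twoIn, ← h.sum_mul_relator]
    have hbl : b ≠ l.1 := fun hb => l.2 hb.symm
    have := DFunLike.congr_fun hw (D.overArc l.1)
    simp only [Finsupp.single_apply, h.bij.1.eq_iff, Finsupp.add_apply, Finsupp.coe_finsetSum,
      Finset.sum_apply, Finsupp.smul_apply, smul_eq_mul, if_neg hbl, zero_add] at this
    rw [← this]
    simp [Subtype.ext_iff]
  choose X hX using key
  refine ⟨X, ?_⟩
  ext i j
  rw [Matrix.smul_apply, Matrix.one_apply, smul_eq_mul, ← hX]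
  rfl

/-- Pure linear algebra: the diagram enters only through its overpass graph and the bound on the
cuts. -/
theorem conclusion (h : D.IsOverpassGraph s)
    (hc : ∀ T : Finset D.Crossing, T.Nonempty → T ≠ univ → 2 ≤ cut s T) :
    Function.Bijective D.overArc ∧
    (∀ b : D.Crossing,
      (D.reducedCrossingMatrix b).det ≠ 0 ∧
      0 < D.annihilator (D.overArc b) ∧
      (∃ (L : Matrix {i : D.Crossing // i ≠ b} {i : D.Crossing // i ≠ b} ℤ)
          (y : {i : D.Crossing // i ≠ b} → D.Arc → ZMod (D.annihilator (D.overArc b))),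
        L.map (Int.cast : ℤ → ℚ) =
          (D.annihilator (D.overArc b) : ℚ) •
            ((D.reducedCrossingMatrix b).map (Int.cast : ℤ → ℚ))⁻¹ ∧
        (∀ k, y k (D.overArc b) = 0 ∧ (∀ i, y k (D.overArc i.val) = (L i k : ZMod _)) ∧
          D.IsFoxColoring _ (y k)) ∧
        ∀ a a' : D.Arc, a ≠ a' → ∃ k, y k a ≠ y k a') ∧
      (∃ (t : ℕ) (z : Fin t → D.Arc → ZMod (D.reducedCrossingMatrix b).det.natAbs),
        (∀ k, D.IsFoxColoring _ (z k)) ∧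
        ∀ a a' : D.Arc, a ≠ a' → ∃ k, z k a ≠ z k a')) ∧
    Function.Injective D.colClass := by
  have hc1 : Conn s := fun T h1 h2 => by have := hc T h1 h2; omega
  refine ⟨h.bij, fun b => ⟨h.det_ne_zero hc1 b, h.annihilator_pos hc1 b, ?_, ?_⟩,
    h.injective_colClass hc⟩
  · obtain ⟨X, hX⟩ := h.exists_mul_eq_annihilator b
    obtain ⟨y, hy⟩ := h.exists_colorings hc b (h.annihilator_pos hc1 b).ne' hX
    refine ⟨X, y, ?_, hy⟩
    have hdet : IsUnit ((D.reducedCrossingMatrix b).map (Int.cast : ℤ → ℚ)).det := by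
      have : ((D.reducedCrossingMatrix b).map (Int.cast : ℤ → ℚ)).det =
          ((D.reducedCrossingMatrix b).det : ℚ) :=
        ((Int.castRingHom ℚ).map_det _).symm
      rw [this, isUnit_iff_ne_zero]
      exact_mod_cast h.det_ne_zero hc1 b
    have hXQ := congrArg (fun M => M.map (Int.cast : ℤ → ℚ)) hX
    have hmul : (X * D.reducedCrossingMatrix b).map (Int.cast : ℤ → ℚ) =
        X.map (Int.cast : ℤ → ℚ) * (D.reducedCrossingMatrix b).map (Int.cast : ℤ → ℚ) :=
      Matrix.map_mul (f := Int.castRingHom ℚ)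
    simp only [hmul] at hXQ
    rw [← Matrix.mul_nonsing_inv_cancel_right _ (X.map (Int.cast : ℤ → ℚ)) hdet, hXQ]
    have h1 : ((D.annihilator (D.overArc b) : ℤ) •
        (1 : Matrix {i : D.Crossing // i ≠ b} {i : D.Crossing // i ≠ b} ℤ)).map (Int.cast : ℤ → ℚ) =
          (D.annihilator (D.overArc b) : ℚ) • 1 := by
      ext i j
      simp only [Matrix.map_apply, Matrix.smul_apply, Matrix.one_apply, smul_eq_mul]
      push_cast
      rfl
    rw [h1, Matrix.smul_mul, one_mul]
  · set C := D.reducedCrossingMatrix b with hC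
    have hd : C.det.natAbs ≠ 0 := Int.natAbs_ne_zero.2 (h.det_ne_zero hc1 b)
    -- The sign turns the determinant into its absolute value, so the signed adjugate serves as `X`
    -- for the modulus `|det C|`.
    have hX : (SignType.sign C.det : ℤ) • C.adjugate * C = (C.det.natAbs : ℤ) • 1 := by
      rw [Matrix.smul_mul, Matrix.adjugate_mul, smul_smul, Int.natCast_natAbs, sign_mul_self]
    obtain ⟨y, hy, hy'⟩ := h.exists_colorings hc b hd hX
    let e := (Fintype.equivFin {i : D.Crossing // i ≠ b}).symm
    refine ⟨_, fun k => y (e k), fun k => (hy _).2.2, fun a a' haa => ?_⟩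
    obtain ⟨k, hk⟩ := hy' a a' haa
    exact ⟨e.symm k, by simpa using hk⟩

end IsOverpassGraph

end LinkDiagram

/-! ### Colorings of labels -/

namespace Code

open Finset

variable {A : Type} [AddCommGroup A]

/-- Fox colorings with values in an abelian group, as functions of the labels. -/
def IsLabelColoring (C : Code) (f : ℕ → A) : Prop :=
  (∀ v ∈ C.crossings, f (v 1) = f (v 3) ∧ f (v 0) + f (v 2) = f (v 1) + f (v 1)) ∧
    ∀ m ∈ C.markers, f (m 0) = f (m 1)

/-- The label occurs in the diagram. -/
def Used (C : Code) (x : ℕ) : Prop :=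
  (∃ v ∈ C.crossings, ∃ k, v k = x) ∨ ∃ m ∈ C.markers, ∃ k, m k = x

/-- Only the trivial colorings exist. -/
def Rigid (A : Type) [AddCommGroup A] (C : Code) : Prop :=
  ∀ f : ℕ → A, C.IsLabelColoring f → ∃ g, ∀ x, C.Used x → f x = g

/-- The number of ends with a given label. -/
def ends (C : Code) (x : ℕ) : ℕ :=
  (C.crossings.map fun v => ∑ k, if v k = x then 1 else 0).sum +
    (C.markers.map fun v => ∑ k, if v k = x then 1 else 0).sum

section cons

variable (R : List (Fin 4 → ℕ)) (S : List (Fin 2 → ℕ)) (v : Fin 4 → ℕ) (m : Fin 2 → ℕ)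

lemma isLabelColoring_cons (f : ℕ → A) : IsLabelColoring ⟨v :: R, S⟩ f ↔
    (f (v 1) = f (v 3) ∧ f (v 0) + f (v 2) = f (v 1) + f (v 1)) ∧ IsLabelColoring ⟨R, S⟩ f := by
  simp [IsLabelColoring, and_assoc]

lemma isLabelColoring_cons_marker (f : ℕ → A) : IsLabelColoring ⟨R, m :: S⟩ f ↔
    f (m 0) = f (m 1) ∧ IsLabelColoring ⟨R, S⟩ f := by
  simp [IsLabelColoring]; tauto

lemma used_cons (x : ℕ) : Used ⟨v :: R, S⟩ x ↔
    (v 0 = x ∨ v 1 = x ∨ v 2 = x ∨ v 3 = x) ∨ Used ⟨R, S⟩ x := by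
  simp [Used, Fin.exists_fin_succ, or_assoc]

lemma used_cons_marker (x : ℕ) : Used ⟨R, m :: S⟩ x ↔
    (m 0 = x ∨ m 1 = x) ∨ Used ⟨R, S⟩ x := by
  simp only [Used, Fin.exists_fin_two, List.mem_cons, exists_eq_or_imp]
  exact or_left_comm

lemma ends_cons (x : ℕ) : ends ⟨v :: R, S⟩ x =
    (if v 0 = x then 1 else 0) + (if v 1 = x then 1 else 0) + (if v 2 = x then 1 else 0) +
      (if v 3 = x then 1 else 0) + ends ⟨R, S⟩ x := by
  simp only [ends, Fin.sum_univ_four, List.map_cons, List.sum_cons]; ring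

lemma ends_cons_marker (x : ℕ) : ends ⟨R, m :: S⟩ x =
    (if m 0 = x then 1 else 0) + (if m 1 = x then 1 else 0) + ends ⟨R, S⟩ x := by
  simp only [ends, Fin.sum_univ_two, List.map_cons, List.sum_cons]; ring

end cons

lemma used_of_ends {C : Code} {x : ℕ} (h : C.ends x ≠ 0) : C.Used x := by
  contrapose! h
  simp only [Used, not_or, not_exists, not_and] at h
  rw [ends, Nat.add_eq_zero_iff]
  refine ⟨List.sum_eq_zero ?_, List.sum_eq_zero ?_⟩
  · intro n hn
    obtain ⟨v, hv, rfl⟩ := List.mem_map.1 hn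
    exact sum_eq_zero fun k _ => if_neg (h.1 v hv k)
  · intro n hn
    obtain ⟨v, hv, rfl⟩ := List.mem_map.1 hn
    exact sum_eq_zero fun k _ => if_neg (h.2 v hv k)

lemma not_used_of_ends {C : Code} {x : ℕ} (h : C.ends x = 0) : ¬ C.Used x := by
  simp only [ends, Nat.add_eq_zero_iff, List.sum_eq_zero_iff, List.mem_map,
    forall_exists_index, and_imp, forall_apply_eq_imp_iff₂, Finset.sum_eq_zero_iff] at h
  rintro (⟨v, hv, k, hk⟩ | ⟨v, hv, k, hk⟩)
  · simpa [hk] using h.1 v hv k (mem_univ _)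
  · simpa [hk] using h.2 v hv k (mem_univ _)

lemma used_iff_exists_dart (C : Code) (x : ℕ) : C.Used x ↔ ∃ d, C.label d = x := by
  constructor
  · rintro (⟨v, hv, k, hk⟩ | ⟨v, hv, k, hk⟩)
    · obtain ⟨i, rfl⟩ := List.mem_iff_get.1 hv
      exact ⟨Sum.inl (i, k), hk⟩
    · obtain ⟨i, rfl⟩ := List.mem_iff_get.1 hv
      exact ⟨Sum.inr (i, k), hk⟩
  · rintro ⟨d | d, hd⟩
    · exact Or.inl ⟨_, List.get_mem _ _, _, hd⟩
    · exact Or.inr ⟨_, List.get_mem _ _, _, hd⟩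

lemma ends_eq_card (C : Code) (x : ℕ) : C.ends x = #{d : C.Dart | C.label d = x} := by
  rw [card_filter, Fintype.sum_sum_type, Fintype.sum_prod_type, Fintype.sum_prod_type, ends]
  congr 1
  · rw [← List.sum_ofFn]
    congr 1
    exact List.ext_get (by simp) fun n h1 h2 => by
      rw [List.get_eq_getElem, List.get_eq_getElem, List.getElem_map, List.getElem_ofFn]; rfl
  · rw [← List.sum_ofFn]
    congr 1
    exact List.ext_get (by simp) fun n h1 h2 => by
      rw [List.get_eq_getElem, List.get_eq_getElem, List.getElem_map, List.getElem_ofFn]; rfl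

/-- Turns closedness into a count, from which it is read off that the inner labels of a local
picture occur nowhere else. -/
lemma IsClosed.ends_eq {C : Code} (hC : C.IsClosed) {x : ℕ} (hx : C.Used x) : C.ends x = 2 := by
  obtain ⟨d, rfl⟩ := (C.used_iff_exists_dart x).1 hx
  obtain ⟨d', ⟨hne, hl⟩, huniq⟩ := hC d
  rw [ends_eq_card, card_eq_two]
  refine ⟨d, d', hne.symm, ?_⟩
  ext e
  simp only [mem_filter, mem_univ, true_and, mem_insert, mem_singleton]
  constructor
  · intro he
    by_cases h : e = d
    · exact Or.inl h
    · exact Or.inr (huniq e ⟨h, he⟩)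
  · rintro (rfl | rfl)
    · rfl
    · exact hl

lemma IsLabelColoring.congr {C : Code} {f g : ℕ → A} (hf : C.IsLabelColoring f)
    (h : ∀ x, C.Used x → g x = f x) : C.IsLabelColoring g := by
  refine ⟨fun v hv => ?_, fun m hm => ?_⟩
  · have hu : ∀ k, g (v k) = f (v k) := fun k => h _ (Or.inl ⟨v, hv, k, rfl⟩)
    rw [hu, hu, hu, hu]
    exact hf.1 v hv
  · have hu : ∀ k, g (m k) = f (m k) := fun k => h _ (Or.inr ⟨m, hm, k, rfl⟩)
    rw [hu, hu]
    exact hf.2 m hm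

lemma isLabelColoring_map (p : ℕ → ℕ) (R : List (Fin 4 → ℕ)) (S : List (Fin 2 → ℕ)) (f : ℕ → A) :
    IsLabelColoring ⟨R.map (fun v => p ∘ v), S.map (fun v => p ∘ v)⟩ f ↔
      IsLabelColoring ⟨R, S⟩ (f ∘ p) := by
  simp [IsLabelColoring]

lemma used_map (p : ℕ → ℕ) (R : List (Fin 4 → ℕ)) (S : List (Fin 2 → ℕ)) (x : ℕ) :
    Used ⟨R.map (fun v => p ∘ v), S.map (fun v => p ∘ v)⟩ x ↔ ∃ y, Used ⟨R, S⟩ y ∧ p y = x := by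
  simp only [Used, List.mem_map]
  constructor
  · rintro (⟨_, ⟨v, hv, rfl⟩, k, hk⟩ | ⟨_, ⟨v, hv, rfl⟩, k, hk⟩)
    · exact ⟨_, Or.inl ⟨v, hv, k, rfl⟩, hk⟩
    · exact ⟨_, Or.inr ⟨v, hv, k, rfl⟩, hk⟩
  · rintro ⟨y, (⟨v, hv, k, rfl⟩ | ⟨v, hv, k, rfl⟩), hx⟩
    · exact Or.inl ⟨_, ⟨v, hv, rfl⟩, k, hx⟩
    · exact Or.inr ⟨_, ⟨v, hv, rfl⟩, k, hx⟩

/-! ### Invariance of rigidity under the elementary moves -/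

lemma rigid_perm {R R' : List (Fin 4 → ℕ)} {S S' : List (Fin 2 → ℕ)} (hR : R.Perm R')
    (hS : S.Perm S') : Rigid A ⟨R, S⟩ ↔ Rigid A ⟨R', S'⟩ := by
  simp [Rigid, IsLabelColoring, Used, hR.mem_iff, hS.mem_iff]

lemma rigid_relabel (p : Equiv.Perm ℕ) (R : List (Fin 4 → ℕ)) (S : List (Fin 2 → ℕ)) :
    Rigid A ⟨R, S⟩ ↔ Rigid A ⟨R.map (fun v => p ∘ v), S.map (fun v => p ∘ v)⟩ := by
  constructor
  · intro h f hf
    rw [isLabelColoring_map] at hf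
    obtain ⟨g, hg⟩ := h _ hf
    refine ⟨g, fun x hx => ?_⟩
    obtain ⟨y, hy, rfl⟩ := (used_map _ _ _ _).1 hx
    exact hg y hy
  · intro h f hf
    obtain ⟨g, hg⟩ := h (f ∘ p.symm)
      ((isLabelColoring_map _ _ _ _).2 (hf.congr fun x _ => by simp))
    refine ⟨g, fun x hx => ?_⟩
    simpa using hg (p x) ((used_map _ _ _ _).2 ⟨x, hx, rfl⟩)

lemma rigid_unmark (a b : ℕ) (hab : a ≠ b) (R : List (Fin 4 → ℕ)) (S : List (Fin 2 → ℕ))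
    (hC : IsClosed ⟨R, ![a, b] :: S⟩) : Rigid A ⟨R, ![a, b] :: S⟩ ↔
      Rigid A ⟨R.map (fun v => mergeLabel a b ∘ v), S.map (fun v => mergeLabel a b ∘ v)⟩ := by
  have hma : mergeLabel a b a = a := by simp [mergeLabel]
  have hmb : mergeLabel a b b = a := by simp [mergeLabel]
  constructor
  · intro h f hf
    rw [isLabelColoring_map] at hf
    obtain ⟨g, hg⟩ := h (f ∘ mergeLabel a b)
      ((isLabelColoring_cons_marker _ _ _ _).2 ⟨by simp [hma, hmb], hf⟩)
    refine ⟨g, fun x hx => ?_⟩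
    obtain ⟨y, hy, rfl⟩ := (used_map _ _ _ _).1 hx
    exact hg y ((used_cons_marker _ _ _ _).2 (Or.inr hy))
  · intro h f hf
    rw [isLabelColoring_cons_marker] at hf
    have hf1 : f a = f b := hf.1
    have hfm : ∀ x, f (mergeLabel a b x) = f x := by
      intro x
      rw [mergeLabel]
      split_ifs with hx
      · rw [hx, hf1]
      · rfl
    obtain ⟨g, hg⟩ := h f ((isLabelColoring_map _ _ _ _).2 (hf.2.congr fun x _ => hfm x))
    -- The marker carries only one of the two ends labelled `a`, so this label survives in the rest
    -- of the diagram.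
    have hua : Used ⟨R, S⟩ a := by
      have := hC.ends_eq (x := a) ((used_cons_marker _ _ _ _).2 (by simp))
      rw [ends_cons_marker] at this
      refine used_of_ends fun h0 => ?_
      simp [h0, hab.symm] at this
    have hga : f a = g := hg a ((used_map _ _ _ _).2 ⟨a, hua, hma⟩)
    refine ⟨g, fun x hx => ?_⟩
    rcases (used_cons_marker _ _ _ _).1 hx with hx | hx
    · rcases hx with rfl | rfl
      · exact hga
      · exact hf1.symm.trans hga
    · rw [← hfm x]
      exact hg _ ((used_map _ _ _ _).2 ⟨x, hx, rfl⟩)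

/-- Rigidity is inherited from a code with the same colorings on the common labels. -/
lemma Rigid.of {C C' : Code} (h : Rigid A C)
    (hf : ∀ f : ℕ → A, C'.IsLabelColoring f → ∃ f', C.IsLabelColoring f' ∧
      ∀ g, (∀ x, C.Used x → f' x = g) → ∀ x, C'.Used x → f x = g) : Rigid A C' := by
  intro f hC'
  obtain ⟨f', h1, h2⟩ := hf f hC'
  obtain ⟨g, hg⟩ := h f' h1
  exact ⟨g, h2 g hg⟩

/-- Two ends with the label `x` are at the removed crossings. -/
lemma not_used_of_ends_add {C : Code} {x n : ℕ} (h : n + C.ends x = 2) (hn : 2 ≤ n) :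
    ¬ C.Used x := not_used_of_ends (by omega)

/-- The relations at the kink force its three labels to have one color, and the label `a` of the
loop occurs nowhere else, so colorings extend uniquely over it. -/
lemma rigid_r1 (a b c : ℕ) (R : List (Fin 4 → ℕ)) (S : List (Fin 2 → ℕ))
    (hC : IsClosed ⟨![a, a, b, c] :: R, S⟩) :
    Rigid A ⟨![a, a, b, c] :: R, S⟩ ↔ Rigid A ⟨R, ![b, c] :: S⟩ := by
  have ha := hC.ends_eq (x := a) ((used_cons _ _ _ _).2 (by simp))
  rw [ends_cons] at ha
  have hu : ¬ Used ⟨R, S⟩ a := not_used_of_ends_add ha (by simp; omega)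
  have hb : b ≠ a := by rintro rfl; simp at ha; omega
  have hc : c ≠ a := by rintro rfl; simp at ha; omega
  constructor
  · refine fun h => h.of fun f hf => ⟨Function.update f a (f b), ?_, ?_⟩
    · rw [isLabelColoring_cons_marker] at hf
      rw [isLabelColoring_cons]
      refine ⟨?_, hf.2.congr fun x hx => Function.update_of_ne (fun h => hu (by rwa [← h])) _ _⟩
      have := hf.1
      simp at this
      simp [hb, hc, this]
    · intro g hg x hx
      rw [used_cons_marker] at hx
      have hne : x ≠ a := by
        rintro rfl
        simp at hx
        tauto
      rw [← hg x, Function.update_of_ne hne]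
      rw [used_cons]
      simp at hx ⊢
      tauto
  · refine fun h => h.of fun f hf => ⟨f, ?_, ?_⟩
    · rw [isLabelColoring_cons] at hf
      rw [isLabelColoring_cons_marker]
      refine ⟨?_, hf.2⟩
      have := hf.1
      simp at this
      simp only [Matrix.cons_val_zero, Matrix.cons_val_one]
      rw [← this.1]
      exact this.2
    · intro g hg x hx
      rw [used_cons] at hx
      rw [isLabelColoring_cons] at hf
      have := hf.1
      simp at this
      simp only [used_cons_marker, Matrix.cons_val_zero, Matrix.cons_val_one] at hg
      simp at hx
      have hac : f a = g := this.1.trans (hg c (by simp))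
      rcases hx with (rfl | rfl | rfl) | hx
      · exact hac
      · exact hg _ (by simp)
      · exact hg _ (by simp)
      · exact hg _ (Or.inr hx)

lemma rigid_r1_mirror (a b c : ℕ) (R : List (Fin 4 → ℕ)) (S : List (Fin 2 → ℕ))
    (hC : IsClosed ⟨![b, a, a, c] :: R, S⟩) :
    Rigid A ⟨![b, a, a, c] :: R, S⟩ ↔ Rigid A ⟨R, ![b, c] :: S⟩ := by
  have ha := hC.ends_eq (x := a) ((used_cons _ _ _ _).2 (by simp))
  rw [ends_cons] at ha
  have hu : ¬ Used ⟨R, S⟩ a := not_used_of_ends_add ha (by simp; omega)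
  have hb : b ≠ a := by rintro rfl; simp at ha; omega
  have hc : c ≠ a := by rintro rfl; simp at ha; omega
  constructor
  · refine fun h => h.of fun f hf => ⟨Function.update f a (f b), ?_, ?_⟩
    · rw [isLabelColoring_cons_marker] at hf
      rw [isLabelColoring_cons]
      refine ⟨?_, hf.2.congr fun x hx => Function.update_of_ne (fun h => hu (by rwa [← h])) _ _⟩
      have := hf.1
      simp at this
      simp [hb, hc, this]
    · intro g hg x hx
      rw [used_cons_marker] at hx
      have hne : x ≠ a := by
        rintro rfl
        simp at hx
        tauto
      rw [← hg x, Function.update_of_ne hne]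
      rw [used_cons]
      simp at hx ⊢
      tauto
  · refine fun h => h.of fun f hf => ⟨f, ?_, ?_⟩
    · rw [isLabelColoring_cons] at hf
      rw [isLabelColoring_cons_marker]
      refine ⟨?_, hf.2⟩
      have := hf.1
      simp at this
      simp only [Matrix.cons_val_zero, Matrix.cons_val_one]
      rw [← this.1]
      exact this.2
    · intro g hg x hx
      rw [used_cons] at hx
      rw [isLabelColoring_cons] at hf
      have := hf.1
      simp at this
      simp only [used_cons_marker, Matrix.cons_val_zero, Matrix.cons_val_one] at hg
      simp at hx
      have hac : f a = g := this.1.trans (hg c (by simp))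
      rcases hx with (rfl | rfl | rfl) | hx
      · exact hg _ (by simp)
      · exact hac
      · exact hg _ (by simp)
      · exact hg _ (Or.inr hx)

/-- The inner colors are determined by the outer ones: `n` continues the over-strand, and `m`
receives the reflection `2r - p`, which the second crossing reflects back. -/
lemma rigid_r2 (p m q r n s : ℕ) (R : List (Fin 4 → ℕ)) (S : List (Fin 2 → ℕ))
    (hC : IsClosed ⟨![p, n, m, r] :: ![m, n, q, s] :: R, S⟩) :
    Rigid A ⟨![p, n, m, r] :: ![m, n, q, s] :: R, S⟩ ↔ Rigid A ⟨R, ![p, q] :: ![r, s] :: S⟩ := by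
  have hm := hC.ends_eq (x := m) ((used_cons _ _ _ _).2 (by simp))
  have hn := hC.ends_eq (x := n) ((used_cons _ _ _ _).2 (by simp))
  simp only [ends_cons, ← add_assoc, Matrix.cons_val] at hm hn
  have hum : ¬ Used ⟨R, S⟩ m := not_used_of_ends_add hm (by simp; omega)
  have hun : ¬ Used ⟨R, S⟩ n := not_used_of_ends_add hn (by simp; omega)
  have hne : m ≠ n ∧ p ≠ m ∧ q ≠ m ∧ r ≠ m ∧ s ≠ m ∧ p ≠ n ∧ q ≠ n ∧ r ≠ n ∧ s ≠ n := by
    refine ⟨?_, ?_, ?_, ?_, ?_, ?_, ?_, ?_, ?_⟩ <;> rintro rfl <;> simp at hm hn <;> omega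
  obtain ⟨hmn, hpm, hqm, hrm, hsm, hpn, hqn, hrn, hsn⟩ := hne
  simp only [isLabelColoring_cons, isLabelColoring_cons_marker, used_cons, used_cons_marker,
    Rigid, Matrix.cons_val] at *
  constructor
  · intro h f hf
    have hf' : IsLabelColoring ⟨R, S⟩
        (fun x => if x = m then f r + f r - f p else if x = n then f r else f x) :=
      hf.2.2.congr fun x hx => by
        have h1 : x ≠ m := fun h => hum (by rwa [← h])
        have h2 : x ≠ n := fun h => hun (by rwa [← h])
        simp [h1, h2]
    obtain ⟨g, hg⟩ := h _ ⟨by simp [hmn.symm, hpm, hpn, hrm, hrn],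
      by simp [hmn.symm, hqm, hqn, hsm, hsn, hf.1, hf.2.1], hf'⟩
    refine ⟨g, fun x hx => ?_⟩
    have h1 : x ≠ m := by rintro rfl; tauto
    have h2 : x ≠ n := by rintro rfl; tauto
    simpa [h1, h2] using hg x (by tauto)
  · intro h f ⟨⟨h1, h2⟩, ⟨h3, h4⟩, h5⟩
    have hpq : f p = f q := by
      rw [← h4, add_comm (f p)] at h2
      exact add_left_cancel h2
    obtain ⟨g, hg⟩ := h f ⟨hpq, h1.symm.trans h3, h5⟩
    have hr := hg r (by simp)
    have hp := hg p (by simp)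
    rw [h1, hr, hp] at h2
    have hm' : f m = g := add_left_cancel h2
    refine ⟨g, fun x hx => ?_⟩
    rcases hx with (rfl | rfl | rfl | rfl) | (rfl | rfl | rfl | rfl) | hx
    all_goals first | exact hg _ (by tauto) | exact h1.trans hr | exact hm'

/-- Change the colors of three labels. -/
def recolor (f : ℕ → A) (t u v : ℕ) (α β γ : A) (x : ℕ) : A :=
  if x = t then α else if x = u then β else if x = v then γ else f x

/-- The condition that a crossing imposes on a coloring. -/
def ColoredAt (f : ℕ → A) (v : Fin 4 → ℕ) : Prop :=
  f (v 1) = f (v 3) ∧ f (v 0) + f (v 2) = f (v 1) + f (v 1)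

/-- All ends at a crossing have the same color. -/
def ConstantAt (f : ℕ → A) (g : A) (v : Fin 4 → ℕ) : Prop :=
  f (v 0) = g ∧ f (v 1) = g ∧ f (v 2) = g ∧ f (v 3) = g

/-- One if the labels agree, and zero otherwise. -/
def occ (y x : ℕ) : ℕ := if y = x then 1 else 0

lemma ends_cons' (R : List (Fin 4 → ℕ)) (S : List (Fin 2 → ℕ)) (v : Fin 4 → ℕ) (x : ℕ) :
    ends ⟨v :: R, S⟩ x =
      occ (v 0) x + occ (v 1) x + occ (v 2) x + occ (v 3) x + ends ⟨R, S⟩ x :=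
  ends_cons R S v x

/-- The sides `t, u, v` of a triangle occur only there. -/
structure IsTriangle (C : Code) (t u v : ℕ) (l : List ℕ) : Prop where
  ne_tu : t ≠ u
  ne_tv : t ≠ v
  ne_uv : u ≠ v
  ne_t : ∀ x ∈ l, x ≠ t
  ne_u : ∀ x ∈ l, x ≠ u
  ne_v : ∀ x ∈ l, x ≠ v
  unused_t : ¬ C.Used t
  unused_u : ¬ C.Used u
  unused_v : ¬ C.Used v

/-- Every side of the triangle is already counted twice, which exhausts the two ends of its label.
-/
lemma isTriangle_of_ends {C : Code} {t u v : ℕ} {l : List ℕ}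
    (h : ∀ x, x = t ∨ x = u ∨ x = v →
      2 * (occ t x + occ u x + occ v x) + (l.map fun y => occ y x).sum + C.ends x = 2) : C.IsTriangle t u v l := by
  have ht := h t (by simp)
  have hu := h u (by simp)
  have hv := h v (by simp)
  have hself : ∀ x, occ x x = 1 := by simp [occ]
  simp only [hself] at ht hu hv
  have hpos : ∀ x ∈ l, 1 ≤ (l.map fun y => occ y x).sum := fun x hx =>
    List.le_sum_of_mem (List.mem_map.2 ⟨x, hx, hself x⟩)
  refine ⟨?_, ?_, ?_, ?_, ?_, ?_, not_used_of_ends (by omega), not_used_of_ends (by omega),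
    not_used_of_ends (by omega)⟩
  · rintro rfl; rw [hself] at ht; omega
  · rintro rfl; rw [hself] at ht; omega
  · rintro rfl; rw [hself] at hu; omega
  · rintro x hx rfl
    have := hpos _ hx
    omega
  · rintro x hx rfl
    have := hpos _ hx
    omega
  · rintro x hx rfl
    have := hpos _ hx
    omega

/-- The rest of the diagram keeps its colors because the sides do not occur there. So a third
Reidemeister move reduces to a choice of colors for the sides and a check at three crossings. -/
lemma Rigid.of_triangle {R : List (Fin 4 → ℕ)} {S : List (Fin 2 → ℕ)} {t u v : ℕ} {l : List ℕ}
    (hT : IsTriangle ⟨R, S⟩ t u v l) {X₁ X₂ X₃ Y₁ Y₂ Y₃ : Fin 4 → ℕ}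
    (h : Rigid A ⟨X₁ :: X₂ :: X₃ :: R, S⟩)
    (hf : ∀ f : ℕ → A, ColoredAt f Y₁ → ColoredAt f Y₂ → ColoredAt f Y₃ → ∃ α β γ : A,
      (ColoredAt (recolor f t u v α β γ) X₁ ∧ ColoredAt (recolor f t u v α β γ) X₂ ∧
        ColoredAt (recolor f t u v α β γ) X₃) ∧
      ∀ g, ConstantAt (recolor f t u v α β γ) g X₁ → ConstantAt (recolor f t u v α β γ) g X₂ →
        ConstantAt (recolor f t u v α β γ) g X₃ →
        ConstantAt f g Y₁ ∧ ConstantAt f g Y₂ ∧ ConstantAt f g Y₃) :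
    Rigid A ⟨Y₁ :: Y₂ :: Y₃ :: R, S⟩ := by
  refine h.of fun f hY => ?_
  simp only [isLabelColoring_cons] at hY
  obtain ⟨h1, h2, h3, hR⟩ := hY
  obtain ⟨α, β, γ, ⟨e1, e2, e3⟩, hg⟩ := hf f h1 h2 h3
  have hold : ∀ x, Used ⟨R, S⟩ x → recolor f t u v α β γ x = f x := by
    intro x hx
    have n1 : x ≠ t := by rintro rfl; exact hT.unused_t hx
    have n2 : x ≠ u := by rintro rfl; exact hT.unused_u hx
    have n3 : x ≠ v := by rintro rfl; exact hT.unused_v hx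
    simp [recolor, n1, n2, n3]
  refine ⟨recolor f t u v α β γ, ?_, ?_⟩
  · simp only [isLabelColoring_cons]
    exact ⟨e1, e2, e3, hR.congr hold⟩
  · intro g hX x hx
    simp only [used_cons] at hX hx
    obtain ⟨⟨p1, p2, p3, p4⟩, ⟨q1, q2, q3, q4⟩, r1, r2, r3, r4⟩ := hg g
      ⟨hX _ (by simp), hX _ (by simp), hX _ (by simp), hX _ (by simp)⟩
      ⟨hX _ (by simp), hX _ (by simp), hX _ (by simp), hX _ (by simp)⟩
      ⟨hX _ (by simp), hX _ (by simp), hX _ (by simp), hX _ (by simp)⟩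
    rcases hx with (rfl | rfl | rfl | rfl) | (rfl | rfl | rfl | rfl) |
      (rfl | rfl | rfl | rfl) | hx
    all_goals first | assumption | skip
    rw [← hold x hx]
    exact hX x (by simp [hx])

lemma rigid_r3 (t₁ u₁ v₁ t₂ u₂ v₂ t u v : ℕ) (R : List (Fin 4 → ℕ)) (S : List (Fin 2 → ℕ))
    (hC : IsClosed ⟨![u₂, t, u, t₂] :: ![v₂, t₁, v, t] :: ![v, u₁, v₁, u] :: R, S⟩) :
    Rigid A ⟨![u₂, t, u, t₂] :: ![v₂, t₁, v, t] :: ![v, u₁, v₁, u] :: R, S⟩ ↔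
      Rigid A ⟨![u, t₁, u₁, t] :: ![v, t, v₁, t₂] :: ![v₂, u, v, u₂] :: R, S⟩ := by
  have hT : IsTriangle ⟨R, S⟩ t u v [t₁, u₁, v₁, t₂, u₂, v₂] := by
    refine isTriangle_of_ends fun x hx => ?_
    refine Eq.trans ?_ (hC.ends_eq (x := x) (by simp [used_cons]; tauto))
    simp only [ends_cons', List.map_cons, List.sum_cons, List.map_nil, List.sum_nil,
      Matrix.cons_val]
    ring
  obtain ⟨a1, a2, a3, ht, hu, hv, -, -, -⟩ := id hT
  simp only [List.mem_cons, List.not_mem_nil, or_false, forall_eq_or_imp, forall_eq] at ht hu hv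
  constructor
  -- The side colors are forced: `t` and `u` continue the over-strands from `t₁` and `u₁`, and `v`
  -- is the reflection of `v₂` in the top strand. The other cases are analogous.
  · refine fun h => h.of_triangle hT fun f b1 b2 b3 => ⟨f t₁, f u₁, f t₁ + f t₁ - f v₂, ?cols, ?const⟩
    all_goals simp [ColoredAt] at b1 b2 b3
    case cols => refine ⟨?_, ?_, ?_⟩ <;> simp [ColoredAt, recolor, ht, hu, hv, a1.symm, a2.symm, a3.symm] <;> grind
    case const =>
      intro g c1 c2 c3
      simp [ConstantAt, recolor, ht, hu, hv, a1.symm, a2.symm, a3.symm] at c1 c2 c3 ⊢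
      grind
  · refine fun h => h.of_triangle hT fun f b1 b2 b3 => ⟨f t₁, f u₂, f u₂ + f u₂ - f v₂, ?cols, ?const⟩
    all_goals simp [ColoredAt] at b1 b2 b3
    case cols => refine ⟨?_, ?_, ?_⟩ <;> simp [ColoredAt, recolor, ht, hu, hv, a1.symm, a2.symm, a3.symm] <;> grind
    case const =>
      intro g c1 c2 c3
      simp [ConstantAt, recolor, ht, hu, hv, a1.symm, a2.symm, a3.symm] at c1 c2 c3 ⊢
      grind

lemma rigid_r3_mirror (t₁ u₁ v₁ t₂ u₂ v₂ t u v : ℕ) (R : List (Fin 4 → ℕ))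
    (S : List (Fin 2 → ℕ))
    (hC : IsClosed ⟨![u₂, t, u, t₂] :: ![v₂, t₁, v, t] :: ![u, v, u₁, v₁] :: R, S⟩) :
    Rigid A ⟨![u₂, t, u, t₂] :: ![v₂, t₁, v, t] :: ![u, v, u₁, v₁] :: R, S⟩ ↔
      Rigid A ⟨![u, t₁, u₁, t] :: ![v, t, v₁, t₂] :: ![u₂, v₂, u, v] :: R, S⟩ := by
  have hT : IsTriangle ⟨R, S⟩ t u v [t₁, u₁, v₁, t₂, u₂, v₂] := by
    refine isTriangle_of_ends fun x hx => ?_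
    refine Eq.trans ?_ (hC.ends_eq (x := x) (by simp [used_cons]; tauto))
    simp only [ends_cons', List.map_cons, List.sum_cons, List.map_nil, List.sum_nil,
      Matrix.cons_val]
    ring
  obtain ⟨a1, a2, a3, ht, hu, hv, -, -, -⟩ := id hT
  simp only [List.mem_cons, List.not_mem_nil, or_false, forall_eq_or_imp, forall_eq] at ht hu hv
  constructor
  · refine fun h => h.of_triangle hT fun f b1 b2 b3 => ⟨f t₁, f t₁ + f t₁ - f u₂, f v₁, ?cols, ?const⟩
    all_goals simp [ColoredAt] at b1 b2 b3
    case cols => refine ⟨?_, ?_, ?_⟩ <;> simp [ColoredAt, recolor, ht, hu, hv, a1.symm, a2.symm, a3.symm] <;> grind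
    case const =>
      intro g c1 c2 c3
      simp [ConstantAt, recolor, ht, hu, hv, a1.symm, a2.symm, a3.symm] at c1 c2 c3 ⊢
      grind
  · refine fun h => h.of_triangle hT fun f b1 b2 b3 => ⟨f t₁, f t₁ + f t₁ - f u₁, f v₂, ?cols, ?const⟩
    all_goals simp [ColoredAt] at b1 b2 b3
    case cols => refine ⟨?_, ?_, ?_⟩ <;> simp [ColoredAt, recolor, ht, hu, hv, a1.symm, a2.symm, a3.symm] <;> grind
    case const =>
      intro g c1 c2 c3
      simp [ConstantAt, recolor, ht, hu, hv, a1.symm, a2.symm, a3.symm] at c1 c2 c3 ⊢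
      grind

lemma rigid_halfTurn (a b c d : ℕ) (R : List (Fin 4 → ℕ)) (S : List (Fin 2 → ℕ)) :
    Rigid A ⟨![a, b, c, d] :: R, S⟩ ↔ Rigid A ⟨![c, d, a, b] :: R, S⟩ := by
  constructor
  all_goals
    refine fun h => h.of fun f hf => ⟨f, ?_, fun g hg x hx => hg x ?_⟩
    · rw [isLabelColoring_cons] at hf ⊢
      refine ⟨?_, hf.2⟩
      have := hf.1
      simp at this ⊢
      grind
    · rw [used_cons] at hx ⊢
      simp at hx ⊢
      tauto

lemma rigid_flip (a b : ℕ) (R : List (Fin 4 → ℕ)) (S : List (Fin 2 → ℕ)) :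
    Rigid A ⟨R, ![a, b] :: S⟩ ↔ Rigid A ⟨R, ![b, a] :: S⟩ := by
  constructor
  all_goals
    refine fun h => h.of fun f hf => ⟨f, ?_, fun g hg x hx => hg x ?_⟩
    · rw [isLabelColoring_cons_marker] at hf ⊢
      exact ⟨hf.1.symm, hf.2⟩
    · rw [used_cons_marker] at hx ⊢
      simp at hx ⊢
      tauto

/-- The elementary moves preserve rigidity. -/
lemma Move.rigid_iff {C C' : Code} (h : Move C C') (hC : C.IsClosed) :
    Rigid A C ↔ Rigid A C' := by
  cases h with
  | perm hR hS => exact rigid_perm hR hS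
  | relabel f R S => exact rigid_relabel f R S
  | halfTurn a b c d R S => exact rigid_halfTurn a b c d R S
  | flip a b R S => exact rigid_flip a b R S
  | unmark a b hab R S => exact rigid_unmark a b hab R S hC
  | r1 a b c R S => exact rigid_r1 a b c R S hC
  | r1_mirror a b c R S => exact rigid_r1_mirror a b c R S hC
  | r2 p m q r n s R S => exact rigid_r2 p m q r n s R S hC
  | r3 t₁ u₁ v₁ t₂ u₂ v₂ t u v R S => exact rigid_r3 t₁ u₁ v₁ t₂ u₂ v₂ t u v R S hC
  | r3_mirror t₁ u₁ v₁ t₂ u₂ v₂ t u v R S => exact rigid_r3_mirror t₁ u₁ v₁ t₂ u₂ v₂ t u v R S hC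

end Code

/-! ### Nonconstant colorings as an obstruction to being the unknot -/

namespace LinkDiagram

variable {A : Type} [AddCommGroup A]

lemma SameLink.rigid_iff {D D' : LinkDiagram} (h : D.SameLink D') :
    Code.Rigid A D.toCode ↔ Code.Rigid A D'.toCode := by
  induction h with
  | rel D D' h => exact h.rigid_iff D.closed
  | refl D => exact Iff.rfl
  | symm D D' _ ih => exact ih.symm
  | trans D D' D'' _ _ ih ih' => exact ih.trans ih'

/-- The circle with one marker has a single label, so its colorings are constant. -/
lemma IsUnknot.rigid {D : LinkDiagram} (h : D.IsUnknot) : Code.Rigid A D.toCode := by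
  rw [SameLink.rigid_iff h]
  refine fun f _ => ⟨f 0, fun x hx => ?_⟩
  rcases hx with ⟨v, hv, -⟩ | ⟨m, hm, k, rfl⟩
  · exact absurd hv List.not_mem_nil
  · rw [List.mem_singleton.1 hm]
    fin_cases k <;> rfl

/-- A diagram is not rigid if its label structure maps onto a connected graph with at most one
loop. -/
theorem not_isUnknot_of_overpass {D : LinkDiagram} {V : Type} [Fintype V] [DecidableEq V]
    [Nonempty V] {s : V → Fin 2 → V} (hin : TwoOut.TwoIn s) (hc : TwoOut.Conn s)
    {ε : V × Fin 2} (hl : ∀ c k, s c k = c → (c, k) = ε) (ov : ℕ → V)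
    (hcr : ∀ v ∈ D.crossings, ov (v 1) = ov (v 3) ∧ ov (v 0) = s (ov (v 1)) 0 ∧
      ov (v 2) = s (ov (v 1)) 1)
    (hm : ∀ m ∈ D.markers, ov (m 0) = ov (m 1))
    (hov : ∀ c, ∃ x, D.toCode.Used x ∧ ov x = c) : ¬ D.IsUnknot := by
  intro hU
  -- The universal group of the overpass graph. Coloring each label by the class of its overpass is
  -- admissible, and rigidity would make all vertices equivalent modulo the Laplacian.
  let rel : V → V → ℤ := fun c =>
    2 • Pi.single c 1 - Pi.single (s c 0) 1 - Pi.single (s c 1) 1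
  let M := Submodule.span ℤ (Set.range rel)
  let e : V → (V → ℤ) ⧸ M := fun c => Submodule.Quotient.mk (Pi.single c 1)
  have hcol : D.toCode.IsLabelColoring (fun x => e (ov x)) := by
    refine ⟨fun v hv => ?_, fun m hm' => congrArg e (hm m hm')⟩
    obtain ⟨h1, h2, h3⟩ := hcr v hv
    refine ⟨congrArg e h1, ?_⟩
    simp only [h2, h3]
    have : rel (ov (v 1)) ∈ M := Submodule.subset_span ⟨_, rfl⟩
    rw [eq_comm, ← sub_eq_zero]
    simp only [e, ← Submodule.Quotient.mk_add, ← Submodule.Quotient.mk_sub]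
    rw [Submodule.Quotient.mk_eq_zero]
    convert this using 1
    simp only [rel]
    module
  obtain ⟨g, hg⟩ := hU.rigid _ hcol
  have he : ∀ c, e c = g := fun c => by
    obtain ⟨x, hx, rfl⟩ := hov c
    exact hg x hx
  obtain ⟨i, i', hii⟩ := TwoOut.exists_not_lap hin hc hl
  have hmem : (Pi.single i 1 - Pi.single i' 1 : V → ℤ) ∈ M := by
    rw [← Submodule.Quotient.eq]
    exact (he i).trans (he i').symm
  obtain ⟨w, hw⟩ := (Submodule.mem_span_range_iff_exists_fun ℤ).1 hmem
  refine hii w fun j => ?_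
  have := congrFun hw j
  simp only [rel, Finset.sum_apply, Pi.smul_apply, Pi.sub_apply, Pi.single_apply, smul_eq_mul]
    at this
  rw [← this, TwoOut.lap, Fintype.sum_prod_type]
  simp only [Fin.sum_univ_two, Finset.sum_add_distrib, mul_sub, Finset.sum_sub_distrib]
  simp [eq_comm]
  ring

end LinkDiagram

/-! ### Combinatorial maps and Euler's inequality -/

namespace CombMap

open Finset

variable {δ : Type} (lab : δ → ℕ) (turn : δ → δ)

/-- `o` exchanges the two ends of every edge. -/
structure IsOpp (o : δ → δ) : Prop where
  ne : ∀ d, o d ≠ d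
  iff : ∀ d e, lab e = lab d ↔ e = d ∨ e = o d

/-- The faces of a combinatorial map. -/
abbrev MapFace : Type := Quot fun d e : δ => ∃ d', d' ≠ d ∧ lab d' = lab d ∧ e = turn d'

/-- The connected pieces of a combinatorial map. -/
abbrev MapPiece : Type := Quot fun d e : δ => lab d = lab e ∨ e = turn d

variable {lab turn}

namespace IsOpp

variable {o : δ → δ}

lemma lab_opp (h : IsOpp lab o) (d : δ) : lab (o d) = lab d := (h.iff d _).2 (Or.inr rfl)

lemma opp_opp (h : IsOpp lab o) (d : δ) : o (o d) = d := by
  rcases (h.iff (o d) d).1 (h.lab_opp d).symm with h1 | h1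
  · exact absurd h1.symm (h.ne d)
  · exact h1.symm

lemma involutive (h : IsOpp lab o) : Function.Involutive o := h.opp_opp

lemma other_iff (h : IsOpp lab o) (d e : δ) : e ≠ d ∧ lab e = lab d ↔ e = o d := by
  rw [h.iff]
  constructor
  · tauto
  · rintro rfl; exact ⟨h.ne d, Or.inr rfl⟩

lemma existsUnique (h : IsOpp lab o) (d : δ) : ∃! d', d' ≠ d ∧ lab d' = lab d :=
  ⟨o d, ⟨h.ne d, h.lab_opp d⟩, fun e he => (h.other_iff d e).1 he⟩

lemma faceStep_iff (h : IsOpp lab o) (d e : δ) :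
    (∃ d', d' ≠ d ∧ lab d' = lab d ∧ e = turn d') ↔ e = turn (o d) := by
  constructor
  · rintro ⟨d', h1, h2, rfl⟩
    rw [(h.other_iff d d').1 ⟨h1, h2⟩]
  · rintro rfl
    exact ⟨o d, h.ne d, h.lab_opp d, rfl⟩

lemma face_eq (h : IsOpp lab o) (d : δ) :
    (Quot.mk _ (turn (o d)) : MapFace lab turn) = Quot.mk _ d :=
  (Quot.sound ((h.faceStep_iff d _).2 rfl)).symm

lemma piece_opp (h : IsOpp lab o) (d : δ) : (Quot.mk _ (o d) : MapPiece lab turn) = Quot.mk _ d :=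
  Quot.sound (Or.inl (h.lab_opp d))

end IsOpp

lemma piece_turn (d : δ) : (Quot.mk _ (turn d) : MapPiece lab turn) = Quot.mk _ d :=
  (Quot.sound (r := fun d e : δ => lab d = lab e ∨ e = turn d) (Or.inr rfl)).symm

lemma exists_isOpp (h : ∀ d, ∃! d', d' ≠ d ∧ lab d' = lab d) : ∃ o, IsOpp lab o := by
  choose o ho hu using h
  refine ⟨o, fun d => (ho d).1, fun d e => ⟨fun he => ?_, ?_⟩⟩
  · by_cases hed : e = d
    · exact Or.inl hed
    · exact Or.inr (hu d e ⟨hed, he⟩)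
  · rintro (rfl | rfl)
    · rfl
    · exact (ho d).2

/-- A function that is constant on pieces. -/
def PieceConst (lab : δ → ℕ) (turn : δ → δ) : Submodule ℚ (δ → ℚ) :=
  LinearMap.range (LinearMap.funLeft ℚ ℚ (Quot.mk _ : δ → MapPiece lab turn))

lemma mem_pieceConst {f : δ → ℚ} (h1 : ∀ d e, lab d = lab e → f d = f e)
    (h2 : ∀ d, f (turn d) = f d) : f ∈ PieceConst lab turn := by
  refine ⟨Quot.lift f ?_, ?_⟩
  · rintro d e (h | rfl)
    · exact h1 d e h
    · exact (h2 d).symm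
  · ext d
    rfl

/-- If the functions of the kernel become constant on pieces, then the kernel is small. -/
lemma finrank_ker_le [Finite δ] {α : Type} [Finite α] {M : Type} [AddCommGroup M] [Module ℚ M]
    (g : δ → α) (hg : Function.Surjective g) (Φ : (α → ℚ) →ₗ[ℚ] M)
    (h : ∀ f, Φ f = 0 → f ∘ g ∈ PieceConst lab turn) :
    Nat.card α ≤ Nat.card (MapPiece lab turn) + Module.finrank ℚ (LinearMap.range Φ) := by
  have hinj : Function.Injective (LinearMap.funLeft ℚ ℚ g) :=
    LinearMap.funLeft_injective_of_surjective _ _ _ hg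
  have h1 : Module.finrank ℚ (LinearMap.ker Φ) ≤ Nat.card (MapPiece lab turn) := by
    calc Module.finrank ℚ (LinearMap.ker Φ)
        = Module.finrank ℚ ((LinearMap.ker Φ).map (LinearMap.funLeft ℚ ℚ g)) :=
          (Submodule.equivMapOfInjective _ hinj _).finrank_eq
      _ ≤ Module.finrank ℚ (PieceConst lab turn) := by
          refine Submodule.finrank_mono ?_
          rintro _ ⟨f, hf, rfl⟩
          exact h f hf
      _ ≤ Module.finrank ℚ (MapPiece lab turn → ℚ) := LinearMap.finrank_range_le _
      _ = Nat.card (MapPiece lab turn) := by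
          have := Fintype.ofFinite (MapPiece lab turn)
          rw [Module.finrank_fintype_fun_eq_card, Nat.card_eq_fintype_card]
  have h2 := Φ.finrank_range_add_finrank_ker
  have h3 : Module.finrank ℚ (α → ℚ) = Nat.card α := by
    have := Fintype.ofFinite α
    rw [Module.finrank_fintype_fun_eq_card, Nat.card_eq_fintype_card]
  omega

/-- Euler's inequality: the genus is nonnegative. -/
theorem euler_le [Fintype δ] {o : δ → δ} (ho : IsOpp lab o) (ht : Function.Bijective turn)
    {W : Type} [Finite W] (vert : δ → W) (hs : Function.Surjective vert)
    (hv : ∀ d, vert (turn d) = vert d) :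
    2 * (Nat.card W + Nat.card (MapFace lab turn)) ≤
      Fintype.card δ + 4 * Nat.card (MapPiece lab turn) := by
  classical
  let e := Fintype.equivFin δ
  -- An arbitrary numbering of the ends selects one end of each edge.
  let E := {d : δ // e d < e (o d)}
  have hE : ∀ d, e d < e (o d) ∨ e (o d) < e d := fun d =>
    lt_or_gt_of_ne fun h => ho.ne d (e.injective h).symm
  have hcard : 2 * Fintype.card E = Fintype.card δ := by
    have h1 : Fintype.card E = Fintype.card {d : δ // ¬ e d < e (o d)} := by
      refine Fintype.card_congr
        { toFun := fun d => ⟨o d.1, by rw [ho.opp_opp]; exact not_lt.2 d.2.le⟩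
          invFun := fun d => ⟨o d.1, by
            rw [ho.opp_opp]; exact (hE d.1).resolve_left d.2⟩
          left_inv := fun d => Subtype.ext (ho.opp_opp _)
          right_inv := fun d => Subtype.ext (ho.opp_opp _) }
    have h2 := Fintype.card_subtype_compl (fun d : δ => e d < e (o d))
    have h3 := Fintype.card_subtype_le (fun d : δ => e d < e (o d))
    change _ = Fintype.card δ - Fintype.card E at h2
    change Fintype.card E ≤ _ at h3
    omega
  let dif : (δ → ℚ) →ₗ[ℚ] (E → ℚ) :=
    LinearMap.funLeft ℚ ℚ (fun d : E => d.1) - LinearMap.funLeft ℚ ℚ (fun d : E => o d.1)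
  have hdif : ∀ f d, dif f d = f d.1 - f (o d.1) := fun f d => rfl
  have hdif0 : ∀ f, dif f = 0 → ∀ d d', lab d = lab d' → f d = f d' := by
    intro f hf
    have h1 : ∀ d, f (o d) = f d := by
      intro d
      rcases hE d with h | h
      · have := congrFun hf ⟨d, h⟩
        rw [hdif] at this
        exact (sub_eq_zero.1 this).symm
      · have := congrFun hf ⟨o d, by rwa [ho.opp_opp]⟩
        have h2 : f (o d) - f (o (o d)) = 0 := this
        rw [ho.opp_opp] at h2
        exact sub_eq_zero.1 h2
    intro d d' h
    rcases (ho.iff d' d).1 h with rfl | rfl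
    · rfl
    · exact h1 _
  let q : δ → MapFace lab turn := Quot.mk _
  -- These are the coboundary maps of the dual graph and of the graph. Their kernels are constant on
  -- pieces, so their ranks are at least the numbers of faces and of vertices minus the number of
  -- pieces. As the ranges are disjoint, the ranks add up to at most the number of edges.
  let Φ := dif.comp (LinearMap.funLeft ℚ ℚ q)
  let Ψ := dif.comp (LinearMap.funLeft ℚ ℚ vert)
  have hF := finrank_ker_le (lab := lab) (turn := turn) q Quot.mk_surjective Φ (fun f hf => by
    refine mem_pieceConst (hdif0 _ hf) fun d => ?_
    have h1 := hdif0 _ hf d (o d) (ho.lab_opp d).symm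
    have h2 := ho.face_eq (turn := turn) (o d)
    rw [ho.opp_opp] at h2
    exact (congrArg f h2).trans h1.symm)
  have hW := finrank_ker_le (lab := lab) (turn := turn) vert hs Ψ (fun f hf =>
    mem_pieceConst (hdif0 _ hf) fun d => congrArg f (hv d))
  -- The ranges are orthogonal: reindexing by `o` and by `turn ∘ o` makes the pairing vanish, so a
  -- common element has zero sum of squares.
  have hdisj : Disjoint (LinearMap.range Φ) (LinearMap.range Ψ) := by
    rw [Submodule.disjoint_def]
    rintro _ ⟨f, rfl⟩ ⟨w, hw⟩
    have hall : ∀ d, w (vert d) - w (vert (o d)) = f (q d) - f (q (o d)) := by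
      intro d
      rcases hE d with h | h
      · exact congrFun hw ⟨d, h⟩
      · have := congrFun hw ⟨o d, by rwa [ho.opp_opp]⟩
        change w (vert (o d)) - w (vert (o (o d))) = f (q (o d)) - f (q (o (o d))) at this
        rw [ho.opp_opp] at this
        linarith
    have hsum : ∑ d, (f (q d) - f (q (o d))) * (w (vert d) - w (vert (o d))) = 0 := by
      have e1 : ∑ d, f (q (o d)) * w (vert d) = ∑ d, f (q d) * w (vert (o d)) :=
        Fintype.sum_bijective o ho.involutive.bijective _ _ fun d => by rw [ho.opp_opp]
      have e2 : ∑ d, f (q (o d)) * w (vert (o d)) = ∑ d, f (q d) * w (vert d) :=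
        Fintype.sum_bijective o ho.involutive.bijective _ _ fun d => rfl
      have e3 : ∑ d, f (q d) * w (vert (o d)) = ∑ d, f (q d) * w (vert d) :=
        Fintype.sum_bijective (fun d => turn (o d)) (ht.comp ho.involutive.bijective) _ _
          fun d => by rw [hv, show q (turn (o d)) = q d from ho.face_eq d]
      simp_rw [sub_mul, mul_sub, sum_sub_distrib]
      rw [e1, e2, e3]
      ring
    simp_rw [hall] at hsum
    rw [sum_eq_zero_iff_of_nonneg fun d _ => mul_self_nonneg _] at hsum
    ext d
    exact mul_self_eq_zero.1 (hsum d.1 (mem_univ _))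
  have hrank := Submodule.finrank_add_finrank_le_of_disjoint hdisj
  rw [Module.finrank_fintype_fun_eq_card] at hrank
  omega

/-- Isomorphic maps have the same number of faces. -/
lemma card_face_congr {δ' : Type} {lab' : δ' → ℕ} {turn' : δ' → δ'} (φ : δ ≃ δ')
    (hl : ∀ d, lab' (φ d) = lab d) (ht : ∀ d, turn' (φ d) = φ (turn d)) :
    Nat.card (MapFace lab turn) = Nat.card (MapFace lab' turn') := by
  refine Nat.card_congr (Quot.congr φ fun d e => ?_)
  constructor
  · rintro ⟨d', h1, h2, rfl⟩
    exact ⟨φ d', by simpa using h1, by rw [hl, hl, h2], (ht _).symm⟩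
  · rintro ⟨d', h1, h2, h3⟩
    obtain ⟨x, rfl⟩ := φ.surjective d'
    rw [ht] at h3
    exact ⟨x, by simpa using h1, by rw [← hl, h2, hl], φ.injective h3⟩

lemma card_piece_congr {δ' : Type} {lab' : δ' → ℕ} {turn' : δ' → δ'} (φ : δ ≃ δ')
    (hl : ∀ d, lab' (φ d) = lab d) (ht : ∀ d, turn' (φ d) = φ (turn d)) :
    Nat.card (MapPiece lab turn) = Nat.card (MapPiece lab' turn') := by
  refine Nat.card_congr (Quot.congr φ fun d e => ?_)
  rw [hl, hl, ht, φ.injective.eq_iff]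

end CombMap

/-! ### Codes as unordered families of crossings and markers -/

namespace Code

open Finset CombMap

variable {I J : Type}

/-- The ends at families of crossings and markers. -/
abbrev FDart (I J : Type) : Type := (I × Fin 4) ⊕ (J × Fin 2)

/-- The labels of the ends. -/
def flabel (v : I → Fin 4 → ℕ) (m : J → Fin 2 → ℕ) : FDart I J → ℕ
  | Sum.inl p => v p.1 p.2
  | Sum.inr p => m p.1 p.2

/-- The next end, counterclockwise. -/
def fturn : FDart I J → FDart I J
  | Sum.inl p => Sum.inl (p.1, p.2 + 1)
  | Sum.inr p => Sum.inr (p.1, p.2 + 1)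

/-- The crossing or marker of an end. -/
def fvert : FDart I J → I ⊕ J := Sum.map Prod.fst Prod.fst

lemma fturn_bijective : Function.Bijective (fturn : FDart I J → FDart I J) := by
  refine Function.bijective_iff_has_inverse.2
    ⟨Sum.map (fun p => (p.1, p.2 - 1)) (fun p => (p.1, p.2 - 1)), ?_, ?_⟩ <;>
  rintro (⟨i, k⟩ | ⟨j, k⟩) <;> simp [fturn]

lemma fvert_surjective : Function.Surjective (fvert : FDart I J → I ⊕ J) := by
  rintro (i | j)
  · exact ⟨Sum.inl (i, 0), rfl⟩
  · exact ⟨Sum.inr (j, 0), rfl⟩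

lemma fvert_fturn (d : FDart I J) : fvert (fturn d) = fvert d := by
  rcases d with d | d <;> rfl

/-- Euler's formula for families of crossings and markers. -/
def FPlanar (v : I → Fin 4 → ℕ) (m : J → Fin 2 → ℕ) : Prop :=
  Nat.card (MapFace (flabel v m) fturn) = Nat.card I + 2 * Nat.card (MapPiece (flabel v m) fturn)

variable {v : I → Fin 4 → ℕ} {m : J → Fin 2 → ℕ}

/-- A marker adds one vertex and one edge, so markers drop out of Euler's inequality. -/
lemma card_face_le [Finite I] [Finite J] {o : FDart I J → FDart I J} (ho : IsOpp (flabel v m) o) :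
    Nat.card (MapFace (flabel v m) fturn) ≤ Nat.card I + 2 * Nat.card (MapPiece (flabel v m) fturn) := by
  have := Fintype.ofFinite I
  have := Fintype.ofFinite J
  have h := euler_le ho fturn_bijective fvert fvert_surjective fvert_fturn
  simp only [Nat.card_eq_fintype_card (α := I ⊕ J), Fintype.card_sum, Fintype.card_prod,
    Fintype.card_fin] at h
  rw [Nat.card_eq_fintype_card (α := I)]
  omega

/-- A description of a code by families of crossings and markers. -/
structure Presents (C : Code) (v : I → Fin 4 → ℕ) (m : J → Fin 2 → ℕ) where
  eI : I ≃ Fin C.crossings.length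
  hI : ∀ i, C.crossings.get (eI i) = v i
  eJ : J ≃ Fin C.markers.length
  hJ : ∀ j, C.markers.get (eJ j) = m j

namespace Presents

variable {C : Code}

/-- The induced bijection of ends. -/
def dart (P : C.Presents v m) : FDart I J ≃ C.Dart :=
  Equiv.sumCongr (P.eI.prodCongr (Equiv.refl _)) (P.eJ.prodCongr (Equiv.refl _))

lemma label_dart (P : C.Presents v m) (d : FDart I J) : C.label (P.dart d) = flabel v m d := by
  rcases d with ⟨i, k⟩ | ⟨j, k⟩
  · exact congrFun (P.hI i) k
  · exact congrFun (P.hJ j) k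

lemma turn_dart (P : C.Presents v m) (d : FDart I J) : C.turn (P.dart d) = P.dart (fturn d) := by
  rcases d with d | d <;> rfl

lemma isClosed_iff (P : C.Presents v m) : C.IsClosed ↔ ∃ o, IsOpp (flabel v m) o := by
  constructor
  · intro h
    obtain ⟨o, ho⟩ := exists_isOpp (lab := C.label) h
    refine ⟨fun d => P.dart.symm (o (P.dart d)), fun d hd => ?_, fun d e => ?_⟩
    · rw [Equiv.symm_apply_eq] at hd
      exact ho.ne _ hd
    · rw [← P.label_dart, ← P.label_dart, ho.iff, P.dart.injective.eq_iff, Equiv.eq_symm_apply]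
  · rintro ⟨o, ho⟩
    have : IsOpp C.label (fun d => P.dart (o (P.dart.symm d))) := by
      refine ⟨fun d hd => ?_, fun d e => ?_⟩
      · rw [← Equiv.eq_symm_apply] at hd
        exact ho.ne _ hd
      · obtain ⟨d, rfl⟩ := P.dart.surjective d
        obtain ⟨e, rfl⟩ := P.dart.surjective e
        rw [P.label_dart, P.label_dart, ho.iff, Equiv.symm_apply_apply, P.dart.injective.eq_iff,
          P.dart.injective.eq_iff]
    exact this.existsUnique

lemma isPlanar_iff (P : C.Presents v m) : C.IsPlanar ↔ FPlanar v m := by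
  have h1 := card_face_congr P.dart P.label_dart P.turn_dart
  have h2 := card_piece_congr P.dart P.label_dart P.turn_dart
  have h3 : Nat.card I = C.crossings.length := by rw [Nat.card_congr P.eI, Nat.card_fin]
  have h4 : Nat.card J = C.markers.length := by rw [Nat.card_congr P.eJ, Nat.card_fin]
  change _ + _ + Nat.card (MapFace C.label C.turn) = _ + 2 * Nat.card (MapPiece C.label C.turn) ↔ _
  rw [FPlanar, ← h1, ← h2, h3]
  omega

end Presents

/-- Equal multisets have fibers of the same size over each value, and bijections of the fibers are
glued together. -/
lemma exists_equiv_get {α ι : Type} [Fintype ι] (l : List α) (f : ι → α)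
    (h : (l : Multiset α) = univ.val.map f) :
    ∃ e : ι ≃ Fin l.length, ∀ i, l.get (e i) = f i := by
  classical
  have hl : (l : Multiset α) = univ.val.map l.get := by
    rw [Fin.univ_val_map, List.ofFn_get]
  have hcard : ∀ a, Fintype.card {i // f i = a} = Fintype.card {k // l.get k = a} := by
    intro a
    have := congrArg (Multiset.count a) (h.symm.trans hl)
    rw [Multiset.count_map, Multiset.count_map] at this
    rw [Fintype.card_subtype, Fintype.card_subtype]
    rw [← Finset.filter_val, ← Finset.filter_val] at this
    have h2 : #{x | a = f x} = #{x | a = l.get x} := this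
    simpa only [eq_comm] using h2
  refine ⟨(Equiv.sigmaFiberEquiv f).symm.trans ((Equiv.sigmaCongrRight fun a =>
    Fintype.equivOfCardEq (hcard a)).trans (Equiv.sigmaFiberEquiv l.get)), fun i => ?_⟩
  exact (Fintype.equivOfCardEq (hcard (f i)) ⟨i, rfl⟩).2

lemma exists_presents [Fintype I] [Fintype J] (C : Code)
    (hI : (C.crossings : Multiset (Fin 4 → ℕ)) = univ.val.map v)
    (hJ : (C.markers : Multiset (Fin 2 → ℕ)) = univ.val.map m) : Nonempty (C.Presents v m) := by
  obtain ⟨eI, h1⟩ := exists_equiv_get _ _ hI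
  obtain ⟨eJ, h2⟩ := exists_equiv_get _ _ hJ
  exact ⟨eI, h1, eJ, h2⟩

end Code

/-! ### Deleting a marker -/

namespace Code

open Finset CombMap

variable {I J : Type}

/-- The strands between crossings. -/
abbrev FStrand (v : I → Fin 4 → ℕ) (m : J → Fin 2 → ℕ) : Type :=
  Quot fun d e : FDart I J => flabel v m d = flabel v m e ∨
    ∃ j, d = Sum.inr (j, 0) ∧ e = Sum.inr (j, 1)

/-- The arcs. -/
abbrev FArc (v : I → Fin 4 → ℕ) (m : J → Fin 2 → ℕ) : Type :=
  Quot fun d e : FDart I J => (flabel v m d = flabel v m e ∨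
    ∃ j, d = Sum.inr (j, 0) ∧ e = Sum.inr (j, 1)) ∨ ∃ i, d = Sum.inl (i, 1) ∧ e = Sum.inl (i, 3)

/-- No crossing is nugatory. -/
def FReduced (v : I → Fin 4 → ℕ) (m : J → Fin 2 → ℕ) : Prop :=
  ∀ i k, (Quot.mk _ (Sum.inl (i, k)) : MapFace (flabel v m) fturn) ≠
    Quot.mk _ (Sum.inl (i, k + 2))

/-- Over- and under-crossings alternate. -/
def FAlternating (v : I → Fin 4 → ℕ) (m : J → Fin 2 → ℕ) : Prop :=
  ∀ (i i' : I) (k k' : Fin 4), (i, k) ≠ (i', k') →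
    (Quot.mk _ (Sum.inl (i, k)) : FStrand v m) = Quot.mk _ (Sum.inl (i', k')) →
      (Odd k.val ↔ Even k'.val)

section

variable {a b : ℕ} {v : I → Fin 4 → ℕ} {m : Option J → Fin 2 → ℕ}
  {o : FDart I (Option J) → FDart I (Option J)}

/-- The ends of a map, as ends of the same map with one more marker. -/
def emb : FDart I J → FDart I (Option J)
  | Sum.inl p => Sum.inl p
  | Sum.inr p => Sum.inr (some p.1, p.2)

lemma emb_injective : Function.Injective (emb : FDart I J → FDart I (Option J)) := by
  rintro (⟨i, k⟩ | ⟨j, k⟩) (⟨i', k'⟩ | ⟨j', k'⟩) h <;> simp_all [emb]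

lemma fturn_emb (d : FDart I J) : fturn (emb d) = emb (fturn d) := by
  rcases d with d | d <;> rfl

/-- The labels after deletion of the marker `none`. -/
abbrev unmarkLabel (a b : ℕ) (v : I → Fin 4 → ℕ) (m : Option J → Fin 2 → ℕ) :
    FDart I J → ℕ :=
  flabel (fun i => mergeLabel a b ∘ v i) (fun j => mergeLabel a b ∘ m (some j))

lemma unmarkLabel_eq (d : FDart I J) :
    unmarkLabel a b v m d = mergeLabel a b (flabel v m (emb d)) := by
  rcases d with d | d <;> rfl

/-- The first end at the marker `none`. -/
def mark (k : Fin 2) : FDart I (Option J) := Sum.inr (none, k)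

lemma eq_emb_or_mark (d : FDart I (Option J)) : (∃ x, d = emb x) ∨ d = mark 0 ∨ d = mark 1 := by
  rcases d with p | ⟨_ | j, k⟩
  · exact Or.inl ⟨Sum.inl p, rfl⟩
  · fin_cases k
    · exact Or.inr (Or.inl rfl)
    · exact Or.inr (Or.inr rfl)
  · exact Or.inl ⟨Sum.inr (j, k), rfl⟩

lemma emb_ne_mark (x : FDart I J) (k : Fin 2) : emb x ≠ mark k := by
  rcases x with x | x <;> simp [emb, mark]

/-- The two ends `p` and `q` which are opposite to the ends of the marker `none`. -/
structure IsMark (a b : ℕ) (v : I → Fin 4 → ℕ) (m : Option J → Fin 2 → ℕ)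
    (o : FDart I (Option J) → FDart I (Option J)) (p q : FDart I J) : Prop where
  opp : IsOpp (flabel v m) o
  ne : a ≠ b
  mark_zero : flabel v m (mark 0) = a
  mark_one : flabel v m (mark 1) = b
  left : o (mark 0) = emb p
  right : o (mark 1) = emb q

/-- The labels at the marker differ, so its two ends are not opposite to each other and their
opposites lie in the rest of the map. -/
lemma exists_isMark (ho : IsOpp (flabel v m) o) (hab : a ≠ b) (hm : m none = ![a, b]) :
    ∃ p q, IsMark a b v m o p q := by
  have h0 : flabel v m (mark 0) = a := by simp [flabel, mark, hm]
  have h1 : flabel v m (mark 1) = b := by simp [flabel, mark, hm]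
  have hl := ho.lab_opp (mark 0)
  have hr := ho.lab_opp (mark 1)
  rcases eq_emb_or_mark (o (mark 0)) with ⟨p, hp⟩ | h | h
  rotate_left
  · exact absurd h (ho.ne _)
  · rw [h, h0, h1] at hl; exact absurd hl.symm hab
  rcases eq_emb_or_mark (o (mark 1)) with ⟨q, hq⟩ | h | h
  rotate_left
  · rw [h, h0, h1] at hr; exact absurd hr hab
  · exact absurd h (ho.ne _)
  exact ⟨p, q, ho, hab, h0, h1, hp, hq⟩

namespace IsMark

variable {p q : FDart I J}

lemma label_left_iff (h : IsMark a b v m o p q) (x : FDart I J) :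
    flabel v m (emb x) = a ↔ x = p := by
  rw [← h.mark_zero, h.opp.iff, h.left, emb_injective.eq_iff]
  simp [emb_ne_mark]

lemma label_right_iff (h : IsMark a b v m o p q) (x : FDart I J) :
    flabel v m (emb x) = b ↔ x = q := by
  rw [← h.mark_one, h.opp.iff, h.right, emb_injective.eq_iff]
  simp [emb_ne_mark]

lemma left_ne_right (h : IsMark a b v m o p q) : p ≠ q := by
  intro hpq
  have h1 := (h.label_left_iff p).2 rfl
  have h2 := (h.label_right_iff p).2 hpq
  exact h.ne (h1.symm.trans h2)

lemma opp_left (h : IsMark a b v m o p q) : o (emb p) = mark 0 := by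
  rw [← h.left, h.opp.opp_opp]

lemma opp_right (h : IsMark a b v m o p q) : o (emb q) = mark 1 := by
  rw [← h.right, h.opp.opp_opp]

lemma exists_opp (h : IsMark a b v m o p q) {x : FDart I J} (h1 : x ≠ p) (h2 : x ≠ q) :
    ∃ y, o (emb x) = emb y := by
  rcases eq_emb_or_mark (o (emb x)) with hy | hy | hy
  · exact hy
  · rw [← h.opp_left] at hy
    exact absurd (emb_injective (h.opp.involutive.injective hy)) h1
  · rw [← h.opp_right] at hy
    exact absurd (emb_injective (h.opp.involutive.injective hy)) h2

lemma merge_eq_iff (h : IsMark a b v m o p q) (x y : FDart I J) :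
    unmarkLabel a b v m y = unmarkLabel a b v m x ↔
      flabel v m (emb y) = flabel v m (emb x) ∨ ((x = p ∨ x = q) ∧ (y = p ∨ y = q)) := by
  rw [unmarkLabel_eq, unmarkLabel_eq, ← h.label_left_iff x, ← h.label_left_iff y,
    ← h.label_right_iff x, ← h.label_right_iff y]
  simp only [mergeLabel]
  split_ifs <;> grind

/-- The far ends `p` and `q` of the two edges at the marker become the two ends of the merged edge.
-/
lemma exists_unmark_opp (h : IsMark a b v m o p q) :
    ∃ o' : FDart I J → FDart I J, IsOpp (unmarkLabel a b v m) o' ∧ o' p = q ∧ o' q = p ∧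
      ∀ x, x ≠ p → x ≠ q → o (emb x) = emb (o' x) := by
  classical
  have hex : ∀ x, ∃ y, x ≠ p → x ≠ q → o (emb x) = emb y := by
    intro x
    by_cases h1 : x = p
    · exact ⟨x, fun h => absurd h1 h⟩
    · by_cases h2 : x = q
      · exact ⟨x, fun _ h => absurd h2 h⟩
      · obtain ⟨y, hy⟩ := h.exists_opp h1 h2
        exact ⟨y, fun _ _ => hy⟩
  choose r hr using hex
  have hpq := h.left_ne_right
  have h3 : ∀ x, x ≠ p → x ≠ q →
      o (emb x) = emb (if x = p then q else if x = q then p else r x) := by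
    intro x h1 h2
    rw [if_neg h1, if_neg h2]
    exact hr x h1 h2
  refine ⟨fun x => if x = p then q else if x = q then p else r x, ⟨fun d => ?_, fun d e => ?_⟩,
    by simp, by simp [hpq.symm], h3⟩
  · by_cases h1 : d = p
    · simp [h1, hpq.symm]
    · by_cases h2 : d = q
      · simp [h2, hpq.symm, hpq]
      · intro h4
        have h5 := h3 d h1 h2
        rw [h4] at h5
        exact h.opp.ne _ h5
  · rw [h.merge_eq_iff, h.opp.iff, emb_injective.eq_iff]
    by_cases h1 : d = p
    · subst h1
      simp only [h.opp_left, emb_ne_mark, if_true, true_or, true_and]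
      tauto
    · by_cases h2 : d = q
      · subst h2
        simp only [h.opp_right, emb_ne_mark, if_true, or_true, true_and, h1, if_false]
        tauto
      · rw [h3 d h1 h2, emb_injective.eq_iff]
        tauto

/-- Deleting a marker does not change the faces. -/
lemma exists_faceEquiv (h : IsMark a b v m o p q) :
    ∃ f : MapFace (unmarkLabel a b v m) fturn ≃ MapFace (flabel v m) fturn,
      ∀ x, f (Quot.mk _ x) = Quot.mk _ (emb x) := by
  obtain ⟨o', ho', hp, hq, hx⟩ := h.exists_unmark_opp
  have hfp : (Quot.mk _ (fturn q) : MapFace (unmarkLabel a b v m) fturn) = Quot.mk _ p := by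
    rw [← hp]; exact ho'.face_eq p
  have hfq : (Quot.mk _ (fturn p) : MapFace (unmarkLabel a b v m) fturn) = Quot.mk _ q := by
    rw [← hq]; exact ho'.face_eq q
  have e0 : (Quot.mk _ (emb (fturn p)) : MapFace (flabel v m) fturn) = Quot.mk _ (mark 0) := by
    rw [← h.opp.face_eq (mark 0), h.left, fturn_emb]
  have e1 : (Quot.mk _ (emb (fturn q)) : MapFace (flabel v m) fturn) = Quot.mk _ (mark 1) := by
    rw [← h.opp.face_eq (mark 1), h.right, fturn_emb]
  have e2 : (Quot.mk _ (mark 1) : MapFace (flabel v m) fturn) = Quot.mk _ (emb p) := by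
    rw [← h.opp.face_eq (emb p), h.opp_left]; rfl
  have e3 : (Quot.mk _ (mark 0) : MapFace (flabel v m) fturn) = Quot.mk _ (emb q) := by
    rw [← h.opp.face_eq (emb q), h.opp_right]; rfl
  -- The two corners at the marker lie in the faces of `q` and of `p`, by `e3` and `e2`.
  let g : FDart I (Option J) → MapFace (unmarkLabel a b v m) fturn
    | Sum.inl x => Quot.mk _ (Sum.inl x)
    | Sum.inr (some j, k) => Quot.mk _ (Sum.inr (j, k))
    | Sum.inr (none, 0) => Quot.mk _ q
    | Sum.inr (none, 1) => Quot.mk _ p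
  have hg : ∀ x, g (emb x) = Quot.mk _ x := by rintro (x | x) <;> rfl
  have hg0 : g (mark 0) = Quot.mk _ q := rfl
  have hg1 : g (mark 1) = Quot.mk _ p := rfl
  refine ⟨⟨Quot.lift (fun x => Quot.mk _ (emb x)) ?_, Quot.lift g ?_, ?_, ?_⟩, fun x => rfl⟩
  · intro x y hxy
    rw [ho'.faceStep_iff] at hxy
    subst hxy
    by_cases h1 : x = p
    · rw [h1, hp, e1, e2]
    · by_cases h2 : x = q
      · rw [h2, hq, e0, e3]
      · rw [← fturn_emb, ← hx x h1 h2, h.opp.face_eq]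
  · intro d e hde
    rw [h.opp.faceStep_iff] at hde
    subst hde
    rcases eq_emb_or_mark d with ⟨x, rfl⟩ | rfl | rfl
    · rw [hg]
      by_cases h1 : x = p
      · rw [h1, h.opp_left]
        exact hg1.symm
      · by_cases h2 : x = q
        · rw [h2, h.opp_right]
          exact hg0.symm
        · rw [hx x h1 h2, fturn_emb, hg, ho'.face_eq]
    · rw [hg0, h.left, fturn_emb, hg, hfq]
    · rw [hg1, h.right, fturn_emb, hg, hfp]
  · rintro ⟨x⟩
    exact hg x
  · rintro ⟨d⟩
    change Quot.lift _ _ (g d) = Quot.mk _ d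
    rcases eq_emb_or_mark d with ⟨x, rfl⟩ | rfl | rfl
    · rw [hg]
    · rw [hg0]; exact e3.symm
    · rw [hg1]; exact e2.symm

/-- Quotients of the ends by a relation that identifies the ends of edges and of markers are
unchanged. -/
lemma exists_quotEquiv (h : IsMark a b v m o p q) (r : FDart I (Option J) → FDart I (Option J) → Prop)
    (r' : FDart I J → FDart I J → Prop)
    (hr : ∀ d e, flabel v m d = flabel v m e → r d e)
    (hr' : ∀ d e, unmarkLabel a b v m d = unmarkLabel a b v m e → r' d e)
    (hmark : (Quot.mk r (mark 0)) = Quot.mk r (mark 1))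
    (hrr : ∀ d e, r d e → flabel v m d = flabel v m e ∨ (∃ x y, d = emb x ∧ e = emb y ∧ r' x y) ∨
      (∃ k l, d = mark k ∧ e = mark l))
    (hrr' : ∀ x y, r' x y → unmarkLabel a b v m x = unmarkLabel a b v m y ∨ r (emb x) (emb y)) :
    ∃ f : Quot r' ≃ Quot r, ∀ x, f (Quot.mk _ x) = Quot.mk _ (emb x) := by
  have hp : Quot.mk r (mark 0) = Quot.mk r (emb p) := by
    rw [← h.left]; exact Quot.sound (hr _ _ (h.opp.lab_opp _).symm)
  have hq : Quot.mk r (mark 1) = Quot.mk r (emb q) := by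
    rw [← h.right]; exact Quot.sound (hr _ _ (h.opp.lab_opp _).symm)
  have hpq : Quot.mk r' p = Quot.mk r' q :=
    Quot.sound (hr' _ _ ((h.merge_eq_iff q p).2 (by simp)))
  let g : FDart I (Option J) → Quot r'
    | Sum.inl x => Quot.mk _ (Sum.inl x)
    | Sum.inr (some j, k) => Quot.mk _ (Sum.inr (j, k))
    | Sum.inr (none, _) => Quot.mk _ p
  have hg : ∀ x, g (emb x) = Quot.mk _ x := by rintro (x | x) <;> rfl
  have hgm : ∀ k, g (mark k) = Quot.mk _ p := fun k => rfl
  have hgl : ∀ d e, flabel v m d = flabel v m e → g d = g e := by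
    intro d e hde
    rcases (h.opp.iff e d).1 hde with rfl | rfl
    · rfl
    · rcases eq_emb_or_mark e with ⟨x, rfl⟩ | rfl | rfl
      · by_cases h1 : x = p
        · rw [h1, h.opp_left, hg, hgm]
        · by_cases h2 : x = q
          · rw [h2, h.opp_right, hg, hgm, hpq]
          · obtain ⟨y, hy⟩ := h.exists_opp h1 h2
            rw [hy, hg, hg]
            refine Quot.sound (hr' _ _ ((h.merge_eq_iff x y).2 (Or.inl ?_)).symm) |>.symm
            rw [← hy, h.opp.lab_opp]
      · rw [h.left, hg, hgm]
      · rw [h.right, hg, hgm, hpq]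
  have hfl : ∀ x y, unmarkLabel a b v m x = unmarkLabel a b v m y →
      Quot.mk r (emb x) = Quot.mk r (emb y) := by
    intro x y hxy
    rcases (h.merge_eq_iff y x).1 hxy with h1 | ⟨h1, h2⟩
    · exact Quot.sound (hr _ _ h1)
    · rcases h1 with rfl | rfl <;> rcases h2 with rfl | rfl
      · rfl
      · rw [← hp, ← hq, hmark]
      · rw [← hp, ← hq, hmark]
      · rfl
  refine ⟨⟨Quot.lift (fun x => Quot.mk _ (emb x)) ?_, Quot.lift g ?_, ?_, ?_⟩, fun x => rfl⟩
  · intro x y hxy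
    rcases hrr' x y hxy with h1 | h1
    · exact hfl x y h1
    · exact Quot.sound h1
  · intro d e hde
    rcases hrr d e hde with h1 | ⟨x, y, rfl, rfl, h1⟩ | ⟨k, l, rfl, rfl⟩
    · exact hgl d e h1
    · rw [hg, hg]; exact Quot.sound h1
    · rw [hgm, hgm]
  · rintro ⟨x⟩
    exact hg x
  · rintro ⟨d⟩
    change Quot.lift _ _ (g d) = Quot.mk _ d
    rcases eq_emb_or_mark d with ⟨x, rfl⟩ | rfl | rfl
    · rw [hg]
    · rw [hgm]; exact hp.symm
    · rw [hgm, ← hmark]; exact hp.symm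

lemma exists_pieceEquiv (h : IsMark a b v m o p q) :
    ∃ f : MapPiece (unmarkLabel a b v m) fturn ≃ MapPiece (flabel v m) fturn,
      ∀ x, f (Quot.mk _ x) = Quot.mk _ (emb x) := by
  refine h.exists_quotEquiv _ _ (fun d e h => Or.inl h) (fun d e h => Or.inl h)
    (Quot.sound (Or.inr rfl)) ?_ ?_
  · rintro d e (h1 | rfl)
    · exact Or.inl h1
    · rcases eq_emb_or_mark d with ⟨x, rfl⟩ | rfl | rfl
      · exact Or.inr (Or.inl ⟨x, fturn x, rfl, fturn_emb x, Or.inr rfl⟩)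
      · exact Or.inr (Or.inr ⟨0, 1, rfl, rfl⟩)
      · exact Or.inr (Or.inr ⟨1, 0, rfl, rfl⟩)
  · rintro x y (h1 | rfl)
    · exact Or.inl h1
    · exact Or.inr (Or.inr (fturn_emb x).symm)

lemma exists_strandEquiv (h : IsMark a b v m o p q) :
    ∃ f : FStrand (fun i => mergeLabel a b ∘ v i) (fun j => mergeLabel a b ∘ m (some j)) ≃
        FStrand v m, ∀ x, f (Quot.mk _ x) = Quot.mk _ (emb x) := by
  refine h.exists_quotEquiv _ _ (fun d e h => Or.inl h) (fun d e h => Or.inl h)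
    (Quot.sound (Or.inr ⟨none, rfl, rfl⟩)) ?_ ?_
  · rintro d e (h1 | ⟨_ | j, rfl, rfl⟩)
    · exact Or.inl h1
    · exact Or.inr (Or.inr ⟨0, 1, rfl, rfl⟩)
    · exact Or.inr (Or.inl ⟨Sum.inr (j, 0), Sum.inr (j, 1), rfl, rfl, Or.inr ⟨j, rfl, rfl⟩⟩)
  · rintro x y (h1 | ⟨j, rfl, rfl⟩)
    · exact Or.inl h1
    · exact Or.inr (Or.inr ⟨some j, rfl, rfl⟩)

lemma exists_arcEquiv (h : IsMark a b v m o p q) :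
    ∃ f : FArc (fun i => mergeLabel a b ∘ v i) (fun j => mergeLabel a b ∘ m (some j)) ≃
        FArc v m, ∀ x, f (Quot.mk _ x) = Quot.mk _ (emb x) := by
  refine h.exists_quotEquiv _ _ (fun d e h => Or.inl (Or.inl h)) (fun d e h => Or.inl (Or.inl h))
    (Quot.sound (Or.inl (Or.inr ⟨none, rfl, rfl⟩))) ?_ ?_
  · rintro d e ((h1 | ⟨_ | j, rfl, rfl⟩) | ⟨i, rfl, rfl⟩)
    · exact Or.inl h1
    · exact Or.inr (Or.inr ⟨0, 1, rfl, rfl⟩)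
    · exact Or.inr (Or.inl ⟨Sum.inr (j, 0), Sum.inr (j, 1), rfl, rfl, Or.inl (Or.inr ⟨j, rfl, rfl⟩)⟩)
    · exact Or.inr (Or.inl ⟨Sum.inl (i, 1), Sum.inl (i, 3), rfl, rfl, Or.inr ⟨i, rfl, rfl⟩⟩)
  · rintro x y ((h1 | ⟨j, rfl, rfl⟩) | ⟨i, rfl, rfl⟩)
    · exact Or.inl h1
    · exact Or.inr (Or.inl (Or.inr ⟨some j, rfl, rfl⟩))
    · exact Or.inr (Or.inr ⟨i, rfl, rfl⟩)

/-- Markers do not enter the Euler count `FPlanar`, so it suffices that faces and pieces correspond.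
-/
lemma fPlanar_iff (h : IsMark a b v m o p q) :
    FPlanar (fun i => mergeLabel a b ∘ v i) (fun j => mergeLabel a b ∘ m (some j)) ↔
      FPlanar v m := by
  obtain ⟨f, -⟩ := h.exists_faceEquiv
  obtain ⟨g, -⟩ := h.exists_pieceEquiv
  rw [FPlanar, FPlanar, Nat.card_congr f, Nat.card_congr g]

lemma fReduced (h : IsMark a b v m o p q) (hr : FReduced v m) :
    FReduced (fun i => mergeLabel a b ∘ v i) (fun j => mergeLabel a b ∘ m (some j)) := by
  obtain ⟨f, hf⟩ := h.exists_faceEquiv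
  intro i k hik
  have := congrArg f hik
  rw [hf, hf] at this
  exact hr i k this

lemma fAlternating (h : IsMark a b v m o p q) (ha : FAlternating v m) :
    FAlternating (fun i => mergeLabel a b ∘ v i) (fun j => mergeLabel a b ∘ m (some j)) := by
  obtain ⟨f, hf⟩ := h.exists_strandEquiv
  intro i i' k k' hne hik
  have := congrArg f hik
  rw [hf, hf] at this
  exact ha i i' k k' hne this

end IsMark

end

end Code

/-! ### Families describing a link diagram -/

namespace Code

open Finset CombMap

variable {I J : Type}

section multiset

variable {α β γ : Type}

lemma univ_val_map_equiv [Fintype α] [Fintype β] (e : α ≃ β) (f : β → γ) :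
    univ.val.map (f ∘ e) = univ.val.map f := by
  rw [← Multiset.map_map, Multiset.map_univ_val_equiv]

lemma univ_val_map_sum [Fintype α] [Fintype β] (f : α ⊕ β → γ) :
    univ.val.map f = univ.val.map (f ∘ Sum.inl) + univ.val.map (f ∘ Sum.inr) := by
  rw [← univ_disjSum_univ, Finset.val_disjSum, Multiset.disjSum, Multiset.map_add,
    Multiset.map_map, Multiset.map_map]

lemma univ_val_map_option [Fintype α] (f : Option α → γ) :
    univ.val.map f = f none ::ₘ univ.val.map (fun a => f (some a)) := by
  change Multiset.map f (none ::ₘ Multiset.map some univ.val) = _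
  rw [Multiset.map_cons, Multiset.map_map]
  rfl

lemma univ_val_map_subtype [Fintype α] (p : α → Prop) [DecidablePred p] (f : α → γ) :
    univ.val.map (fun x : {a // p a} => f x.1) + univ.val.map (fun x : {a // ¬ p a} => f x.1) =
      univ.val.map f := by
  rw [← univ_val_map_equiv (Equiv.sumCompl p), univ_val_map_sum]
  rfl

end multiset

/-- The crossings and the markers of the code, in any order, are the two families. -/
def IsFam [Fintype I] [Fintype J] (C : Code) (v : I → Fin 4 → ℕ) (m : J → Fin 2 → ℕ) : Prop :=
  (C.crossings : Multiset (Fin 4 → ℕ)) = univ.val.map v ∧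
    (C.markers : Multiset (Fin 2 → ℕ)) = univ.val.map m

variable {v : I → Fin 4 → ℕ} {m : J → Fin 2 → ℕ}

section

variable [Fintype I] [Fintype J] {C C' : Code}

lemma IsFam.presents (h : C.IsFam v m) : Nonempty (C.Presents v m) := exists_presents C h.1 h.2

lemma isFam_self (C : Code) : C.IsFam C.crossings.get C.markers.get := by
  constructor <;> rw [Fin.univ_val_map, List.ofFn_get]

lemma IsFam.closed (h : C.IsFam v m) {o : FDart I J → FDart I J} (ho : IsOpp (flabel v m) o) :
    C.IsClosed := by
  obtain ⟨P⟩ := h.presents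
  exact P.isClosed_iff.2 ⟨o, ho⟩

lemma IsFam.planar (h : C.IsFam v m) (hp : FPlanar v m) : C.IsPlanar := by
  obtain ⟨P⟩ := h.presents
  exact P.isPlanar_iff.2 hp

lemma IsFam.move (h : C.IsFam v m) (h' : C'.IsFam v m) : Move C C' :=
  Move.perm (Multiset.coe_eq_coe.1 (h.1.trans h'.1.symm))
    (Multiset.coe_eq_coe.1 (h.2.trans h'.2.symm))

end

namespace Presents

variable {C : Code}

/-- The faces of a code and of its families. -/
def face (P : C.Presents v m) : MapFace (flabel v m) fturn ≃ MapFace C.label C.turn :=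
  Quot.congr P.dart fun d e => by
    constructor
    · rintro ⟨d', h1, h2, rfl⟩
      exact ⟨P.dart d', by simpa using h1, by rw [P.label_dart, P.label_dart, h2],
        (P.turn_dart _).symm⟩
    · rintro ⟨d', h1, h2, h3⟩
      obtain ⟨x, rfl⟩ := P.dart.surjective d'
      rw [P.turn_dart] at h3
      exact ⟨x, by simpa using h1, by rw [← P.label_dart, h2, P.label_dart], P.dart.injective h3⟩

lemma strand_iff (P : C.Presents v m) (d e : FDart I J) :
    (flabel v m d = flabel v m e ∨ ∃ j, d = Sum.inr (j, 0) ∧ e = Sum.inr (j, 1)) ↔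
      (C.label (P.dart d) = C.label (P.dart e) ∨
        ∃ j, P.dart d = Sum.inr (j, 0) ∧ P.dart e = Sum.inr (j, 1)) := by
  rw [P.label_dart, P.label_dart]
  refine or_congr Iff.rfl ⟨?_, ?_⟩
  · rintro ⟨j, rfl, rfl⟩
    exact ⟨P.eJ j, rfl, rfl⟩
  · rintro ⟨j, h1, h2⟩
    obtain ⟨j, rfl⟩ := P.eJ.surjective j
    exact ⟨j, P.dart.injective h1, P.dart.injective h2⟩

end Presents

end Code

namespace LinkDiagram

open Code CombMap

variable {I J : Type} {v : I → Fin 4 → ℕ} {m : J → Fin 2 → ℕ} {D : LinkDiagram}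

/-- The arcs of a diagram and of its families. -/
def arcEquiv (P : D.toCode.Presents v m) : FArc v m ≃ D.Arc :=
  Quot.congr P.dart fun d e => or_congr (P.strand_iff d e) (by
    constructor
    · rintro ⟨i, rfl, rfl⟩
      exact ⟨P.eI i, rfl, rfl⟩
    · rintro ⟨i, h1, h2⟩
      obtain ⟨i, rfl⟩ := P.eI.surjective i
      exact ⟨i, P.dart.injective h1, P.dart.injective h2⟩)

/-- The strands of a diagram and of its families. -/
def strandEquiv (P : D.toCode.Presents v m) : FStrand v m ≃ Quot D.StrandStep :=
  Quot.congr P.dart P.strand_iff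

lemma isReduced_iff (P : D.toCode.Presents v m) : D.IsReduced ↔ FReduced v m := by
  have key : ∀ i k, Relation.EqvGen D.FaceStep (Sum.inl (P.eI i, k)) (Sum.inl (P.eI i, k + 2)) ↔
      (Quot.mk _ (Sum.inl (i, k)) : MapFace (flabel v m) fturn) =
        Quot.mk _ (Sum.inl (i, k + 2)) := by
    intro i k
    rw [← P.face.injective.eq_iff]
    exact ⟨fun h => Quot.eqvGen_sound h, fun h => Quot.eqvGen_exact h⟩
  constructor
  · intro h i k
    rw [Ne, ← key]
    exact h _ _
  · intro h c k
    obtain ⟨i, rfl⟩ := P.eI.surjective c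
    rw [key]
    exact h i k

lemma isAlternating_iff (P : D.toCode.Presents v m) : D.IsAlternating ↔ FAlternating v m := by
  have key : ∀ i i' k k', Relation.EqvGen D.StrandStep (Sum.inl (P.eI i, k)) (Sum.inl (P.eI i', k')) ↔
      (Quot.mk _ (Sum.inl (i, k)) : FStrand v m) = Quot.mk _ (Sum.inl (i', k')) := by
    intro i i' k k'
    rw [← (strandEquiv P).injective.eq_iff]
    exact ⟨fun h => Quot.eqvGen_sound h, fun h => Quot.eqvGen_exact h⟩
  constructor
  · intro h i i' k k' hne hq
    exact h (P.eI i) (P.eI i') k k' (by simpa using hne) ((key _ _ _ _).2 hq)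
  · intro h c c' k k' hne hq
    obtain ⟨i, rfl⟩ := P.eI.surjective c
    obtain ⟨i', rfl⟩ := P.eI.surjective c'
    exact h i i' k k' (by simpa using hne) ((key _ _ _ _).1 hq)

/-- A diagram of the same link with corresponding crossings and arcs. -/
structure Simplifies (D D₀ : LinkDiagram) : Prop where
  same : D.SameLink D₀
  reduced : D.IsReduced → D₀.IsReduced
  alternating : D.IsAlternating → D₀.IsAlternating
  arcs : ∃ (e : D.Crossing ≃ D₀.Crossing) (f : D.Arc ≃ D₀.Arc),
    ∀ c, f (D.overArc c) = D₀.overArc (e c) ∧ f (D.underArc c) = D₀.underArc (e c) ∧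
      f (D.underArc' c) = D₀.underArc' (e c)

lemma Simplifies.refl (D : LinkDiagram) : D.Simplifies D :=
  ⟨Relation.EqvGen.refl D, id, id, Equiv.refl _, Equiv.refl _, fun _ => ⟨rfl, rfl, rfl⟩⟩

lemma Simplifies.trans {D D₁ D₂ : LinkDiagram} (h : D.Simplifies D₁) (h' : D₁.Simplifies D₂) :
    D.Simplifies D₂ := by
  obtain ⟨e, f, hf⟩ := h.arcs
  obtain ⟨e', f', hf'⟩ := h'.arcs
  refine ⟨Relation.EqvGen.trans _ _ _ h.same h'.same, h'.reduced ∘ h.reduced,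
    h'.alternating ∘ h.alternating, e.trans e', f.trans f', fun c => ?_⟩
  simp only [Equiv.trans_apply, (hf c).1, (hf c).2.1, (hf c).2.2]
  exact hf' (e c)

lemma SameLink.of_move {D D' : LinkDiagram} (h : Move D.toCode D'.toCode) : D.SameLink D' :=
  Relation.EqvGen.rel _ _ h

/-- The marker is first moved to the front of the list and then deleted. The intermediate code also
has to be a link diagram, because moves connect link diagrams only. -/
lemma exists_simplifies_of_marker (D : LinkDiagram) {w : Fin 2 → ℕ} (hw : w ∈ D.markers)
    (hne : w 0 ≠ w 1) :
    ∃ D₀ : LinkDiagram, D.Simplifies D₀ ∧ D₀.markers.length < D.markers.length := by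
  obtain ⟨S, hS⟩ : ∃ S, D.markers.Perm (w :: S) := ⟨_, List.perm_cons_erase hw⟩
  have hw' : w = ![w 0, w 1] := by ext k; fin_cases k <;> rfl
  generalize w 0 = a at *
  generalize w 1 = b at *
  subst hw'
  let m : Option (Fin S.length) → Fin 2 → ℕ := fun j => j.elim ![a, b] S.get
  let v := D.crossings.get
  have hfam : ∀ L : List (Fin 2 → ℕ), L.Perm (![a, b] :: S) →
      IsFam ⟨D.crossings, L⟩ v m := by
    intro L hL
    refine ⟨(isFam_self D.toCode).1, ?_⟩
    rw [univ_val_map_option]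
    change (L : Multiset _) = ![a, b] ::ₘ Finset.univ.val.map S.get
    rw [Fin.univ_val_map, List.ofFn_get]
    exact Multiset.coe_eq_coe.2 hL
  have hD : D.toCode.IsFam v m := hfam _ hS
  obtain ⟨P⟩ := hD.presents
  obtain ⟨o, ho⟩ := P.isClosed_iff.1 D.closed
  obtain ⟨p, q, hM⟩ := exists_isMark ho hne rfl
  obtain ⟨o', ho', -⟩ := hM.exists_unmark_opp
  have hp := P.isPlanar_iff.1 D.planar
  have hD₁ := hfam _ (List.Perm.refl (![a, b] :: S))
  let D₁ : LinkDiagram := ⟨_, hD₁.closed ho, hD₁.planar hp⟩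
  have hD₀ : IsFam ⟨D.crossings.map (fun x => mergeLabel a b ∘ x), S.map (fun x => mergeLabel a b ∘ x)⟩
      (fun i => mergeLabel a b ∘ v i) (fun j => mergeLabel a b ∘ m (some j)) := by
    constructor
    · rw [← Multiset.map_coe, (isFam_self D.toCode).1, Multiset.map_map]
      rfl
    · rw [← Multiset.map_coe, (isFam_self ⟨[], S⟩).2, Multiset.map_map]
      rfl
  let D₀ : LinkDiagram := ⟨_, hD₀.closed ho', hD₀.planar (hM.fPlanar_iff.2 hp)⟩
  obtain ⟨P₀⟩ : Nonempty (D₀.toCode.Presents _ _) := hD₀.presents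
  obtain ⟨f, hf⟩ := hM.exists_arcEquiv
  refine ⟨D₀, ⟨?_, ?_, ?_, P.eI.symm.trans P₀.eI,
    (arcEquiv P).symm.trans (f.symm.trans (arcEquiv P₀)), ?_⟩, ?_⟩
  · refine Relation.EqvGen.trans _ D₁ _ (SameLink.of_move (hD.move hD₁)) (SameLink.of_move ?_)
    exact Move.unmark a b hne _ _
  · rw [isReduced_iff P, isReduced_iff P₀]
    exact hM.fReduced
  · rw [isAlternating_iff P, isAlternating_iff P₀]
    exact hM.fAlternating
  · have key : ∀ (i : Fin D.crossings.length) (k : Fin 4),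
        ((arcEquiv P).symm.trans (f.symm.trans (arcEquiv P₀))) (D.arcOf (Sum.inl (P.eI i, k))) =
          D₀.arcOf (Sum.inl (P₀.eI i, k)) := by
      intro i k
      rw [Equiv.trans_apply, show (arcEquiv P).symm (D.arcOf (Sum.inl (P.eI i, k))) =
        Quot.mk _ (Sum.inl (i, k)) from (Equiv.symm_apply_eq _).2 rfl, Equiv.trans_apply,
        show f.symm (Quot.mk _ (Sum.inl (i, k))) = Quot.mk _ (Sum.inl (i, k)) from
          (Equiv.symm_apply_eq _).2 (hf (Sum.inl (i, k))).symm]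
      rfl
    intro c
    obtain ⟨i, rfl⟩ := P.eI.surjective c
    rw [show (P.eI.symm.trans P₀.eI) (P.eI i) = P₀.eI i by simp]
    exact ⟨key i 1, key i 0, key i 2⟩
  · rw [hS.length_eq]
    simp [D₀]

/-- All markers between different edges can be deleted. -/
lemma exists_simplifies (D : LinkDiagram) :
    ∃ D₀ : LinkDiagram, D.Simplifies D₀ ∧ ∀ w ∈ D₀.markers, w 0 = w 1 := by
  induction hn : D.markers.length using Nat.strong_induction_on generalizing D with
  | _ n ih =>
    by_cases h : ∀ w ∈ D.markers, w 0 = w 1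
    · exact ⟨D, Simplifies.refl D, h⟩
    · push Not at h
      obtain ⟨w, hw, hne⟩ := h
      obtain ⟨D₁, h1, hlt⟩ := exists_simplifies_of_marker D hw hne
      obtain ⟨D₀, h0, hm⟩ := ih _ (hn ▸ hlt) D₁ rfl
      exact ⟨D₀, h1.trans h0, hm⟩

end LinkDiagram

/-! ### Split diagrams -/

namespace Code

open Finset CombMap

variable {I J : Type} {v : I → Fin 4 → ℕ} {m : J → Fin 2 → ℕ}

section sub

variable {I' J' : Type} {α : I' → I} {β : J' → J}

/-- The ends at subfamilies of crossings and markers. -/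
def femb (α : I' → I) (β : J' → J) : FDart I' J' → FDart I J :=
  Sum.map (Prod.map α id) (Prod.map β id)

lemma femb_injective (hα : Function.Injective α) (hβ : Function.Injective β) :
    Function.Injective (femb α β) :=
  Function.Injective.sumMap (hα.prodMap Function.injective_id) (hβ.prodMap Function.injective_id)

lemma flabel_femb (d : FDart I' J') :
    flabel v m (femb α β d) = flabel (fun i => v (α i)) (fun j => m (β j)) d := by
  rcases d with d | d <;> rfl

lemma fturn_femb (d : FDart I' J') : fturn (femb α β d) = femb α β (fturn d) := by
  rcases d with d | d <;> rfl

lemma exists_isOpp_restrict {o : FDart I J → FDart I J} (ho : IsOpp (flabel v m) o)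
    (hα : Function.Injective α) (hβ : Function.Injective β)
    (hc : ∀ x, ∃ y, o (femb α β x) = femb α β y) :
    ∃ o', IsOpp (flabel (fun i => v (α i)) (fun j => m (β j))) o' ∧
      ∀ x, o (femb α β x) = femb α β (o' x) := by
  choose o' ho' using hc
  refine ⟨o', ⟨fun d hd => ?_, fun d e => ?_⟩, ho'⟩
  · have := ho' d
    rw [hd] at this
    exact ho.ne _ this
  · rw [← flabel_femb (α := α) (β := β) (v := v) (m := m) d,
      ← flabel_femb (α := α) (β := β) (v := v) (m := m) e, ho.iff, ho', (femb_injective hα hβ).eq_iff,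
      (femb_injective hα hβ).eq_iff]

/-- The face of a submap in the whole map. -/
def faceMap {o : FDart I J → FDart I J} (ho : IsOpp (flabel v m) o) {o' : FDart I' J' → FDart I' J'}
    (ho' : IsOpp (flabel (fun i => v (α i)) (fun j => m (β j))) o')
    (h : ∀ x, o (femb α β x) = femb α β (o' x)) :
    MapFace (flabel (fun i => v (α i)) (fun j => m (β j))) fturn → MapFace (flabel v m) fturn :=
  Quot.lift (fun x => Quot.mk _ (femb α β x)) fun x y hxy => by
    rw [ho'.faceStep_iff] at hxy
    rw [hxy, ← fturn_femb, ← h, ho.face_eq]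

end sub

/-- A representative end of a crossing or marker. -/
def rep : I ⊕ J → FDart I J := Sum.map (fun i => (i, 0)) (fun j => (j, 0))

lemma piece_rep (d : FDart I J) :
    (Quot.mk _ (rep (fvert d)) : MapPiece (flabel v m) fturn) = Quot.mk _ d := by
  have ht : ∀ e : FDart I J, (Quot.mk _ (fturn e) : MapPiece (flabel v m) fturn) = Quot.mk _ e :=
    piece_turn
  rcases d with ⟨i, k⟩ | ⟨j, k⟩
  · have h1 := ht (Sum.inl (i, 0))
    have h2 := ht (Sum.inl (i, 1))
    have h3 := ht (Sum.inl (i, 2))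
    fin_cases k
    · rfl
    · exact h1.symm
    · exact h1.symm.trans h2.symm
    · exact h1.symm.trans (h2.symm.trans h3.symm)
  · fin_cases k
    · rfl
    · exact (ht (Sum.inr (j, 0))).symm

/-- Both parts of a planar map without edges between them are planar. -/
lemma fPlanar_split [Finite I] [Finite J] {o : FDart I J → FDart I J} (ho : IsOpp (flabel v m) o)
    (hp : FPlanar v m) (X : I ⊕ J → Prop) (hX : ∀ d, X (fvert (o d)) ↔ X (fvert d)) :
    ((∃ o', IsOpp (flabel (fun i : {i // X (Sum.inl i)} => v i.1)
        (fun j : {j // X (Sum.inr j)} => m j.1)) o') ∧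
      FPlanar (fun i : {i // X (Sum.inl i)} => v i.1) (fun j : {j // X (Sum.inr j)} => m j.1)) ∧
    ((∃ o', IsOpp (flabel (fun i : {i // ¬ X (Sum.inl i)} => v i.1)
        (fun j : {j // ¬ X (Sum.inr j)} => m j.1)) o') ∧
      FPlanar (fun i : {i // ¬ X (Sum.inl i)} => v i.1)
        (fun j : {j // ¬ X (Sum.inr j)} => m j.1)) := by
  classical
  let f₁ : FDart {i // X (Sum.inl i)} {j // X (Sum.inr j)} → FDart I J :=
    femb Subtype.val Subtype.val
  let f₂ : FDart {i // ¬ X (Sum.inl i)} {j // ¬ X (Sum.inr j)} → FDart I J :=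
    femb Subtype.val Subtype.val
  have hf₁ : Function.Injective f₁ := femb_injective Subtype.val_injective Subtype.val_injective
  have hf₂ : Function.Injective f₂ := femb_injective Subtype.val_injective Subtype.val_injective
  have r₁ : ∀ d, X (fvert d) ↔ ∃ x, d = f₁ x := by
    rintro (⟨i, k⟩ | ⟨j, k⟩)
    · constructor
      · exact fun h => ⟨Sum.inl (⟨i, h⟩, k), rfl⟩
      · rintro ⟨⟨⟨i, hi⟩, k⟩ | x, hx⟩ <;> simp [f₁, femb] at hx
        rw [hx.1]; exact hi
    · constructor
      · exact fun h => ⟨Sum.inr (⟨j, h⟩, k), rfl⟩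
      · rintro ⟨x | ⟨⟨j, hj⟩, k⟩, hx⟩ <;> simp [f₁, femb] at hx
        rw [hx.1]; exact hj
  have r₂ : ∀ d, ¬ X (fvert d) ↔ ∃ x, d = f₂ x := by
    rintro (⟨i, k⟩ | ⟨j, k⟩)
    · constructor
      · exact fun h => ⟨Sum.inl (⟨i, h⟩, k), rfl⟩
      · rintro ⟨⟨⟨i, hi⟩, k⟩ | x, hx⟩ <;> simp [f₂, femb] at hx
        rw [hx.1]; exact hi
    · constructor
      · exact fun h => ⟨Sum.inr (⟨j, h⟩, k), rfl⟩
      · rintro ⟨x | ⟨⟨j, hj⟩, k⟩, hx⟩ <;> simp [f₂, femb] at hx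
        rw [hx.1]; exact hj
  obtain ⟨o₁, ho₁, h₁⟩ := exists_isOpp_restrict ho Subtype.val_injective Subtype.val_injective
    (fun x => (r₁ _).1 ((hX _).2 ((r₁ _).2 ⟨x, rfl⟩)))
  obtain ⟨o₂, ho₂, h₂⟩ := exists_isOpp_restrict ho Subtype.val_injective Subtype.val_injective
    (fun x => (r₂ _).1 ((not_congr (hX _)).2 ((r₂ _).2 ⟨x, rfl⟩)))
  -- A squeeze: each part satisfies Euler's inequality, the faces of the parts cover those of the
  -- whole, the pieces of the whole map onto those of the parts, and the whole attains equality. So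
  -- both parts attain it.
  have c₁ := card_face_le ho₁
  have c₂ := card_face_le ho₂
  have cF : Nat.card (MapFace (flabel v m) fturn) ≤ _ :=
    Nat.card_le_card_of_surjective (Sum.elim (faceMap ho ho₁ h₁) (faceMap ho ho₂ h₂)) (by
      rintro ⟨d⟩
      by_cases h : X (fvert d)
      · obtain ⟨x, rfl⟩ := (r₁ d).1 h
        exact ⟨Sum.inl (Quot.mk _ x), rfl⟩
      · obtain ⟨x, rfl⟩ := (r₂ d).1 h
        exact ⟨Sum.inr (Quot.mk _ x), rfl⟩)
  let P₁ := MapPiece (flabel (fun i : {i // X (Sum.inl i)} => v i.1)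
    (fun j : {j // X (Sum.inr j)} => m j.1)) fturn
  let P₂ := MapPiece (flabel (fun i : {i // ¬ X (Sum.inl i)} => v i.1)
    (fun j : {j // ¬ X (Sum.inr j)} => m j.1)) fturn
  let g : FDart I J → P₁ ⊕ P₂ := fun d =>
    if h : X (fvert d) then Sum.inl (Quot.mk _ ((r₁ d).1 h).choose)
    else Sum.inr (Quot.mk _ ((r₂ d).1 h).choose)
  have g₁ : ∀ x, g (f₁ x) = Sum.inl (Quot.mk _ x) := by
    intro x
    have h : X (fvert (f₁ x)) := (r₁ _).2 ⟨x, rfl⟩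
    have h2 := ((r₁ _).1 h).choose_spec
    simp only [g, dif_pos h]
    rw [← hf₁ h2]
  have g₂ : ∀ x, g (f₂ x) = Sum.inr (Quot.mk _ x) := by
    intro x
    have h : ¬ X (fvert (f₂ x)) := (r₂ _).2 ⟨x, rfl⟩
    have h2 := ((r₂ _).1 h).choose_spec
    simp only [g, dif_neg h]
    rw [← hf₂ h2]
  have cP : Nat.card (P₁ ⊕ P₂) ≤ Nat.card (MapPiece (flabel v m) fturn) := by
    refine Nat.card_le_card_of_surjective (Quot.lift g ?_) ?_
    · rintro d e hde
      by_cases h : X (fvert d)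
      · obtain ⟨x, rfl⟩ := (r₁ d).1 h
        rcases hde with hde | rfl
        · rcases (ho.iff _ _).1 hde.symm with rfl | rfl
          · rfl
          · change _ = g (o (femb _ _ x))
            rw [h₁, g₁]
            change _ = g (f₁ _)
            rw [g₁, ho₁.piece_opp]
        · change _ = g (fturn (femb _ _ x))
          rw [fturn_femb, g₁]
          change _ = g (f₁ _)
          rw [g₁, piece_turn]
      · obtain ⟨x, rfl⟩ := (r₂ d).1 h
        rcases hde with hde | rfl
        · rcases (ho.iff _ _).1 hde.symm with rfl | rfl
          · rfl
          · change _ = g (o (femb _ _ x))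
            rw [h₂, g₂]
            change _ = g (f₂ _)
            rw [g₂, ho₂.piece_opp]
        · change _ = g (fturn (femb _ _ x))
          rw [fturn_femb, g₂]
          change _ = g (f₂ _)
          rw [g₂, piece_turn]
    · rintro (⟨⟨x⟩⟩ | ⟨⟨x⟩⟩)
      · exact ⟨Quot.mk _ (f₁ x), g₁ x⟩
      · exact ⟨Quot.mk _ (f₂ x), g₂ x⟩
  rw [Nat.card_sum] at cF cP
  have cI : Nat.card I = Nat.card {i // X (Sum.inl i)} + Nat.card {i // ¬ X (Sum.inl i)} := by
    rw [← Nat.card_sum]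
    exact Nat.card_congr (Equiv.sumCompl _).symm
  rw [FPlanar] at hp
  simp only [FPlanar]
  change _ ≤ _ + 2 * Nat.card P₁ at c₁
  change _ ≤ _ + 2 * Nat.card P₂ at c₂
  exact ⟨⟨⟨o₁, ho₁⟩, by change _ = _ + 2 * Nat.card P₁; omega⟩,
    ⟨⟨o₂, ho₂⟩, by change _ = _ + 2 * Nat.card P₂; omega⟩⟩

/-- The code with given crossings and markers. -/
noncomputable def ofFam [Fintype I] [Fintype J] (v : I → Fin 4 → ℕ) (m : J → Fin 2 → ℕ) : Code :=
  ⟨(univ : Finset I).toList.map v, (univ : Finset J).toList.map m⟩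

lemma isFam_ofFam [Fintype I] [Fintype J] (v : I → Fin 4 → ℕ) (m : J → Fin 2 → ℕ) :
    (ofFam v m).IsFam v m := by
  constructor <;> simp only [ofFam] <;> rw [← Multiset.map_coe, Finset.coe_toList]

end Code

/-! ### Disconnected diagrams and closed curves without crossings -/

namespace LinkDiagram

open Code CombMap Finset

/-- A diagram that is not connected represents a split link. -/
lemma isSplit_of_pieces {D : LinkDiagram} (h : ¬ Subsingleton (MapPiece D.label D.turn)) :
    D.IsSplit := by
  classical
  have hD := isFam_self D.toCode
  obtain ⟨P⟩ := hD.presents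
  obtain ⟨o, ho⟩ := P.isClosed_iff.1 D.closed
  have hp := P.isPlanar_iff.1 D.planar
  have h' : ∃ d e : FDart (Fin D.crossings.length) (Fin D.markers.length),
      (Quot.mk _ d : MapPiece (flabel D.crossings.get D.markers.get) fturn) ≠ Quot.mk _ e := by
    by_contra! hall
    refine h ⟨?_⟩
    rintro ⟨d⟩ ⟨e⟩
    obtain ⟨d, rfl⟩ := P.dart.surjective d
    obtain ⟨e, rfl⟩ := P.dart.surjective e
    have := Quot.eqvGen_exact (hall d e)
    clear hall
    induction this with
    | rel x y hxy =>
      refine Quot.sound ?_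
      rw [P.label_dart, P.label_dart, P.turn_dart, P.dart.injective.eq_iff]
      exact hxy
    | refl => rfl
    | symm _ _ _ ih => exact ih.symm
    | trans _ _ _ _ _ ih ih' => exact ih.trans ih'
  obtain ⟨d, e, hde⟩ := h'
  -- The crossings and markers in the piece of `d`; no edge leaves this set.
  let X : Fin D.crossings.length ⊕ Fin D.markers.length → Prop := fun w =>
    (Quot.mk _ (rep w) : MapPiece (flabel D.crossings.get D.markers.get) fturn) = Quot.mk _ d
  have hXv : ∀ x, X (fvert x) ↔
      (Quot.mk _ x : MapPiece (flabel D.crossings.get D.markers.get) fturn) = Quot.mk _ d := by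
    intro x
    simp only [X, piece_rep]
  have hX : ∀ x, X (fvert (o x)) ↔ X (fvert x) := by
    intro x
    rw [hXv, hXv, ho.piece_opp]
  obtain ⟨⟨⟨o₁, ho₁⟩, hp₁⟩, ⟨o₂, ho₂⟩, hp₂⟩ := fPlanar_split ho hp X hX
  have hd : X (fvert d) := (hXv d).2 rfl
  have he : ¬ X (fvert e) := fun hh => hde ((hXv e).1 hh).symm
  let C₁ := ofFam (fun i : {i // X (Sum.inl i)} => D.crossings.get i.1)
    (fun j : {j // X (Sum.inr j)} => D.markers.get j.1)
  let C₂ := ofFam (fun i : {i // ¬ X (Sum.inl i)} => D.crossings.get i.1)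
    (fun j : {j // ¬ X (Sum.inr j)} => D.markers.get j.1)
  have hC₁ := isFam_ofFam (fun i : {i // X (Sum.inl i)} => D.crossings.get i.1)
    (fun j : {j // X (Sum.inr j)} => D.markers.get j.1)
  have hC₂ := isFam_ofFam (fun i : {i // ¬ X (Sum.inl i)} => D.crossings.get i.1)
    (fun j : {j // ¬ X (Sum.inr j)} => D.markers.get j.1)
  have hC : IsFam ⟨C₁.crossings ++ C₂.crossings, C₁.markers ++ C₂.markers⟩
      D.crossings.get D.markers.get := by
    constructor
    · rw [← Multiset.coe_add, hC₁.1, hC₂.1]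
      exact univ_val_map_subtype (fun i => X (Sum.inl i)) D.crossings.get
    · rw [← Multiset.coe_add, hC₁.2, hC₂.2]
      exact univ_val_map_subtype (fun j => X (Sum.inr j)) D.markers.get
  obtain ⟨P₁⟩ := hC₁.presents
  obtain ⟨P₂⟩ := hC₂.presents
  refine ⟨⟨_, hC.closed ho, hC.planar hp⟩, ⟨C₁, hC₁.closed ho₁, hC₁.planar hp₁⟩,
    ⟨C₂, hC₂.closed ho₂, hC₂.planar hp₂⟩, SameLink.of_move (hD.move hC), ?_, ?_, rfl, rfl⟩
  · rcases d with ⟨i, k⟩ | ⟨j, k⟩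
    · exact ⟨P₁.dart (Sum.inl (⟨i, hd⟩, k))⟩
    · exact ⟨P₁.dart (Sum.inr (⟨j, hd⟩, k))⟩
  · rcases e with ⟨i, k⟩ | ⟨j, k⟩
    · exact ⟨P₂.dart (Sum.inl (⟨i, he⟩, k))⟩
    · exact ⟨P₂.dart (Sum.inr (⟨j, he⟩, k))⟩

/-- A connected diagram that contains a closed curve with one marker is a circle. -/
lemma isUnknot_of_marker {D : LinkDiagram} (h : Subsingleton (MapPiece D.label D.turn))
    {w : Fin 2 → ℕ} (hw : w ∈ D.markers) (hw' : w 0 = w 1) : D.IsUnknot := by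
  obtain ⟨j, rfl⟩ := List.mem_iff_get.1 hw
  obtain ⟨o, ho⟩ := exists_isOpp (lab := D.label) D.closed
  have hoj : o (Sum.inr (j, 0)) = Sum.inr (j, 1) :=
    ((ho.other_iff (Sum.inr (j, 0)) (Sum.inr (j, 1))).1 ⟨by simp, hw'.symm⟩).symm
  have hoj' : o (Sum.inr (j, 1)) = Sum.inr (j, 0) := by rw [← hoj, ho.opp_opp]
  -- The two ends of the marker are joined to each other, so they form a whole connected piece and
  -- hence the entire diagram.
  let χ : D.Dart → Prop := fun d => d = Sum.inr (j, 0) ∨ d = Sum.inr (j, 1)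
  have hlab : ∀ d e, D.label d = D.label e → χ d → χ e := by
    intro d e hde hd
    rcases (ho.iff _ _).1 hde.symm with rfl | rfl
    · exact hd
    · rcases hd with rfl | rfl
      · rw [hoj]; exact Or.inr rfl
      · rw [hoj']; exact Or.inl rfl
  have hturn : ∀ d, χ (D.turn d) ↔ χ d := by
    rintro (⟨i, k⟩ | ⟨l, k⟩)
    · simp [χ, Code.turn]
    · simp only [χ, Code.turn, Sum.inr.injEq, Prod.mk.injEq]
      fin_cases k <;> simp [or_comm]
  have hall : ∀ d, χ d := by
    let L : MapPiece D.label D.turn → Prop := Quot.lift χ (by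
      rintro d e (h1 | rfl)
      · exact propext ⟨hlab d e h1, hlab e d h1.symm⟩
      · exact propext (hturn d).symm)
    intro d
    have h1 : L (Quot.mk _ (Sum.inr (j, 0))) := Or.inl rfl
    rw [Subsingleton.elim (Quot.mk _ (Sum.inr (j, 0))) (Quot.mk _ d : MapPiece D.label D.turn)] at h1
    exact h1
  have hcr : D.crossings = [] := by
    by_contra hne
    have hlt := List.length_pos_iff.2 hne
    rcases hall (Sum.inl (⟨0, hlt⟩, 0)) with h1 | h1 <;> simp at h1
  have hmk : ∀ l : Fin D.markers.length, l = j := by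
    intro l
    rcases hall (Sum.inr (l, 0)) with h1 | h1 <;> simp at h1
    exact h1
  have hlen : D.markers.length = 1 := by
    have hj := j.2
    by_contra hne
    have h0 := hmk ⟨0, by omega⟩
    have h1 := hmk ⟨1, by omega⟩
    have := congrArg Fin.val (h0.trans h1.symm)
    simp at this
  obtain ⟨u, hu⟩ := List.length_eq_one_iff.1 hlen
  have huw : D.markers.get j = u := by
    have hmem := List.get_mem D.markers j
    generalize D.markers.get j = x at hmem
    rw [hu] at hmem
    exact List.mem_singleton.1 hmem
  rw [huw] at hw'
  have hcode : D.toCode = ⟨[], [u]⟩ := by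
    cases hD : D.toCode
    rw [hD] at hcr hu
    simp only at hcr hu
    rw [hcr, hu]
  refine SameLink.of_move ?_
  rw [hcode]
  have := Move.relabel (Equiv.swap (u 0) 0) [] [u]
  have hu0 : (Equiv.swap (u 0) 0 : ℕ → ℕ) ∘ u = ![0, 0] := by
    ext k
    fin_cases k
    · simp
    · simp [← hw']
  simp only [List.map_cons, List.map_nil, hu0] at this
  exact this

/-- A diagram of a prime link is equivalent to a connected diagram without markers. -/
lemma RepresentsPrimeLink.exists_simplifies {D : LinkDiagram} (h : D.RepresentsPrimeLink) :
    ∃ D₀ : LinkDiagram, D.Simplifies D₀ ∧ D₀.markers = [] ∧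
      Subsingleton (MapPiece D₀.label D₀.turn) := by
  obtain ⟨D₀, hs, hm⟩ := LinkDiagram.exists_simplifies D
  have hsub : Subsingleton (MapPiece D₀.label D₀.turn) := by
    by_contra hns
    obtain ⟨D', D₁, D₂, h1, h2⟩ := isSplit_of_pieces hns
    exact h.2.2.1 ⟨D', D₁, D₂, Relation.EqvGen.trans _ _ _ hs.same h1, h2⟩
  refine ⟨D₀, hs, ?_, hsub⟩
  by_contra hne
  obtain ⟨w, hw⟩ := List.exists_mem_of_ne_nil _ hne
  exact h.2.1 (Relation.EqvGen.trans _ _ _ hs.same (isUnknot_of_marker hsub hw (hm w hw)))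

end LinkDiagram

/-! ### The overpass graph of an alternating diagram -/

namespace FourValent

open Finset TwoOut

variable {I : Type}

/-- The ends `0` and `2`, those of the under-strands. -/
def under (p : I × Fin 2) : I × Fin 4 := (p.1, if p.2 = 0 then 0 else 2)

lemma under_injective : Function.Injective (under : I × Fin 2 → I × Fin 4) := by
  rintro ⟨i, k⟩ ⟨j, l⟩ h
  simp only [under, Prod.mk.injEq] at h
  obtain ⟨rfl, h⟩ := h
  fin_cases k <;> fin_cases l <;> simp_all

lemma even_under (p : I × Fin 2) : Even (under p).2.val := by
  obtain ⟨i, k⟩ := p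
  fin_cases k <;> simp [under]

/-- Each under-arc points to the crossing where it passes over, if `o` joins the ends of the
edges. -/
def arrows (o : I × Fin 4 → I × Fin 4) (i : I) (k : Fin 2) : I := (o (under (i, k))).1

/-- The crossing at which the strand through an end passes over. -/
def overpass (o : I × Fin 4 → I × Fin 4) (a : I × Fin 4) : I := if Even a.2.val then (o a).1 else a.1

/-- An involution joins over-ends with under-ends. -/
structure IsAlt (o : I × Fin 4 → I × Fin 4) : Prop where
  invol : Function.Involutive o
  alt : ∀ a, Even (o a).2.val ↔ ¬ Even a.2.val

namespace IsAlt

variable {o : I × Fin 4 → I × Fin 4}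

lemma overpass_opp (h : IsAlt o) (a : I × Fin 4) : overpass o (o a) = overpass o a := by
  by_cases ha : Even a.2.val
  · have : ¬ Even (o a).2.val := fun h' => (h.alt a).1 h' ha
    rw [overpass, overpass, if_neg this, if_pos ha]
  · rw [overpass, overpass, if_pos ((h.alt a).2 ha), if_neg ha, h.invol]

variable [Fintype I]

lemma sum_under (F : I × Fin 4 → ℤ) :
    ∑ p, F (under p) = ∑ a, if Even a.2.val then F a else 0 := by
  rw [Fintype.sum_prod_type, Fintype.sum_prod_type]
  refine sum_congr rfl fun i _ => ?_
  rw [Fin.sum_univ_two, Fin.sum_univ_four]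
  simp [under, show ¬ Even 3 by decide]

lemma sum_opp (h : IsAlt o) (F : I × Fin 4 → ℤ) : ∑ a, F (o a) = ∑ a, F a :=
  Fintype.sum_bijective o h.invol.bijective _ _ fun _ => rfl

variable [DecidableEq I]

/-- Arrows correspond to under-ends, and `o` exchanges these with the over-ends, of which each
crossing has two. -/
lemma twoIn (h : IsAlt o) : TwoIn (arrows o) := by
  intro j
  rw [show ∑ p : I × Fin 2, (if arrows o p.1 p.2 = j then 1 else 0 : ℤ) = _ from
    sum_under fun a => if (o a).1 = j then 1 else 0]
  rw [← h.sum_opp]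
  simp only [h.invol _, h.alt]
  rw [Fintype.sum_prod_type, sum_eq_single j]
  · rw [Fin.sum_univ_four]
    simp [show ¬ Even 3 by decide]
  · intro i _ hi
    simp [hi]
  · simp

lemma cut_eq (T : Finset I) : cut (arrows o) T =
    ∑ a : I × Fin 4, if Even a.2.val ∧ a.1 ∈ T ∧ (o a).1 ∉ T then 1 else 0 := by
  rw [show cut (arrows o) T = _ from
    sum_under fun a => if a.1 ∈ T ∧ (o a).1 ∉ T then 1 else 0]
  exact sum_congr rfl fun a _ => by simp only [ite_and]

/-- By balance the entering arrows may be counted instead, seen from their over-ends in `T`. So the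
edges that leave `T` at under-ends and at over-ends are equally many. -/
lemma cut_eq' (h : IsAlt o) (T : Finset I) : cut (arrows o) T =
    ∑ a : I × Fin 4, if ¬ Even a.2.val ∧ a.1 ∈ T ∧ (o a).1 ∉ T then 1 else 0 := by
  rw [cut_eq_in h.twoIn, show ∑ p : I × Fin 2,
    (if p.1 ∉ T ∧ arrows o p.1 p.2 ∈ T then 1 else 0 : ℤ) = _ from
    sum_under fun a => if a.1 ∉ T ∧ (o a).1 ∈ T then 1 else 0, ← h.sum_opp]
  refine sum_congr rfl fun a _ => ?_
  simp only [h.invol _, h.alt, ← ite_and]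
  exact if_congr (by tauto) rfl rfl

lemma mem_iff_of_cut (h : IsAlt o) {T : Finset I} (hT : ¬ 1 ≤ cut (arrows o) T) (a : I × Fin 4) :
    (o a).1 ∈ T ↔ a.1 ∈ T := by
  have h0 : cut (arrows o) T = 0 := by have := cut_nonneg (s := arrows o) T; omega
  have h1 := h0
  rw [cut_eq, sum_eq_zero_iff_of_nonneg (fun a _ => by split_ifs <;> simp)] at h0
  rw [h.cut_eq', sum_eq_zero_iff_of_nonneg (fun a _ => by split_ifs <;> simp)] at h1
  have key : ∀ a : I × Fin 4, a.1 ∈ T → (o a).1 ∈ T := by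
    intro a ha
    have h2 := h0 a (mem_univ _)
    have h3 := h1 a (mem_univ _)
    simp only [ite_eq_right_iff, one_ne_zero, imp_false] at h2 h3
    tauto
  refine ⟨fun ha => ?_, key a⟩
  have := key _ ha
  rwa [h.invol] at this

lemma exists_unique_of_sum {α : Type} [Fintype α] {P : α → Prop} [DecidablePred P]
    (h : ∑ a, (if P a then 1 else 0 : ℤ) = 1) : ∃ a, P a ∧ ∀ b, P b → b = a := by
  rw [sum_boole] at h
  obtain ⟨a, ha⟩ := card_eq_one.1 (by exact_mod_cast h)
  have hm : ∀ b, P b ↔ b = a := fun b => by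
    have := Finset.ext_iff.1 ha b
    simpa using this
  exact ⟨a, (hm a).2 rfl, fun b hb => (hm b).1 hb⟩

end IsAlt

/-- Exactly two edges connect the crossings in `X` with the others. -/
structure TwoCut (o : I × Fin 4 → I × Fin 4) (X : I → Prop) (p q : I × Fin 4) : Prop where
  alt : Even q.2.val ↔ ¬ Even p.2.val
  left : X p.1
  right : X q.1
  left' : ¬ X (o p).1
  right' : ¬ X (o q).1
  eq : ∀ a : I × Fin 4, X a.1 → ¬ X (o a).1 → a = p ∨ a = q

/-- One edge leaves `T` at an under-end, counted by `cut_eq`, and one at an over-end, counted by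
`cut_eq'`. -/
lemma IsAlt.exists_twoCut [Fintype I] [DecidableEq I] {o : I × Fin 4 → I × Fin 4} (h : IsAlt o)
    {T : Finset I} (hT : cut (arrows o) T = 1) : ∃ p q, TwoCut o (· ∈ T) p q := by
  obtain ⟨p, ⟨hp1, hp2, hp3⟩, hp⟩ := exists_unique_of_sum ((cut_eq T).symm.trans hT)
  obtain ⟨q, ⟨hq1, hq2, hq3⟩, hq⟩ := exists_unique_of_sum ((h.cut_eq' T).symm.trans hT)
  refine ⟨p, q, by tauto, hp2, hq2, hp3, hq3, fun a ha ha' => ?_⟩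
  by_cases he : Even a.2.val
  · exact Or.inl (hp a ⟨he, ha, ha'⟩)
  · exact Or.inr (hq a ⟨he, ha, ha'⟩)

namespace TwoCut

variable {o : I × Fin 4 → I × Fin 4} {X : I → Prop} {p q : I × Fin 4}

lemma ne (h : TwoCut o X p q) : p ≠ q := by
  rintro rfl
  have := h.alt
  tauto

lemma symm (h : TwoCut o X p q) : TwoCut o X q p :=
  ⟨by have := h.alt; tauto, h.right, h.left, h.right', h.left', fun a h1 h2 => (h.eq a h1 h2).symm⟩

lemma compl (h : TwoCut o X p q) (ho : IsAlt o) : TwoCut o (fun i => ¬ X i) (o p) (o q) := by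
  refine ⟨by have := h.alt; rw [ho.alt, ho.alt]; tauto, h.left', h.right', ?_, ?_, ?_⟩
  · rw [ho.invol]; exact not_not.2 h.left
  · rw [ho.invol]; exact not_not.2 h.right
  · intro a h1 h2
    rcases h.eq (o a) (not_not.1 h2) (by rwa [ho.invol]) with h3 | h3
    · left; rw [← h3, ho.invol]
    · right; rw [← h3, ho.invol]

/-- The two strands that leave `X` can be joined inside `X`. -/
lemma exists_cap (h : TwoCut o X p q) (ho : IsAlt o) :
    ∃ o' : {i // X i} × Fin 4 → {i // X i} × Fin 4, IsAlt o' ∧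
      o' (⟨p.1, h.left⟩, p.2) = (⟨q.1, h.right⟩, q.2) ∧
      ∀ a, (a.1.1, a.2) ≠ p → (a.1.1, a.2) ≠ q → ((o' a).1.1, (o' a).2) = o (a.1.1, a.2) := by
  classical
  -- The two edges are cut and `p` is joined to `q`. This still alternates because `p` and `q` have
  -- opposite parity.
  let u : I × Fin 4 → I × Fin 4 := fun a => if a = p then q else if a = q then p else o a
  have hup : u p = q := if_pos rfl
  have huq : u q = p := by simp [u, h.ne.symm]
  have hu : ∀ a, a ≠ p → a ≠ q → u a = o a := fun a h1 h2 => by simp [u, h1, h2]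
  have huX : ∀ a, X a.1 → X (u a).1 := by
    intro a ha
    by_cases h1 : a = p
    · rw [h1, hup]; exact h.right
    · by_cases h2 : a = q
      · rw [h2, huq]; exact h.left
      · rw [hu a h1 h2]
        by_contra h3
        exact (h.eq a ha h3).elim h1 h2
  have huu : ∀ a, X a.1 → u (u a) = a := by
    intro a ha
    by_cases h1 : a = p
    · rw [h1, hup, huq]
    · by_cases h2 : a = q
      · rw [h2, huq, hup]
      · rw [hu a h1 h2, hu, ho.invol]
        · intro h3
          exact h.left' (by rw [← h3, ho.invol]; exact ha)
        · intro h3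
          exact h.right' (by rw [← h3, ho.invol]; exact ha)
  have hualt : ∀ a, Even (u a).2.val ↔ ¬ Even a.2.val := by
    intro a
    by_cases h1 : a = p
    · rw [h1, hup]; exact h.alt
    · by_cases h2 : a = q
      · rw [h2, huq]; exact h.symm.alt
      · rw [hu a h1 h2]; exact ho.alt a
  let o' : {i // X i} × Fin 4 → {i // X i} × Fin 4 := fun a =>
    (⟨(u (a.1.1, a.2)).1, huX _ a.1.2⟩, (u (a.1.1, a.2)).2)
  refine ⟨o', ⟨fun a => ?_, fun a => hualt _⟩, ?_, fun a h1 h2 => hu _ h1 h2⟩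
  · have := huu (a.1.1, a.2) a.1.2
    refine Prod.ext (Subtype.ext ?_) ?_
    · exact congrArg Prod.fst this
    · have h2 := congrArg Prod.snd this
      exact h2
  · refine Prod.ext (Subtype.ext ?_) ?_
    · exact congrArg Prod.fst hup
    · have h2 := congrArg Prod.snd hup
      exact h2

end TwoCut

end FourValent

/-! ### Cutting an alternating map along two edges -/

namespace FourValent

open Finset TwoOut CombMap Code

variable {I : Type}

/-- A connected planar reduced alternating map without markers, with the involution `o` that
exchanges the ends of the edges. -/
structure AltMap (v : I → Fin 4 → ℕ) (o : I × Fin 4 → I × Fin 4) : Prop where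
  opp : IsOpp (flabel v (Empty.elim : Empty → Fin 2 → ℕ)) (Sum.map o id)
  alt : ∀ a, Even (o a).2.val ↔ ¬ Even a.2.val
  reduced : FReduced v (Empty.elim : Empty → Fin 2 → ℕ)
  conn : Subsingleton (MapPiece (flabel v (Empty.elim : Empty → Fin 2 → ℕ)) fturn)
  planar : FPlanar v (Empty.elim : Empty → Fin 2 → ℕ)

/-- The next end at the same crossing. -/
def rot (a : I × Fin 4) : I × Fin 4 := (a.1, a.2 + 1)

lemma rot_injective : Function.Injective (rot : I × Fin 4 → I × Fin 4) := by
  rintro ⟨i, k⟩ ⟨j, l⟩ h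
  simpa [rot] using h

lemma even_rot (a : I × Fin 4) : Even (rot a).2.val ↔ ¬ Even a.2.val := by
  obtain ⟨i, k⟩ := a
  simp only [rot]
  revert k
  decide

/-- The face at the corner of an end. -/
def face (v : I → Fin 4 → ℕ) (a : I × Fin 4) :
    MapFace (flabel v (Empty.elim : Empty → Fin 2 → ℕ)) fturn := Quot.mk _ (Sum.inl a)

lemma face_surjective (v : I → Fin 4 → ℕ) : Function.Surjective (face v) := by
  rintro ⟨a | ⟨⟨⟩, _⟩⟩
  exact ⟨a, rfl⟩

namespace AltMap

variable {v : I → Fin 4 → ℕ} {o : I × Fin 4 → I × Fin 4}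

lemma isAlt (h : AltMap v o) : IsAlt o := by
  refine ⟨fun a => ?_, h.alt⟩
  have := h.opp.opp_opp (Sum.inl a)
  simpa using this

lemma label_iff (h : AltMap v o) (a b : I × Fin 4) : v b.1 b.2 = v a.1 a.2 ↔ b = a ∨ b = o a := by
  have := h.opp.iff (Sum.inl a) (Sum.inl b)
  simpa [flabel] using this

lemma opp_ne (h : AltMap v o) (a : I × Fin 4) : o a ≠ a := fun h1 => h.opp.ne (Sum.inl a) (by simp [h1])

lemma face_rot_opp (h : AltMap v o) (a : I × Fin 4) : face v (rot (o a)) = face v a :=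
  h.opp.face_eq (turn := fturn) (Sum.inl a)

lemma face_rot (h : AltMap v o) (a : I × Fin 4) : face v (rot a) = face v (o a) := by
  rw [← h.face_rot_opp (o a), h.isAlt.invol]

/-- A step of the face walk passes along an edge and then turns. Each of the two reverses the
parity, so all corners of a face have the same parity. -/
lemma even_iff_of_face (h : AltMap v o) {a b : I × Fin 4} (hab : face v a = face v b) :
    Even a.2.val ↔ Even b.2.val := by
  let L : MapFace (flabel v (Empty.elim : Empty → Fin 2 → ℕ)) fturn → Prop :=
    Quot.lift (Sum.elim (fun a => Even a.2.val) fun b => b.1.elim) (by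
      rintro (a | ⟨⟨⟩, _⟩) e he
      rw [h.opp.faceStep_iff] at he
      subst he
      refine propext ?_
      have := even_rot (o a)
      rw [h.alt, not_not] at this
      exact this.symm)
  exact iff_of_eq (congrArg L hab)

/-- An edge from a crossing to itself would join ends of opposite parity, hence neighbours. The face
walk along the outside of this loop puts two opposite corners into one face, against reducedness. -/
lemma fst_opp_ne (h : AltMap v o) (a : I × Fin 4) : (o a).1 ≠ a.1 := by
  have key : ∀ i k, o (i, k) ≠ (i, k + 1) := by
    intro i k hik
    have h1 := h.face_rot_opp (i, k)
    rw [hik] at h1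
    refine h.reduced i k (h1.symm.trans ?_)
    rw [rot, add_assoc]
    rfl
  obtain ⟨i, k⟩ := a
  intro hi
  have h2 := h.alt (i, k)
  have h3 : o (i, k) = (i, (o (i, k)).2) := Prod.ext hi rfl
  generalize (o (i, k)).2 = l at *
  have h4 : l = k + 1 ∨ k = l + 1 := by
    simp only at h2
    clear h3 hi
    revert k l
    decide
  rcases h4 with rfl | rfl
  · exact key _ _ h3
  · refine key i l ?_
    rw [← h3, h.isAlt.invol]

lemma iff_of_invariant (h : AltMap v o) {W : I → Prop} (hW : ∀ a, W (o a).1 ↔ W a.1) (i j : I) : W i ↔ W j := by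
  let L : MapPiece (flabel v (Empty.elim : Empty → Fin 2 → ℕ)) fturn → Prop :=
    Quot.lift (Sum.elim (fun a => W a.1) fun b => b.1.elim) (by
      rintro (a | ⟨⟨⟩, _⟩) e (he | rfl)
      · rcases (h.opp.iff _ _).1 he.symm with rfl | rfl
        · rfl
        · exact propext (hW a).symm
      · rfl)
  have := h.conn
  exact iff_of_eq (congrArg L (Subsingleton.elim (Quot.mk _ (Sum.inl (i, 0)))
    (Quot.mk _ (Sum.inl (j, 0)))))

lemma conn_arrows (h : AltMap v o) [Fintype I] [DecidableEq I] : Conn (arrows o) := by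
  intro T hT hT'
  by_contra hc
  obtain ⟨i, hi⟩ := hT
  exact hT' (eq_univ_iff_forall.2 fun j =>
    (h.iff_of_invariant (h.isAlt.mem_iff_of_cut hc) i j).1 hi)

end AltMap

/-! ### Capping one side of a two-edge cut by a marker -/

section

variable {v : I → Fin 4 → ℕ} {o : I × Fin 4 → I × Fin 4} {X : I → Prop} {p q : I × Fin 4}

/-- A face that leaves `X` along an edge returns along the other edge. -/
lemma TwoCut.face_eq [Finite I] (c : TwoCut o X p q) (h : AltMap v o) :
    face v q = face v (rot p) := by
  have hinv := h.isAlt.invol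
  by_contra hne
  -- If the claim fails, the face walk preserves the corners of the face of `q` outside `X`: it
  -- cannot enter `X` at `p` by `hne`, nor at `q` by parity.
  let Y := {a : I × Fin 4 // ¬ X a.1 ∧ face v a = face v q}
  have hmaps : ∀ a : Y, ¬ X (rot (o a.1)).1 ∧ face v (rot (o a.1)) = face v q := by
    rintro ⟨a, ha, ha'⟩
    refine ⟨fun hX => ?_, (h.face_rot_opp a).trans ha'⟩
    rcases c.eq (o a) hX (by rwa [hinv]) with h1 | h1
    · apply hne
      rw [← ha', ← h1, h.face_rot_opp]
    · have h2 := h.even_iff_of_face ha'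
      have h3 := h.alt a
      rw [h1] at h3
      tauto
  let φ : Y → Y := fun a => ⟨rot (o a.1), hmaps a⟩
  have hφ : Function.Injective φ := fun a b hab =>
    Subtype.ext (hinv.injective (rot_injective (congrArg Subtype.val hab)))
  -- An injective walk on a finite set is onto, but the only end that is sent to `rot (o q)` is `q`,
  -- which lies in `X`.
  obtain ⟨a, ha⟩ := (Finite.injective_iff_surjective.1 hφ)
    ⟨rot (o q), c.right', h.face_rot_opp q⟩
  have : a.1 = q := hinv.injective (rot_injective (congrArg Subtype.val ha))
  exact a.2.1 (by rw [this]; exact c.right)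

/-- The ends of the map that consists of the part in `X` and of one marker. The marker stands for
the rest of the map. -/
def capEmb (o : I × Fin 4 → I × Fin 4) (X : I → Prop) (p q : I × Fin 4) :
    FDart {i // X i} Unit → I × Fin 4
  | Sum.inl a => (a.1.1, a.2)
  | Sum.inr b => if b.2 = 0 then o p else o q

/-- The crossings in `X`, with labels changed by `σ`. -/
abbrev capCrossings (v : I → Fin 4 → ℕ) (X : I → Prop) (σ : ℕ → ℕ) : {i // X i} → Fin 4 → ℕ :=
  fun i k => σ (v i.1 k)

/-- The marker that joins the two edges which leave `X`. -/
abbrev capMarkers (v : I → Fin 4 → ℕ) (p q : I × Fin 4) (σ : ℕ → ℕ) : Unit → Fin 2 → ℕ :=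
  fun _ => ![σ (v p.1 p.2), σ (v q.1 q.2)]

/-- The labels of the part in `X`. -/
abbrev capLabel (v : I → Fin 4 → ℕ) (X : I → Prop) (p q : I × Fin 4) (σ : ℕ → ℕ) :
    FDart {i // X i} Unit → ℕ := flabel (capCrossings v X σ) (capMarkers v p q σ)

namespace TwoCut

lemma opp_ne_opp (c : TwoCut o X p q) (h : IsAlt o) : o p ≠ o q :=
  fun h1 => c.ne (h.invol.injective h1)

lemma capEmb_injective (c : TwoCut o X p q) (h : IsAlt o) :
    Function.Injective (capEmb o X p q) := by
  have hpq := c.opp_ne_opp h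
  have h1 := c.left'
  have h2 := c.right'
  have key : ∀ (a : {i // X i} × Fin 4) (b : Unit × Fin 2),
      capEmb o X p q (Sum.inl a) ≠ capEmb o X p q (Sum.inr b) := by
    rintro ⟨⟨i, hi⟩, k⟩ ⟨_, l⟩ he
    simp only [capEmb] at he
    split_ifs at he
    · rw [← he] at h1; exact h1 hi
    · rw [← he] at h2; exact h2 hi
  rintro (a | b) (a' | b') he
  · simp only [capEmb, Prod.mk.injEq] at he
    exact congrArg Sum.inl (Prod.ext (Subtype.ext he.1) he.2)
  · exact absurd he (key a b')
  · exact absurd he.symm (key a' b)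
  · obtain ⟨_, l⟩ := b
    obtain ⟨_, l'⟩ := b'
    fin_cases l <;> fin_cases l' <;> simp_all [capEmb]

lemma capLabel_eq (h : AltMap v o) (σ : ℕ → ℕ) (d : FDart {i // X i} Unit) :
    capLabel v X p q σ d = σ (v (capEmb o X p q d).1 (capEmb o X p q d).2) := by
  rcases d with a | ⟨_, l⟩
  · rfl
  · fin_cases l
    · exact congrArg σ ((h.label_iff p (o p)).2 (Or.inr rfl)).symm
    · exact congrArg σ ((h.label_iff q (o q)).2 (Or.inr rfl)).symm

/-- With the ends of the marker represented by `o p` and `o q`, the involution of the capped part is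
a restriction of `o`. -/
lemma exists_capOpp (c : TwoCut o X p q) (h : AltMap v o) {σ : ℕ → ℕ}
    (hσ : Function.Injective σ) :
    ∃ o' : FDart {i // X i} Unit → FDart {i // X i} Unit, IsOpp (capLabel v X p q σ) o' ∧
      ∀ d, o (capEmb o X p q d) = capEmb o X p q (o' d) := by
  have hex : ∀ d, ∃ e, o (capEmb o X p q d) = capEmb o X p q e := by
    rintro (⟨⟨i, hi⟩, k⟩ | ⟨_, l⟩)
    · by_cases hX : X (o (i, k)).1
      · exact ⟨Sum.inl (⟨_, hX⟩, (o (i, k)).2), rfl⟩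
      · rcases c.eq (i, k) hi hX with h1 | h1
        · exact ⟨Sum.inr ((), 0), by simp [capEmb, h1]⟩
        · exact ⟨Sum.inr ((), 1), by simp [capEmb, h1]⟩
    · fin_cases l
      · exact ⟨Sum.inl (⟨p.1, c.left⟩, p.2), h.isAlt.invol p⟩
      · exact ⟨Sum.inl (⟨q.1, c.right⟩, q.2), h.isAlt.invol q⟩
  choose o' ho' using hex
  refine ⟨o', ⟨fun d hd => ?_, fun d e => ?_⟩, ho'⟩
  · have := ho' d
    rw [hd] at this
    exact h.opp_ne _ this
  · rw [capLabel_eq h, capLabel_eq h, hσ.eq_iff, h.label_iff, ho',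
      (c.capEmb_injective h.isAlt).eq_iff, (c.capEmb_injective h.isAlt).eq_iff]

/-- At a crossing there is nothing to show. At the marker this is the geometric input: the faces
next to the two cut edges agree by `face_eq`. -/
lemma face_capEmb [Finite I] (c : TwoCut o X p q) (h : AltMap v o) (d : FDart {i // X i} Unit) :
    face v (capEmb o X p q (fturn d)) = face v (rot (capEmb o X p q d)) := by
  rcases d with a | ⟨_, l⟩
  · rfl
  · have h1 := c.face_eq h
    have h2 := c.symm.face_eq h
    fin_cases l
    · change face v (o q) = face v (rot (o p))
      rw [h.face_rot_opp, h2, h.face_rot]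
    · change face v (o p) = face v (rot (o q))
      rw [h.face_rot_opp, h1, h.face_rot]

lemma exists_capFace [Finite I] (c : TwoCut o X p q) (h : AltMap v o) {σ : ℕ → ℕ}
    (hσ : Function.Injective σ) :
    ∃ f : MapFace (capLabel v X p q σ) fturn → MapFace (flabel v Empty.elim) fturn,
      ∀ d, f (Quot.mk _ d) = face v (capEmb o X p q d) := by
  obtain ⟨o', ho', hoo⟩ := c.exists_capOpp h hσ
  refine ⟨Quot.lift (fun d => face v (capEmb o X p q d)) fun d e hde => ?_, fun d => rfl⟩
  rw [ho'.faceStep_iff] at hde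
  rw [hde, c.face_capEmb h, ← hoo, h.face_rot_opp]

/-- Everything outside `X` is contracted to the marker. The resulting map `κ` from crossings to
pieces is constant along edges, hence constant because the whole map is connected. -/
lemma subsingleton_capPiece (c : TwoCut o X p q) (h : AltMap v o) {σ : ℕ → ℕ}
    (hσ : Function.Injective σ) :
    Nat.card (MapPiece (capLabel v X p q σ) fturn) = 1 := by
  classical
  obtain ⟨o', ho', hoo⟩ := c.exists_capOpp h hσ
  let z : MapPiece (capLabel v X p q σ) fturn := Quot.mk _ (Sum.inr ((), 0))
  have ht : ∀ d, (Quot.mk _ (fturn d) : MapPiece (capLabel v X p q σ) fturn) = Quot.mk _ d :=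
    piece_turn
  have hz : ∀ b, (Quot.mk _ (Sum.inr b) : MapPiece (capLabel v X p q σ) fturn) = z := by
    rintro ⟨_, l⟩
    fin_cases l
    · rfl
    · exact ht (Sum.inr ((), 0))
  let κ : I → MapPiece (capLabel v X p q σ) fturn := fun i =>
    if hi : X i then Quot.mk _ (Sum.inl (⟨i, hi⟩, 0)) else z
  have hκz : ∀ i, ¬ X i → κ i = z := fun i hi => dif_neg hi
  have hκ : ∀ a : {i // X i} × Fin 4,
      (Quot.mk _ (Sum.inl a) : MapPiece (capLabel v X p q σ) fturn) = κ a.1.1 := by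
    rintro ⟨⟨i, hi⟩, k⟩
    simp only [κ, dif_pos hi]
    exact (piece_rep (v := capCrossings v X σ) (m := capMarkers v p q σ)
      (Sum.inl (⟨i, hi⟩, k))).symm
  have hκ' : ∀ d, (Quot.mk _ d : MapPiece (capLabel v X p q σ) fturn) =
      κ (capEmb o X p q d).1 := by
    rintro (a | ⟨_, l⟩)
    · exact hκ a
    · rw [hz]
      fin_cases l
      · exact (hκz _ c.left').symm
      · exact (hκz _ c.right').symm
  have hstep : ∀ a, X a.1 → κ (o a).1 = κ a.1 := by
    intro a ha
    have h1 := hoo (Sum.inl (⟨a.1, ha⟩, a.2))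
    change o a = _ at h1
    rw [h1, ← hκ', ho'.piece_opp, hκ]
  have hstep' : ∀ a, κ (o a).1 = κ a.1 := by
    intro a
    by_cases ha : X a.1
    · exact hstep a ha
    · by_cases ha' : X (o a).1
      · rw [← hstep (o a) ha', h.isAlt.invol]
      · exact (hκz _ ha').trans (hκz _ ha).symm
  have hconst : ∀ i, κ i = z := by
    intro i
    refine (h.iff_of_invariant (W := fun i => κ i = z) (fun a => by rw [hstep']) (o p).1 i).1 ?_
    exact hκz _ c.left'
  rw [Nat.card_eq_one_iff_unique]
  refine ⟨⟨?_⟩, ⟨z⟩⟩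
  rintro ⟨d⟩ ⟨e⟩
  rw [hκ', hκ', hconst, hconst]

/-- The two faces at the marker of the second part are distinct by parity, and they are seen again
at `p` and `q` in the first part. So the faces of both parts still cover those of the whole after
these two are dropped. -/
lemma card_capFace [Finite I] (c : TwoCut o X p q) (h : AltMap v o) {σ τ : ℕ → ℕ}
    (hσ : Function.Injective σ) (hτ : Function.Injective τ) :
    Nat.card (MapFace (flabel v Empty.elim) (fturn : FDart I Empty → _)) + 2 ≤
      Nat.card (MapFace (capLabel v X p q σ) fturn) +
        Nat.card (MapFace (capLabel v (fun i => ¬ X i) (o p) (o q) τ) fturn) := by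
  classical
  have hinv := h.isAlt.invol
  obtain ⟨f₁, hf₁⟩ := c.exists_capFace h hσ
  obtain ⟨f₂, hf₂⟩ := (c.compl h.isAlt).exists_capFace h hτ
  have := Fintype.ofFinite (MapFace (flabel v Empty.elim) (fturn : FDart I Empty → _))
  have := Fintype.ofFinite (MapFace (capLabel v X p q σ) fturn)
  have := Fintype.ofFinite (MapFace (capLabel v (fun i => ¬ X i) (o p) (o q) τ) fturn)
  let F := MapFace (capLabel v X p q σ) fturn ⊕
    MapFace (capLabel v (fun i => ¬ X i) (o p) (o q) τ) fturn
  let f : F → MapFace (flabel v Empty.elim) fturn := Sum.elim f₁ f₂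
  let m₀ : F := Sum.inr (Quot.mk _ (Sum.inr ((), 0)))
  let m₁ : F := Sum.inr (Quot.mk _ (Sum.inr ((), 1)))
  have e₀ : f m₀ = face v p := (hf₂ _).trans (congrArg (face v) (hinv p))
  have e₁ : f m₁ = face v q := (hf₂ _).trans (congrArg (face v) (hinv q))
  have hne : m₁ ≠ m₀ := by
    intro hm
    have := congrArg f hm
    rw [e₀, e₁] at this
    have h1 := h.even_iff_of_face this
    have h2 := c.alt
    tauto
  have hX : ∀ a : I × Fin 4, X a.1 → ∃ x ∈ (univ.erase m₀).erase m₁, f x = face v a := by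
    intro a ha
    exact ⟨Sum.inl (Quot.mk _ (Sum.inl (⟨a.1, ha⟩, a.2))), by simp [m₀, m₁], hf₁ _⟩
  have hsurj : Set.SurjOn f ((univ.erase m₀).erase m₁ : Finset F)
      ((univ : Finset (MapFace (flabel v Empty.elim) fturn)) : Set _) := by
    intro y _
    obtain ⟨a, rfl⟩ := face_surjective v y
    by_cases ha : X a.1
    · exact hX a ha
    · let x : F := Sum.inr (Quot.mk _ (Sum.inl (⟨a.1, ha⟩, a.2)))
      have hx : f x = face v a := hf₂ _
      by_cases h0 : x = m₀
      · rw [← hx, h0, e₀]; exact hX p c.left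
      · by_cases h1 : x = m₁
        · rw [← hx, h1, e₁]; exact hX q c.right
        · exact ⟨x, by simp [h0, h1], hx⟩
  have hcard := card_le_card_of_surjOn f hsurj
  rw [card_erase_of_mem (by simp [hne]), card_erase_of_mem (mem_univ _), card_univ, card_univ,
    Fintype.card_sum] at hcard
  have hpos : 2 ≤ Fintype.card F := by
    have : Nontrivial F := ⟨m₁, m₀, hne⟩
    exact Fintype.one_lt_card
  rw [Fintype.card_sum] at hpos
  simp only [Nat.card_eq_fintype_card]
  omega

/-- Both parts are planar. -/
lemma fPlanar_cap [Finite I] (c : TwoCut o X p q) (h : AltMap v o) {σ τ : ℕ → ℕ}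
    (hσ : Function.Injective σ) (hτ : Function.Injective τ) :
    FPlanar (capCrossings v X σ) (capMarkers v p q σ) ∧
      FPlanar (capCrossings v (fun i => ¬ X i) τ) (capMarkers v (o p) (o q) τ) := by
  classical
  obtain ⟨o₁, ho₁, -⟩ := c.exists_capOpp h hσ
  obtain ⟨o₂, ho₂, -⟩ := (c.compl h.isAlt).exists_capOpp h hτ
  -- All three maps are connected. The whole has two more faces than crossings, so the parts
  -- together have at least four more than crossings, which is the sum of their upper bounds.
  have c₁ : Nat.card (MapFace (capLabel v X p q σ) fturn) ≤ Nat.card {i // X i} + 2 * _ :=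
    card_face_le ho₁
  have c₂ : Nat.card (MapFace (capLabel v (fun i => ¬ X i) (o p) (o q) τ) fturn) ≤
    Nat.card {i // ¬ X i} + 2 * _ := card_face_le ho₂
  have cF := c.card_capFace h hσ hτ
  have p₁ := c.subsingleton_capPiece h hσ
  have p₂ := (c.compl h.isAlt).subsingleton_capPiece h hτ
  have cI : Nat.card I = Nat.card {i // X i} + Nat.card {i // ¬ X i} := by
    rw [← Nat.card_sum]
    exact Nat.card_congr (Equiv.sumCompl _).symm
  have p₀ : Nat.card (MapPiece (flabel v Empty.elim) (fturn : FDart I Empty → _)) = 1 := by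
    rw [Nat.card_eq_one_iff_unique]
    exact ⟨h.conn, ⟨Quot.mk _ (Sum.inl p)⟩⟩
  have hp := h.planar
  rw [FPlanar] at hp
  rw [p₀] at hp
  rw [p₁] at c₁
  rw [p₂] at c₂
  change Nat.card (MapFace (capLabel v X p q σ) fturn) = Nat.card {i // X i} + 2 * Nat.card _ ∧
    Nat.card (MapFace (capLabel v (fun i => ¬ X i) (o p) (o q) τ) fturn) =
      Nat.card {i // ¬ X i} + 2 * Nat.card _
  rw [p₁, p₂]
  omega

end TwoCut

end

end FourValent

/-! ### Cutting an alternating diagram along two edges -/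

namespace FourValent

open Finset TwoOut CombMap Code

variable {I : Type} {v : I → Fin 4 → ℕ} {o : I × Fin 4 → I × Fin 4} {X : I → Prop}
  {p q : I × Fin 4}

/-- Both parts of a reduced alternating map, closed up by a marker, are knotted. -/
lemma TwoCut.not_isUnknot [Fintype I] [Fintype {i // X i}] (c : TwoCut o X p q) (h : AltMap v o)
    {σ : ℕ → ℕ} (hσ : Function.Injective σ) {D : LinkDiagram}
    (hD : D.toCode.IsFam (capCrossings v X σ) (capMarkers v p q σ)) : ¬ D.IsUnknot := by
  classical
  -- The marker is suppressed: `u` joins `p` and `q` directly, and its arrows form the overpass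
  -- graph of the summand.
  obtain ⟨u, hu, hpq, hui⟩ := c.exists_cap h.isAlt
  have hne : Nonempty {i // X i} := ⟨⟨p.1, c.left⟩⟩
  have hX : ∀ a : {i // X i} × Fin 4, (a.1.1, a.2) ≠ p → (a.1.1, a.2) ≠ q →
      X (o (a.1.1, a.2)).1 := by
    intro a h1 h2
    by_contra h3
    exact (c.eq _ a.1.2 h3).elim h1 h2
  let lab : {i // X i} × Fin 4 → ℕ := fun a => σ (v a.1.1 a.2)
  -- Two different ends in `X` with one label are the ends of an uncut edge, on which `u` agrees
  -- with `o`.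
  have hfac : (FourValent.overpass u).FactorsThrough lab := by
    intro a b hab
    rcases (h.label_iff (a.1.1, a.2) (b.1.1, b.2)).1 (hσ hab).symm with h1 | h1
    · rw [Prod.mk.injEq] at h1
      rw [show b = a from Prod.ext (Subtype.ext h1.1) h1.2]
    · have hXo : X (o (a.1.1, a.2)).1 := by rw [← h1]; exact b.1.2
      have h2 : (a.1.1, a.2) ≠ p := fun h3 => c.left' (by rw [← h3]; exact hXo)
      have h3 : (a.1.1, a.2) ≠ q := fun h3 => c.right' (by rw [← h3]; exact hXo)
      have h4 := (hui a h2 h3).trans h1.symm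
      rw [Prod.mk.injEq] at h4
      rw [← show u a = b from Prod.ext (Subtype.ext h4.1) h4.2, hu.overpass_opp]
  let ov : ℕ → {i // X i} := Function.extend lab (FourValent.overpass u) fun _ => ⟨p.1, c.left⟩
  have hov : ∀ a, ov (lab a) = FourValent.overpass u a := fun a => hfac.extend_apply _ a
  have hcr : ∀ w ∈ D.crossings, ∃ i, w = capCrossings v X σ i := by
    intro w hw
    rw [← Multiset.mem_coe, hD.1, Multiset.mem_map] at hw
    obtain ⟨i, -, hi⟩ := hw
    exact ⟨i, hi.symm⟩
  have hmk : ∀ m ∈ D.markers, m = ![σ (v p.1 p.2), σ (v q.1 q.2)] := by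
    intro m hm
    rw [← Multiset.mem_coe, hD.2, Multiset.mem_map] at hm
    obtain ⟨i, -, hi⟩ := hm
    exact hi.symm
  -- The original map has no edge from a crossing to itself, so a loop must run along the new edge.
  -- As only one of `p` and `q` is an under-end, there is at most one such arrow.
  have hloop : ∀ e k, arrows u e k = e →
      ((under (e, k)).1.1, (under (e, k)).2) = p ∨ ((under (e, k)).1.1, (under (e, k)).2) = q := by
    intro e k he
    by_contra! hcon
    have h1 := hui _ hcon.1 hcon.2
    refine h.fst_opp_ne ((under (e, k)).1.1, (under (e, k)).2) ?_
    rw [← h1]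
    exact congrArg Subtype.val he
  have huniq : ∀ e k e' k', arrows u e k = e → arrows u e' k' = e' → (e, k) = (e', k') := by
    intro e k e' k' h1 h2
    have ev := even_under (e, k)
    have ev' := even_under (e', k')
    have key : ((under (e, k)).1.1, (under (e, k)).2) =
        ((under (e', k')).1.1, (under (e', k')).2) := by
      have halt := c.alt
      rcases hloop e k h1 with h3 | h3 <;> rcases hloop e' k' h2 with h4 | h4
      · exact h3.trans h4.symm
      · rw [← h3, ← h4] at halt; tauto
      · rw [← h3, ← h4] at halt; tauto
      · exact h3.trans h4.symm
    rw [Prod.mk.injEq] at key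
    exact under_injective (Prod.ext (Subtype.ext key.1) key.2)
  obtain ⟨ε, hε⟩ : ∃ ε, ∀ e k, arrows u e k = e → (e, k) = ε := by
    by_cases hex : ∃ e k, arrows u e k = e
    · obtain ⟨e, k, he⟩ := hex
      exact ⟨(e, k), fun e' k' h' => huniq _ _ _ _ h' he⟩
    · push Not at hex
      exact ⟨(⟨p.1, c.left⟩, 0), fun e k he => absurd he (hex e k)⟩
  have hconn : Conn (arrows u) := by
    intro U hU hU'
    by_contra hcut
    have hinv := hu.mem_iff_of_cut hcut
    have hpqU := hinv (⟨p.1, c.left⟩, p.2)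
    rw [hpq] at hpqU
    -- An invariant set of crossings in `X` is extended to the whole map by giving all outside
    -- crossings the status of `p`; connectedness of the whole then applies.
    let W : I → Prop := fun i => if hi : X i then (⟨i, hi⟩ : {i // X i}) ∈ U else ⟨p.1, c.left⟩ ∈ U
    have hWX : ∀ i (hi : X i), W i ↔ (⟨i, hi⟩ : {i // X i}) ∈ U := fun i hi => by simp [W, hi]
    have hWX' : ∀ i, ¬ X i → (W i ↔ ⟨p.1, c.left⟩ ∈ U) := fun i hi => by simp [W, hi]
    have hW1 : ∀ a, X a.1 → (W (o a).1 ↔ W a.1) := by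
      intro a ha
      by_cases h1 : a = p
      · rw [h1, hWX' _ c.left', hWX _ c.left]
      · by_cases h2 : a = q
        · rw [h2, hWX' _ c.right', hWX _ c.right]
          exact hpqU.symm
        · have h3 := hX (⟨a.1, ha⟩, a.2) h1 h2
          have h4 := hui (⟨a.1, ha⟩, a.2) h1 h2
          rw [hWX _ h3, hWX _ ha, ← hinv (⟨a.1, ha⟩, a.2)]
          rw [← show (u (⟨a.1, ha⟩, a.2)).1 = ⟨_, h3⟩ from Subtype.ext (congrArg Prod.fst h4)]
    have hW : ∀ a, W (o a).1 ↔ W a.1 := by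
      intro a
      by_cases ha : X a.1
      · exact hW1 a ha
      · by_cases ha' : X (o a).1
        · have := hW1 (o a) ha'
          rw [h.isAlt.invol] at this
          exact this.symm
        · rw [hWX' _ ha, hWX' _ ha']
    obtain ⟨i, hi⟩ := hU
    refine hU' (eq_univ_iff_forall.2 fun j => ?_)
    have := h.iff_of_invariant hW i.1 j.1
    rw [hWX _ i.2, hWX _ j.2] at this
    exact this.1 hi
  refine LinkDiagram.not_isUnknot_of_overpass hu.twoIn hconn hε ov ?_ ?_ ?_
  · intro w hw
    obtain ⟨i, rfl⟩ := hcr w hw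
    have h0 := hov (i, 0)
    have h1 := hov (i, 1)
    have h2 := hov (i, 2)
    have h3 := hov (i, 3)
    simp only [FourValent.overpass] at h0 h1 h2 h3
    rw [if_pos (by decide)] at h0 h2
    rw [if_neg (by decide)] at h1 h3
    simp only [lab] at h0 h1 h2 h3
    rw [h0, h1, h2, h3]
    exact ⟨rfl, rfl, rfl⟩
  · intro m hm
    rw [hmk m hm]
    have h0 := hov (⟨p.1, c.left⟩, p.2)
    have h1 := hov (⟨q.1, c.right⟩, q.2)
    rw [← hpq, hu.overpass_opp, ← h0, hpq] at h1
    exact h1.symm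
  · intro i
    refine ⟨capCrossings v X σ i 1, ?_, ?_⟩
    · refine Or.inl ⟨capCrossings v X σ i, ?_, 1, rfl⟩
      rw [← Multiset.mem_coe, hD.1, Multiset.mem_map]
      exact ⟨i, mem_univ_val _, rfl⟩
    · refine (hov (i, 1)).trans ?_
      simp [FourValent.overpass]

/-- The crossings of the map, where the labels outside `X` are changed by `σ`. -/
def glueCrossings (v : I → Fin 4 → ℕ) (X : I → Prop) [DecidablePred X] (σ : ℕ → ℕ) :
    I → Fin 4 → ℕ := fun i => if X i then v i else σ ∘ v i

/-- Markers on the two edges that leave `X`. -/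
def glueMarkers (x y : ℕ) (σ : ℕ → ℕ) : Option (Option Empty) → Fin 2 → ℕ
  | none => ![x, σ x]
  | some none => ![y, σ y]

/-- The change of labels only affects two edges, which get new labels. -/
structure IsFresh (v : I → Fin 4 → ℕ) (p q : I × Fin 4) (σ : ℕ → ℕ) : Prop where
  inj : Function.Injective σ
  left : ∀ i k, σ (v p.1 p.2) ≠ v i k
  right : ∀ i k, σ (v q.1 q.2) ≠ v i k
  eq : ∀ i k, v i k ≠ v p.1 p.2 → v i k ≠ v q.1 q.2 → σ (v i k) = v i k

lemma exists_isFresh [Finite I] (v : I → Fin 4 → ℕ) (p q : I × Fin 4)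
    (hpq : v p.1 p.2 ≠ v q.1 q.2) : ∃ σ, IsFresh v p q σ := by
  have hfin : (Set.range fun a : I × Fin 4 => v a.1 a.2).Finite := Set.finite_range _
  obtain ⟨N, hN⟩ := hfin.bddAbove
  have hN' : ∀ i k, v i k ≤ N := fun i k => hN ⟨(i, k), rfl⟩
  have h1 := hN' p.1 p.2
  have h2 := hN' q.1 q.2
  -- The labels of the two cut edges are exchanged with numbers beyond all labels in use.
  let σ := (Equiv.swap (v p.1 p.2) (N + 1)).trans (Equiv.swap (v q.1 q.2) (N + 2))
  have e1 : σ (v p.1 p.2) = N + 1 := by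
    simp only [σ, Equiv.trans_apply, Equiv.swap_apply_left]
    exact Equiv.swap_apply_of_ne_of_ne (by omega) (by omega)
  have e2 : σ (v q.1 q.2) = N + 2 := by
    simp only [σ, Equiv.trans_apply]
    rw [Equiv.swap_apply_of_ne_of_ne hpq.symm (by omega), Equiv.swap_apply_left]
  refine ⟨σ, σ.injective, fun i k => ?_, fun i k => ?_, fun i k h3 h4 => ?_⟩
  · rw [e1]; have := hN' i k; omega
  · rw [e2]; have := hN' i k; omega
  · have := hN' i k
    simp only [σ, Equiv.trans_apply]
    rw [Equiv.swap_apply_of_ne_of_ne h3 (by omega), Equiv.swap_apply_of_ne_of_ne h4 (by omega)]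

namespace TwoCut

lemma label_ne (c : TwoCut o X p q) (h : AltMap v o) : v p.1 p.2 ≠ v q.1 q.2 := by
  intro he
  rcases (h.label_iff p q).1 he.symm with h1 | h1
  · exact c.ne h1.symm
  · exact c.left' (by rw [← h1]; exact c.right)

/-- The parts have only the labels of the two cut edges in common, and `σ` renames exactly these in
the second part. -/
lemma label_ne_label (c : TwoCut o X p q) (h : AltMap v o) {σ : ℕ → ℕ} (hσ : IsFresh v p q σ)
    {a b : I × Fin 4} (ha : X a.1 ∨ a = o p ∨ a = o q) (hb : ¬ X b.1 ∨ b = p ∨ b = q) :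
    v a.1 a.2 ≠ σ (v b.1 b.2) := by
  intro he
  have h1 : v b.1 b.2 ≠ v p.1 p.2 := fun h1 => hσ.left _ _ (by rw [he, h1])
  have h2 : v b.1 b.2 ≠ v q.1 q.2 := fun h2 => hσ.right _ _ (by rw [he, h2])
  rw [hσ.eq _ _ h1 h2] at he
  have hb' : ¬ X b.1 := by
    rcases hb with hb | rfl | rfl
    · exact hb
    · exact absurd rfl h1
    · exact absurd rfl h2
  rw [← he, Ne, h.label_iff, not_or] at h1 h2
  have ha' : X a.1 := by
    rcases ha with ha | ha | ha
    · exact ha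
    · exact absurd ha h1.2
    · exact absurd ha h2.2
  rcases (h.label_iff a b).1 he.symm with rfl | rfl
  · exact hb' ha'
  · exact (c.eq a ha' hb').elim h1.1 h2.1

/-- The ends of the map with two markers are ends in the first part or ends in the second part. -/
def glueEmb (o : I × Fin 4 → I × Fin 4) (X : I → Prop) [DecidablePred X] (p q : I × Fin 4) :
    FDart I (Option (Option Empty)) → (I × Fin 4) ⊕ (I × Fin 4)
  | Sum.inl a => if X a.1 then Sum.inl a else Sum.inr a
  | Sum.inr (none, k) => if k = 0 then Sum.inl (o p) else Sum.inr p
  | Sum.inr (some none, k) => if k = 0 then Sum.inl (o q) else Sum.inr q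

variable [DecidablePred X]

lemma glueEmb_inl (a : I × Fin 4) :
    (∃ d, glueEmb o X p q d = Sum.inl a) ↔ X a.1 ∨ a = o p ∨ a = o q := by
  constructor
  · rintro ⟨b | ⟨_ | _ | ⟨⟨⟩⟩, k⟩, hd⟩ <;> simp only [glueEmb] at hd <;> split_ifs at hd <;> grind
  · rintro (ha | rfl | rfl)
    · exact ⟨Sum.inl a, by simp [glueEmb, ha]⟩
    · exact ⟨Sum.inr (none, 0), rfl⟩
    · exact ⟨Sum.inr (some none, 0), rfl⟩

lemma glueEmb_inr (a : I × Fin 4) :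
    (∃ d, glueEmb o X p q d = Sum.inr a) ↔ ¬ X a.1 ∨ a = p ∨ a = q := by
  constructor
  · rintro ⟨b | ⟨_ | _ | ⟨⟨⟩⟩, k⟩, hd⟩ <;> simp only [glueEmb] at hd <;> split_ifs at hd <;> grind
  · rintro (ha | rfl | rfl)
    · exact ⟨Sum.inl a, by simp [glueEmb, ha]⟩
    · exact ⟨Sum.inr (none, 1), rfl⟩
    · exact ⟨Sum.inr (some none, 1), rfl⟩

lemma glueEmb_injective (c : TwoCut o X p q) (h : IsAlt o) :
    Function.Injective (glueEmb o X p q) := by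
  have h1 := c.ne
  have h2 := c.opp_ne_opp h
  have h3 := c.left
  have h4 := c.right
  have h5 := c.left'
  have h6 := c.right'
  have hk : ∀ k : Fin 2, k ≠ 0 → k = 1 := by decide
  rintro (a | ⟨_ | _ | ⟨⟨⟩⟩, k⟩) (b | ⟨_ | _ | ⟨⟨⟩⟩, l⟩) he <;> simp only [glueEmb] at he <;>
    split_ifs at he <;> grind

lemma glueLabel_eq (h : AltMap v o) {σ : ℕ → ℕ} (d : FDart I (Option (Option Empty))) :
    flabel (glueCrossings v X σ) (glueMarkers (v p.1 p.2) (v q.1 q.2) σ) d =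
      Sum.elim (fun a => v a.1 a.2) (fun a => σ (v a.1 a.2)) (glueEmb o X p q d) := by
  have hp := (h.label_iff p (o p)).2 (Or.inr rfl)
  have hq := (h.label_iff q (o q)).2 (Or.inr rfl)
  rcases d with a | ⟨_ | _ | ⟨⟨⟩⟩, k⟩
  · simp only [flabel, glueCrossings, glueEmb]
    split_ifs <;> rfl
  · fin_cases k
    · exact hp.symm
    · rfl
  · fin_cases k
    · exact hq.symm
    · rfl

/-- A marker divides each cut edge into an edge of the first part and one of the second, so the
involution comes from two separate copies of `o`. -/
lemma exists_glueOpp (c : TwoCut o X p q) (h : AltMap v o) {σ : ℕ → ℕ} (hσ : IsFresh v p q σ) :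
    ∃ o', IsOpp (flabel (glueCrossings v X σ) (glueMarkers (v p.1 p.2) (v q.1 q.2) σ)) o' := by
  have hinv := h.isAlt.invol
  have hex : ∀ d, ∃ e, Sum.map o o (glueEmb o X p q d) = glueEmb o X p q e := by
    intro d
    rcases hd : glueEmb o X p q d with a | a
    · have ha := (glueEmb_inl a).1 ⟨d, hd⟩
      obtain ⟨e, he⟩ := (glueEmb_inl (o := o) (X := X) (p := p) (q := q) (o a)).2 (by
        rcases ha with ha | rfl | rfl
        · by_cases h1 : X (o a).1
          · exact Or.inl h1
          · rcases c.eq a ha h1 with rfl | rfl <;> simp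
        · rw [hinv]; exact Or.inl c.left
        · rw [hinv]; exact Or.inl c.right)
      exact ⟨e, he.symm⟩
    · have ha := (glueEmb_inr a).1 ⟨d, hd⟩
      obtain ⟨e, he⟩ := (glueEmb_inr (o := o) (X := X) (p := p) (q := q) (o a)).2 (by
        rcases ha with ha | rfl | rfl
        · by_cases h1 : X (o a).1
          · rcases c.eq (o a) h1 (by rwa [hinv]) with h2 | h2 <;> simp [h2]
          · exact Or.inl h1
        · exact Or.inl c.left'
        · exact Or.inl c.right')
      exact ⟨e, he.symm⟩
  choose o' ho' using hex
  have hg := c.glueEmb_injective h.isAlt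
  refine ⟨o', fun d hd => ?_, fun d e => ?_⟩
  · have h1 := ho' d
    rw [hd] at h1
    generalize glueEmb o X p q d = x at h1
    rcases x with a | a
    · exact h.opp_ne a (Sum.inl_injective h1)
    · exact h.opp_ne a (Sum.inr_injective h1)
  · rw [glueLabel_eq (p := p) (q := q) h, glueLabel_eq (p := p) (q := q) h,
      ← hg.eq_iff (a := e) (b := d), ← hg.eq_iff (a := e) (b := o' d), ← ho']
    rcases hd : glueEmb o X p q d with a | a <;> rcases he : glueEmb o X p q e with b | b <;>
      simp only [Sum.elim_inl, Sum.elim_inr, Sum.map_inl, Sum.map_inr, Sum.inl.injEq,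
        Sum.inr.injEq, reduceCtorEq, or_self, iff_false, hσ.inj.eq_iff, h.label_iff]
    · exact (c.label_ne_label h hσ ((glueEmb_inl a).1 ⟨d, hd⟩) ((glueEmb_inr b).1 ⟨e, he⟩)).symm
    · exact c.label_ne_label h hσ ((glueEmb_inl b).1 ⟨e, he⟩) ((glueEmb_inr a).1 ⟨d, hd⟩)

/-- Merging each fresh label with the old one undoes `σ`, so deleting both markers recovers the
original crossings. -/
lemma merge_glue (c : TwoCut o X p q) (h : AltMap v o) {σ : ℕ → ℕ} (hσ : IsFresh v p q σ) (i : I) :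
    mergeLabel (v q.1 q.2) (σ (v q.1 q.2)) ∘
      (mergeLabel (v p.1 p.2) (σ (v p.1 p.2)) ∘ glueCrossings v X σ i) = v i := by
  have hpq := c.label_ne h
  have hpq' := hσ.inj.ne hpq
  have h1 := hσ.left p.1 p.2
  have h2 := hσ.right p.1 p.2
  funext k
  have h3 := (hσ.left i k).symm
  have h4 := (hσ.right i k).symm
  simp only [Function.comp_apply, glueCrossings]
  by_cases hi : X i
  · simp [hi, mergeLabel, h3, h4]
  · simp only [hi, if_false, Function.comp_apply]
    by_cases e1 : v i k = v p.1 p.2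
    · rw [e1]
      simp [mergeLabel, h2.symm]
    · by_cases e2 : v i k = v q.1 q.2
      · rw [e2]
        simp [mergeLabel, hpq'.symm]
      · rw [hσ.eq i k e1 e2]
        simp [mergeLabel, h3, h4]

end TwoCut

end FourValent

/-! ### Reduced alternating diagrams of prime links -/

namespace LinkDiagram

open Finset TwoOut CombMap Code FourValent

/-- A code without markers is presented by its crossings. -/
def presentsOfNil {C : Code} (hm : C.markers = []) :
    C.Presents C.crossings.get (Empty.elim : Empty → Fin 2 → ℕ) :=
  have : IsEmpty (Fin C.markers.length) := by rw [hm]; exact Fin.isEmpty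
  ⟨Equiv.refl _, fun _ => rfl, Equiv.equivOfIsEmpty _ _, fun j => j.elim⟩

lemma exists_altMap {D : LinkDiagram} (hm : D.markers = [])
    (hs : Subsingleton (MapPiece D.label D.turn)) (hr : D.IsReduced) (ha : D.IsAlternating) :
    ∃ o, AltMap D.crossings.get o := by
  have P := presentsOfNil hm
  obtain ⟨o', ho'⟩ := P.isClosed_iff.1 D.closed
  have hex : ∀ a, ∃ b, o' (Sum.inl a) = Sum.inl b := by
    intro a
    rcases o' (Sum.inl a) with b | ⟨⟨⟩, _⟩
    exact ⟨b, rfl⟩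
  choose o ho using hex
  have hoo : o' = Sum.map o id := by
    funext d
    rcases d with a | ⟨⟨⟩, _⟩
    exact ho a
  rw [hoo] at ho'
  refine ⟨o, ho', fun a => ?_, (isReduced_iff P).1 hr, ?_, P.isPlanar_iff.1 D.planar⟩
  · have h1 := (isAlternating_iff P).1 ha a.1 (o a).1 a.2 (o a).2
      (fun he => ho'.ne (Sum.inl a) (congrArg Sum.inl he.symm))
      (Quot.sound (Or.inl (ho'.lab_opp (Sum.inl a)).symm))
    rw [← h1, Nat.not_even_iff_odd]
  · have h1 := card_piece_congr P.dart P.label_dart P.turn_dart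
    have h2 := Finite.card_le_one_iff_subsingleton.2 hs
    exact Finite.card_le_one_iff_subsingleton.1 (h1.trans_le h2)

/-- Without markers, an arc of an alternating diagram consists of the over-strand at one crossing
and the two edges adjoining it. The map `overpass` names this crossing and gives the inverse of
`overArc`. -/
lemma isOverpassGraph_arrows {D : LinkDiagram} (hm : D.markers = [])
    {o : D.Crossing × Fin 4 → D.Crossing × Fin 4} (h : AltMap D.crossings.get o) :
    D.IsOverpassGraph (arrows o) := by
  have hemp : IsEmpty (Fin D.markers.length) := by rw [hm]; exact Fin.isEmpty
  let ov : D.Arc → D.Crossing := Quot.lift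
    (Sum.elim (FourValent.overpass o) fun b => isEmptyElim b.1) (by
      rintro (a | ⟨m, _⟩) (b | ⟨m, _⟩) hab
      · rcases hab with (hl | ⟨m, -⟩) | ⟨c, h1, h2⟩
        · rcases (h.label_iff a b).1 hl.symm with rfl | rfl
          · rfl
          · exact (h.isAlt.overpass_opp a).symm
        · exact isEmptyElim m
        · cases h1
          cases h2
          simp [FourValent.overpass, show ¬ Even 3 by decide]
      · exact isEmptyElim m
      · exact isEmptyElim m
      · exact isEmptyElim m)
  have hodd : ∀ a : D.Crossing × Fin 4, ¬ Even a.2.val → D.arcOf (Sum.inl a) = D.overArc a.1 := by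
    rintro ⟨i, k⟩ hk
    fin_cases k
    · simp at hk
    · rfl
    · simp at hk
    · exact (Quot.sound (r := D.ArcStep) (Or.inr ⟨i, rfl, rfl⟩)).symm
  have heven : ∀ a : D.Crossing × Fin 4, Even a.2.val →
      D.arcOf (Sum.inl a) = D.overArc (o a).1 := by
    intro a hk
    rw [← hodd (o a) (by rw [h.alt]; exact not_not.2 hk)]
    exact Quot.sound (Or.inl (Or.inl ((h.label_iff a (o a)).2 (Or.inr rfl)).symm))
  refine ⟨⟨fun i j hij => congrArg ov hij, ?_⟩, fun c => heven (c, 0) (by simp),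
    fun c => heven (c, 2) (by simp), h.isAlt.twoIn⟩
  rintro ⟨a | ⟨m, _⟩⟩
  · by_cases hk : Even a.2.val
    · exact ⟨_, (heven a hk).symm⟩
    · exact ⟨_, (hodd a hk).symm⟩
  · exact isEmptyElim m

/-- Two edges that separate a reduced alternating diagram decompose it as a connected sum of
nontrivial links. -/
lemma exists_isConnectedSum {D : LinkDiagram} (hm : D.markers = [])
    {o : D.Crossing × Fin 4 → D.Crossing × Fin 4} (h : AltMap D.crossings.get o)
    {X : D.Crossing → Prop} {p q : D.Crossing × Fin 4} (c : TwoCut o X p q) :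
    ∃ D' D₁ D₂ : LinkDiagram, D.SameLink D' ∧ IsConnectedSum D' D₁ D₂ ∧ ¬ D₁.IsUnknot ∧
      ¬ D₂.IsUnknot := by
  classical
  let v : D.Crossing → Fin 4 → ℕ := D.crossings.get
  obtain ⟨σ, hσ⟩ := exists_isFresh v p q (c.label_ne h)
  have c' := c.compl h.isAlt
  obtain ⟨hp₁, hp₂⟩ := c.fPlanar_cap h Function.injective_id hσ.inj
  obtain ⟨o₁, ho₁, -⟩ := c.exists_capOpp h Function.injective_id
  obtain ⟨o₂, ho₂, -⟩ := c'.exists_capOpp h hσ.inj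
  obtain ⟨o', ho'⟩ : ∃ o', IsOpp (flabel (glueCrossings v X σ)
    (glueMarkers (v p.1 p.2) (v q.1 q.2) σ)) o' := c.exists_glueOpp h hσ
  generalize hx : v p.1 p.2 = x at *
  generalize hy : v q.1 q.2 = y at *
  have hox : v (o p).1 (o p).2 = x := by rw [← hx]; exact (h.label_iff p (o p)).2 (Or.inr rfl)
  have hoy : v (o q).1 (o q).2 = y := by rw [← hy]; exact (h.label_iff q (o q)).2 (Or.inr rfl)
  have hxy : x ≠ y := by rw [← hx, ← hy]; exact c.label_ne h
  have hxσ : x ≠ σ x := by rw [← hx]; exact (hσ.left _ _).symm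
  have hyσ : y ≠ σ y := by rw [← hy]; exact (hσ.right _ _).symm
  have hyx : y ≠ σ x := by rw [← hx, ← hy]; exact (hσ.left _ _).symm
  let L₁ := (univ : Finset {i // X i}).toList.map (capCrossings v X id)
  let L₂ := (univ : Finset {i // ¬ X i}).toList.map (capCrossings v (fun i => ¬ X i) σ)
  have hL₁ : (L₁ : Multiset (Fin 4 → ℕ)) = univ.val.map (capCrossings v X id) := by
    rw [← Multiset.map_coe, coe_toList]
  have hL₂ : (L₂ : Multiset (Fin 4 → ℕ)) = univ.val.map (capCrossings v (fun i => ¬ X i) σ) := by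
    rw [← Multiset.map_coe, coe_toList]
  have hC₁ : IsFam ⟨L₁, [![x, y]]⟩ (capCrossings v X id) (capMarkers v p q id) := by
    refine ⟨hL₁, ?_⟩
    rw [← hx, ← hy]
    rfl
  have hC₂ : IsFam ⟨L₂, [![σ x, σ y]]⟩ (capCrossings v (fun i => ¬ X i) σ)
      (capMarkers v (o p) (o q) σ) := by
    refine ⟨hL₂, ?_⟩
    rw [← hox, ← hoy]
    rfl
  have hL : ((L₁ ++ L₂ : List (Fin 4 → ℕ)) : Multiset (Fin 4 → ℕ)) =
      univ.val.map (glueCrossings v X σ) := by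
    rw [← Multiset.coe_add, hL₁, hL₂, ← univ_val_map_subtype X (glueCrossings v X σ)]
    congr 2
    · funext i
      exact (if_pos i.2).symm
    · funext i
      exact (if_neg i.2).symm
  have hC' : IsFam ⟨L₁ ++ L₂, [![x, σ x], ![y, σ y]]⟩ (glueCrossings v X σ)
      (glueMarkers x y σ) := ⟨hL, rfl⟩
  obtain ⟨p', q', hM⟩ := exists_isMark ho' hxσ rfl
  obtain ⟨o'', ho'', -⟩ := hM.exists_unmark_opp
  have hmerge : mergeLabel x (σ x) ∘ ![y, σ y] = ![y, σ y] := by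
    have := hσ.inj.ne hxy
    funext k
    fin_cases k
    · simp [mergeLabel, hyx]
    · simp [mergeLabel, this.symm]
  obtain ⟨p'', q'', hM'⟩ := exists_isMark (a := y) (b := σ y) ho'' hyσ hmerge
  obtain ⟨o₀, ho₀, -⟩ := hM'.exists_unmark_opp
  have hfinal : (fun i => mergeLabel y (σ y) ∘ (mergeLabel x (σ x) ∘ glueCrossings v X σ i)) = v := by
    funext i
    rw [← hx, ← hy]
    exact c.merge_glue h hσ i
  -- Planarity is pulled back from the given diagram through the two deletions of markers.
  have hpl'' := hM'.fPlanar_iff.1 (by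
    rw [hfinal]
    convert h.planar using 1)
  have hpl' := hM.fPlanar_iff.1 hpl''
  have hC'' : IsFam ⟨(L₁ ++ L₂).map (fun w => mergeLabel x (σ x) ∘ w),
      [![y, σ y]].map (fun w => mergeLabel x (σ x) ∘ w)⟩
      (fun i => mergeLabel x (σ x) ∘ glueCrossings v X σ i)
      (fun j => mergeLabel x (σ x) ∘ glueMarkers x y σ (some j)) := by
    refine ⟨?_, rfl⟩
    rw [← Multiset.map_coe, hL, Multiset.map_map]
    rfl
  have hC₀ : IsFam ⟨((L₁ ++ L₂).map (fun w => mergeLabel x (σ x) ∘ w)).map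
      (fun w => mergeLabel y (σ y) ∘ w), []⟩ v (Empty.elim : Empty → Fin 2 → ℕ) := by
    refine ⟨?_, rfl⟩
    rw [← Multiset.map_coe, hC''.1, Multiset.map_map]
    exact congrArg (fun f => univ.val.map f) hfinal
  have hD : D.toCode.IsFam v (Empty.elim : Empty → Fin 2 → ℕ) :=
    ⟨(isFam_self D.toCode).1, by rw [hm]; rfl⟩
  let D₁ : LinkDiagram := ⟨_, hC₁.closed ho₁, hC₁.planar hp₁⟩
  let D₂ : LinkDiagram := ⟨_, hC₂.closed ho₂, hC₂.planar hp₂⟩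
  let D' : LinkDiagram := ⟨_, hC'.closed ho', hC'.planar hpl'⟩
  let D'' : LinkDiagram := ⟨_, hC''.closed ho'', hC''.planar hpl''⟩
  let D₀ : LinkDiagram := ⟨_, hC₀.closed h.opp, hC₀.planar h.planar⟩
  have s₁ : D.SameLink D₀ := SameLink.of_move (hD.move hC₀)
  have s₂ : D''.SameLink D₀ := by
    refine SameLink.of_move ?_
    have := Move.unmark y (σ y) hyσ ((L₁ ++ L₂).map (fun w => mergeLabel x (σ x) ∘ w)) []
    rw [← hmerge] at this
    exact this
  have s₃ : D'.SameLink D'' :=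
    SameLink.of_move (Move.unmark x (σ x) hxσ (L₁ ++ L₂) [![y, σ y]])
  refine ⟨D', D₁, D₂, ?_, ⟨x, y, σ x, σ y, [], [], rfl, rfl, rfl, rfl⟩,
    c.not_isUnknot h Function.injective_id hC₁, c'.not_isUnknot h hσ.inj hC₂⟩
  exact s₁.trans _ _ _ ((s₃.trans _ _ _ s₂).symm _ _)

/-- Connectedness provides one leaving arrow, and a single one would decompose the prime link into
two knotted summands. -/
lemma RepresentsPrimeLink.two_le_cut {D D₀ : LinkDiagram} (hD : D.RepresentsPrimeLink)
    (hs : D.SameLink D₀) (hm : D₀.markers = [])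
    {o : D₀.Crossing × Fin 4 → D₀.Crossing × Fin 4} (h : AltMap D₀.crossings.get o)
    (T : Finset D₀.Crossing) (hT : T.Nonempty) (hT' : T ≠ univ) : 2 ≤ cut (arrows o) T := by
  have h1 := h.conn_arrows T hT hT'
  by_contra hlt
  obtain ⟨p, q, c⟩ := h.isAlt.exists_twoCut (T := T) (by omega)
  obtain ⟨D', D₁, D₂, h2, h3, h4, h5⟩ := exists_isConnectedSum hm h c
  exact (hD.2.2.2 D' D₁ D₂ (hs.trans _ _ _ h2) h3).elim h4 h5

/-- The overpass graph of a reduced alternating diagram of a prime link is 2-connected. -/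
lemma exists_isOverpassGraph {D : LinkDiagram} (hred : D.IsReduced) (halt : D.IsAlternating)
    (hprime : D.RepresentsPrimeLink) :
    ∃ s, D.IsOverpassGraph s ∧
      ∀ T : Finset D.Crossing, T.Nonempty → T ≠ univ → 2 ≤ cut s T := by
  obtain ⟨D₀, hs, hm, hsub⟩ := hprime.exists_simplifies
  obtain ⟨o, ho⟩ := exists_altMap hm hsub (hs.reduced hred) (hs.alternating halt)
  have hG := isOverpassGraph_arrows hm ho
  obtain ⟨e, f, hf⟩ := hs.arcs
  have hfe : ∀ c, D.overArc c = f.symm (D₀.overArc (e c)) := fun c => by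
    rw [← (hf c).1, f.symm_apply_apply]
  -- The overpass graph of the simplified diagram is transported along the bijections of crossings
  -- and arcs.
  refine ⟨fun c k => e.symm (arrows o (e c) k), ⟨?_, fun c => ?_, fun c => ?_, fun j => ?_⟩,
    fun T hT hT' => ?_⟩
  · rw [show D.overArc = f.symm ∘ D₀.overArc ∘ e from funext hfe]
    exact f.symm.bijective.comp (hG.bij.comp e.bijective)
  · apply f.injective
    rw [(hf c).2.1, (hf _).1, hG.under, e.apply_symm_apply]
  · apply f.injective
    rw [(hf c).2.2, (hf _).1, hG.under', e.apply_symm_apply]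
  · rw [← hG.twoIn (e j)]
    refine Fintype.sum_equiv (e.prodCongr (Equiv.refl _)) _ _ fun x => ?_
    simp only [Equiv.symm_apply_eq]
    rfl
  · have hcut := hprime.two_le_cut hs.same hm ho (T.map e.toEmbedding) (hT.map) (fun h1 => hT' ?_)
    · refine hcut.trans_eq (Fintype.sum_equiv (e.prodCongr (Equiv.refl _)) _ _ fun x => ?_).symm
      simp only [mem_map_equiv, Equiv.prodCongr_apply, Prod.map_fst, Equiv.symm_apply_apply]
      rfl
    · refine eq_univ_iff_forall.2 fun c => ?_
      have := eq_univ_iff_forall.1 h1 (e c)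
      simpa using this

end LinkDiagram

theorem theorem3p4 (D : LinkDiagram) (hred : D.IsReduced) (halt : D.IsAlternating)
    (hprime : D.RepresentsPrimeLink) :
    -- every arc is the over-arc at exactly one crossing
    Function.Bijective D.overArc ∧
    (∀ b : D.Crossing,
      (D.reducedCrossingMatrix b).det ≠ 0 ∧
      0 < D.annihilator (D.overArc b) ∧
      -- `L` is the integral matrix `n₁ C(D)⁻¹`, and `y k` is its column `k` mod `n₁`, extended by
      -- the color `0` on the base arc
      (∃ (L : Matrix {i : D.Crossing // i ≠ b} {i : D.Crossing // i ≠ b} ℤ)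
          (y : {i : D.Crossing // i ≠ b} → D.Arc → ZMod (D.annihilator (D.overArc b))),
        L.map (Int.cast : ℤ → ℚ) =
          (D.annihilator (D.overArc b) : ℚ) •
            ((D.reducedCrossingMatrix b).map (Int.cast : ℤ → ℚ))⁻¹ ∧
        (∀ k, y k (D.overArc b) = 0 ∧ (∀ i, y k (D.overArc i.val) = (L i k : ZMod _)) ∧
          D.IsFoxColoring _ (y k)) ∧
        ∀ a a' : D.Arc, a ≠ a' → ∃ k, y k a ≠ y k a') ∧
      -- colorings modulo the determinant of the link
      (∃ (t : ℕ) (z : Fin t → D.Arc → ZMod (D.reducedCrossingMatrix b).det.natAbs),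
        (∀ k, D.IsFoxColoring _ (z k)) ∧
        ∀ a a' : D.Arc, a ≠ a' → ∃ k, z k a ≠ z k a')) ∧
    -- different arcs give different elements of the universal group of Fox colorings
    Function.Injective D.colClass := by
  obtain ⟨s, hs, hc⟩ := LinkDiagram.exists_isOverpassGraph hred halt hprime
  exact hs.conclusion hc
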